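/- Let $\mathcal X$ be a finite-dimensional real inner product space. Write $z\langle z,\cdot\rangle$ for the operator $x\mapsto z\langle z,x\rangle$, and equip the linear operators on $\mathcal X$ with $\langle A,B\rangle=\operatorname{tr}(AB^*)$. Let $\mathcal H$ be a linear space of self-adjoint operators on $\mathcal X$ such that $I\in\mathcal H$, $HFH\in\mathcal H$ for all $H,F\in\mathcal H$, and the orthogonal projection $\operatorname{proj}_{\mathcal H}$ maps positive definite operators to positive definite operators. Put $$\|x\|_{\mathcal H}=\bigl\|\sqrt{\operatorname{proj}_{\mathcal H}(x\langle x,\cdot\rangle)}\bigr\|_{\mathrm{op}},\qquad \|x\|_{*}=\bigl\|\sqrt{\operatorname{proj}_{\mathcal H}(x\langle x,\cdot\rangle)}\bigr\|_{\mathrm{tr}} .$$ For differentiable $f:\mathcal X\to\mathbb R$, a point $\hat x$ is *$(\gamma,\epsilon)$-stationary* if there is a probability distribution $\mathcal P$ on $\mathcal X$ with $\mathbb E_{z\sim\mathcal P}[z]=\hat x$, $\|\mathbb E_{z\sim\mathcal P}[\nabla f(z)]\|_*\le\epsilon$ and $\mathbb E_{z\sim\mathcal P}\|z-\hat x\|_{\mathcal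 H}\le\gamma$. Let $f$ be differentiable and bounded below, and let $\nabla_\xi f(x)$, $\xi\sim\mathcal D$, be a jointly measurable stochastic gradient with $\mathbb E_\xi[\nabla_\xi f(x)]=\nabla f(x)$ and $\mathbb E_\xi\|\nabla_\xi f(x)\|_{B^{-1}}^2\le G^2$ for all $x$, where $G>0$, $\|v\|_{B^{-1}}^2=\langle v,B^{-1}v\rangle$, and $B\in\mathcal H$ is positive definite with $\|B\|_{\mathrm{tr}}=1$. *Algorithm.* Parameters: $\beta\in(0,1)$, $\eta,\delta>0$, $N\ge1$, and an initial point $w_{-1}=x_0\in\mathcal X$. Start with $\Delta_0=0$, $m_{-1}=0$, $S_{-1}=\delta^2I$. For $k=0,\dots,N-1$, sample independently $s_k\sim\mathrm{Exp}(1)$ and $\xi_k\sim\mathcal D$ and set $$w_k=w_{k-1}+s_k\Delta_k,\quad g_k=\beta^{-k}\,\nabla_{\xi_k}f(w_k),\quad m_k=m_{k-1}+g_k,\quad S_k=S_{k-1}+\operatorname{proj}_{\mathcal H}(g_k\langle g_k,\cdot\rangle),$$ $$\Delta_{k+1}=-\nabla\Psi_k^*(m_k),\qquad \Psi_k^*(m)=\eta\,\bigl\|\sqrt{\operatorname{proj}_{\mathcal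 H}(m\langle m,\cdot\rangle)+S_k}\bigr\|_{\mathrm{tr}} .$$ Output $\hat x=\bar w_\tau$, where $\bar w_n=\frac{1-\beta}{1-\beta^{n+1}}\sum_{k=0}^{n}\beta^{n-k}w_k$ and $\tau\in\{0,\dots,N-1\}$ is independent of all $(\xi_k,s_k)$, with $\Pr(\tau=n)=\frac{1-\beta^{n+1}}{N}$ for $n<N-1$ and $\Pr(\tau=N-1)=\frac{1-\beta^{N}}{(1-\beta)N}$. **Theorem.** For every $p\in(0,1)$ there is a constant $C>0$, depending only on $p$, such that for all $G,\gamma,\epsilon>0$ there are $\beta\in(0,1)$ and $\eta>0$, depending only on $p,G,\gamma,\epsilon$, with the following property. For all $\mathcal X,\mathcal H,B,f,\mathcal D,\nabla_\xi f$ as above, all $x_0\in\mathcal X$, all $\delta>0$ and every number of iterations $$N\;\ge\;C\left[\frac{\Delta G^2}{\gamma\epsilon^{3}}+\frac{G^2}{\epsilon^{2}}+\frac{\delta\dim\mathcal X}{\epsilon}\right],\qquad \Delta=f(x_0)-\inf_x f(x),$$ the following holds. 1. The output $\hat x$ is $(\gamma,\epsilon)$-stationary in expectation: there is a random distribution $\mathcal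 P$ (a Markov kernel from the probability space of the algorithm to $\mathcal X$) with mean $\hat x$ almost surely, $\mathbb E\,\|\mathbb E_{z\sim\mathcal P}[\nabla f(z)]\|_*\le\epsilon$ and $\mathbb E\,\mathbb E_{z\sim\mathcal P}\|z-\hat x\|_{\mathcal H}\le\gamma$. 2. With probability at least $1-p$ the output $\hat x$ is a $(\gamma,\epsilon)$-stationary point of $f$. If moreover $\delta\dim\mathcal X\le G^2/\epsilon$, then the dimension-independent number of iterations $N\ge C\left[\Delta G^2\gamma^{-1}\epsilon^{-3}+G^2\epsilon^{-2}\right]$ suffices. -/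

import Mathlib

open MeasureTheory ProbabilityTheory
open scoped RealInnerProductSpace

set_option linter.unusedSectionVars false

noncomputable section

namespace O2NC

section Operators

variable {X : Type*} [NormedAddCommGroup X] [InnerProductSpace ℝ X] [FiniteDimensional ℝ X]

/-- The symmetric rank-one operator `x ↦ ⟨z, x⟩ z`. -/
def outer (z : X) : X →ₗ[ℝ] X := (innerₛₗ ℝ z).smulRight z

/-- Membership in `S₊₊`: self-adjoint and positive definite. -/
def IsPosDef (A : X →ₗ[ℝ] X) : Prop :=
  A.IsSymmetric ∧ ∀ x : X, x ≠ 0 → 0 < ⟪x, A x⟫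

theorem trace_comp_adjoint_self (A : X →ₗ[ℝ] X) :
    LinearMap.trace ℝ X (A ∘ₗ A.adjoint) =
      ∑ i, ‖A.adjoint (stdOrthonormalBasis ℝ X i)‖ ^ 2 := by
  rw [LinearMap.trace_eq_sum_inner _ (stdOrthonormalBasis ℝ X)]
  refine Finset.sum_congr rfl fun i _ => ?_
  rw [LinearMap.comp_apply, ← LinearMap.adjoint_inner_left, real_inner_self_eq_norm_sq]

theorem trace_adjoint (A : X →ₗ[ℝ] X) :
    LinearMap.trace ℝ X A.adjoint = LinearMap.trace ℝ X A := by
  rw [LinearMap.trace_eq_sum_inner _ (stdOrthonormalBasis ℝ X),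
    LinearMap.trace_eq_sum_inner _ (stdOrthonormalBasis ℝ X)]
  refine Finset.sum_congr rfl fun i _ => ?_
  rw [LinearMap.adjoint_inner_right, real_inner_comm]

/-- The inner product `⟨A, B⟩ = tr (A B*)` on the space of linear operators. -/
@[reducible] def opInnerCore : InnerProductSpace.Core ℝ (X →ₗ[ℝ] X) where
  inner A B := LinearMap.trace ℝ X (A ∘ₗ B.adjoint)
  conj_inner_symm A B := by
    have h : (B ∘ₗ A.adjoint).adjoint = A ∘ₗ B.adjoint := by
      rw [LinearMap.adjoint_comp, LinearMap.adjoint_adjoint]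
    simp only [conj_trivial]
    rw [← h, trace_adjoint]
  re_inner_nonneg A := by
    simp only [RCLike.re_to_real]
    rw [trace_comp_adjoint_self]
    positivity
  add_left A B C := by simp [LinearMap.add_comp]
  smul_left A B r := by simp [LinearMap.smul_comp]
  definite A h := by
    rw [trace_comp_adjoint_self, Finset.sum_eq_zero_iff_of_nonneg (fun _ _ => by positivity)] at h
    have h0 : A.adjoint = 0 := by
      refine (stdOrthonormalBasis ℝ X).toBasis.ext fun i => ?_
      have := h i (Finset.mem_univ i)
      simpa using this
    rw [← LinearMap.adjoint_adjoint A, h0, map_zero]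

/-- Orthogonal projection onto the subspace `H` of operators, for the inner product
`⟨A, B⟩ = tr (A B*)`. -/
def projH (H : Submodule ℝ (X →ₗ[ℝ] X)) (A : X →ₗ[ℝ] X) : X →ₗ[ℝ] X :=
  letI : NormedAddCommGroup (X →ₗ[ℝ] X) := opInnerCore.toNormedAddCommGroup
  letI : InnerProductSpace ℝ (X →ₗ[ℝ] X) := InnerProductSpace.ofCore opInnerCore.toCore
  H.starProjection A

theorem projH_mem (H : Submodule ℝ (X →ₗ[ℝ] X)) (A : X →ₗ[ℝ] X) : projH H A ∈ H :=
  letI : NormedAddCommGroup (X →ₗ[ℝ] X) := opInnerCore.toNormedAddCommGroup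
  letI : InnerProductSpace ℝ (X →ₗ[ℝ] X) := InnerProductSpace.ofCore opInnerCore.toCore
  H.starProjection_apply_mem A

theorem trace_sub_projH (H : Submodule ℝ (X →ₗ[ℝ] X)) (A F : X →ₗ[ℝ] X) (hF : F ∈ H) :
    LinearMap.trace ℝ X ((A - projH H A) ∘ₗ F.adjoint) = 0 :=
  letI : NormedAddCommGroup (X →ₗ[ℝ] X) := opInnerCore.toNormedAddCommGroup
  letI : InnerProductSpace ℝ (X →ₗ[ℝ] X) := InnerProductSpace.ofCore opInnerCore.toCore
  H.starProjection_inner_eq_zero A F hF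

/-- The square root of a self-adjoint positive semidefinite operator, by spectral decomposition:
`√A = ∑ √λᵢ vᵢ ⟨vᵢ, ·⟩` for an orthonormal eigenbasis `vᵢ` with eigenvalues `λᵢ`. -/
def opSqrt (A : X →ₗ[ℝ] X) : X →ₗ[ℝ] X :=
  open Classical in
  if hA : A.IsSymmetric then
    ∑ i, Real.sqrt (hA.eigenvalues rfl i) • outer (hA.eigenvectorBasis rfl i)
  else 0

theorem opSqrt_apply_eigenvector {A : X →ₗ[ℝ] X} (hA : A.IsSymmetric)
    (j : Fin (Module.finrank ℝ X)) :
    opSqrt A (hA.eigenvectorBasis rfl j) =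
      Real.sqrt (hA.eigenvalues rfl j) • hA.eigenvectorBasis rfl j := by
  classical
  rw [opSqrt, dif_pos hA, LinearMap.sum_apply, Finset.sum_eq_single j]
  · simp [outer]
  · intro i _ hij
    simp [outer, (hA.eigenvectorBasis rfl).orthonormal.2 hij]
  · simp

theorem opSqrt_mul_self {A : X →ₗ[ℝ] X} (hA : A.IsPositive) : opSqrt A ∘ₗ opSqrt A = A := by
  refine (hA.isSymmetric.eigenvectorBasis rfl).toBasis.ext fun j => ?_
  rw [OrthonormalBasis.coe_toBasis, LinearMap.comp_apply, opSqrt_apply_eigenvector hA.isSymmetric,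
    map_smul, opSqrt_apply_eigenvector hA.isSymmetric, smul_smul,
    Real.mul_self_sqrt (hA.nonneg_eigenvalues rfl j), hA.isSymmetric.apply_eigenvectorBasis]
  rfl

theorem outer_isPositive (z : X) : (outer z).IsPositive := by
  refine ⟨fun x y => ?_, fun x => ?_⟩
  · simp [outer, real_inner_smul_right, real_inner_comm, mul_comm]
  · simp [outer, real_inner_smul_left, mul_self_nonneg]

theorem opSqrt_isPositive (A : X →ₗ[ℝ] X) : (opSqrt A).IsPositive := by
  classical
  rw [opSqrt]
  split_ifs with hA
  · exact LinearMap.isPositive_sum _ fun i _ =>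
      (outer_isPositive _).smul_of_nonneg (Real.sqrt_nonneg _)
  · exact LinearMap.isPositive_zero

/-- The trace norm `tr √(A A*)`. -/
def traceNorm (A : X →ₗ[ℝ] X) : ℝ := LinearMap.trace ℝ X (opSqrt (A ∘ₗ A.adjoint))

/-- The operator norm `max_{‖x‖ ≤ 1} ‖A x‖`. -/
def opNorm (A : X →ₗ[ℝ] X) : ℝ := ‖LinearMap.toContinuousLinearMap A‖

/-- The assumptions on the space `H` of preconditioners: it consists of self-adjoint operators,
contains the identity, is closed under symmetric multiplication, and the orthogonal projection
onto it preserves positive definiteness. -/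
structure IsPreconditionerSpace (H : Submodule ℝ (X →ₗ[ℝ] X)) : Prop where
  symm : ∀ A ∈ H, A.IsSymmetric
  id_mem : LinearMap.id ∈ H
  mul_mem : ∀ A ∈ H, ∀ F ∈ H, A ∘ₗ F ∘ₗ A ∈ H
  proj_posDef : ∀ A : X →ₗ[ℝ] X, IsPosDef A → IsPosDef (projH H A)

/-- The primal norm `‖x‖ = ‖√(proj_H (x⟨x, ·⟩))‖_op`. -/
def primalNorm (H : Submodule ℝ (X →ₗ[ℝ] X)) (x : X) : ℝ := opNorm (opSqrt (projH H (outer x)))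

/-- The dual norm `‖x‖_* = ‖√(proj_H (x⟨x, ·⟩))‖_tr`. -/
def dualNorm (H : Submodule ℝ (X →ₗ[ℝ] X)) (x : X) : ℝ := traceNorm (opSqrt (projH H (outer x)))

/-- The weighted squared norm `‖v‖²_{B⁻¹} = ⟨v, B⁻¹ v⟩` (used for invertible `B`). -/
def invNormSq (B : X →ₗ[ℝ] X) (v : X) : ℝ := ⟪v, (Ring.inverse B : Module.End ℝ X) v⟫

end Operators

section Stationarity

variable {X : Type*} [NormedAddCommGroup X] [InnerProductSpace ℝ X] [FiniteDimensional ℝ X]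
  [MeasurableSpace X]

/-- `xhat` is a `(γ, ε)`-stationary point of `f`. -/
def IsStationary (H : Submodule ℝ (X →ₗ[ℝ] X)) (f : X → ℝ) (γ ε : ℝ) (xhat : X) : Prop :=
  ∃ Q : Measure X, IsProbabilityMeasure Q ∧
    Integrable (fun z => z) Q ∧ Integrable (gradient f) Q ∧
    Integrable (fun z => primalNorm H (z - xhat)) Q ∧
    ∫ z, z ∂Q = xhat ∧
    dualNorm H (∫ z, gradient f z ∂Q) ≤ ε ∧
    ∫ z, primalNorm H (z - xhat) ∂Q ≤ γ

/-- The random point `xhat` is `(γ, ε)`-stationary in expectation: there is a random distribution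
`Q ω` with mean `xhat ω` such that the two quantities that define stationarity are at most `ε`
and `γ` in expectation over `ω`. -/
def IsStationaryInExpectation {Ω : Type*} [MeasurableSpace Ω] (P : Measure Ω)
    (H : Submodule ℝ (X →ₗ[ℝ] X)) (f : X → ℝ) (γ ε : ℝ) (xhat : Ω → X) : Prop :=
  ∃ Q : Kernel Ω X, IsMarkovKernel Q ∧
    (∀ᵐ ω ∂P, Integrable (fun z => z) (Q ω) ∧ Integrable (gradient f) (Q ω) ∧
      ∫ z, z ∂(Q ω) = xhat ω) ∧
    ∫⁻ ω, ENNReal.ofReal (dualNorm H (∫ z, gradient f z ∂(Q ω))) ∂P ≤ ENNReal.ofReal ε ∧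
    ∫⁻ ω, ∫⁻ z, ENNReal.ofReal (primalNorm H (z - xhat ω)) ∂(Q ω) ∂P ≤ ENNReal.ofReal γ

/-- `g ξ x`, with `ξ ∼ D`, is an unbiased stochastic estimator of `∇ f x` with second moment in the
norm `‖·‖_{B⁻¹}` at most `G²`. -/
structure IsStochasticGradient {Ξ : Type*} [MeasurableSpace Ξ] (D : Measure Ξ)
    (f : X → ℝ) (g : Ξ → X → X) (B : X →ₗ[ℝ] X) (G : ℝ) : Prop where
  measurable : Measurable (Function.uncurry g)
  integrable : ∀ x, Integrable (fun ξ => g ξ x) D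
  unbiased : ∀ x, ∫ ξ, g ξ x ∂D = gradient f x
  integrable_sq : ∀ x, Integrable (fun ξ => invNormSq B (g ξ x)) D
  second_moment : ∀ x, ∫ ξ, invNormSq B (g ξ x) ∂D ≤ G ^ 2

end Stationarity

section Algorithm

variable {X : Type*} [NormedAddCommGroup X] [InnerProductSpace ℝ X] [FiniteDimensional ℝ X]

/-- The dual regularizer `Ψ*(m) = η ‖√(proj_H (m⟨m, ·⟩) + S)‖_tr`. -/
def dualReg (H : Submodule ℝ (X →ₗ[ℝ] X)) (η : ℝ) (S : X →ₗ[ℝ] X) (m : X) : ℝ :=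
  η * traceNorm (opSqrt (projH H (outer m) + S))

/-- State of the online learner (generalized Leon): current iterate `x`, accumulated gradient `m`
and accumulated operator `S`. -/
structure LeonState (X : Type*) [NormedAddCommGroup X] [InnerProductSpace ℝ X] where
  x : X
  m : X
  S : X →ₗ[ℝ] X

/-- Initialization: `x₀ = 0`, `m₋₁ = 0`, `S₋₁ = δ² I`. -/
def leonInit (δ : ℝ) : LeonState X := ⟨0, 0, δ ^ 2 • LinearMap.id⟩

/-- One iteration of generalized Leon with observed gradient `g`:
`m_k = m_{k-1} + g`, `S_k = S_{k-1} + proj_H (g⟨g, ·⟩)`, `x_{k+1} = -∇Ψ_k*(m_k)`. -/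
def leonStep (H : Submodule ℝ (X →ₗ[ℝ] X)) (η : ℝ) (st : LeonState X) (g : X) : LeonState X :=
  let m := st.m + g
  let S := st.S + projH H (outer g)
  ⟨-gradient (dualReg H η S) m, m, S⟩

/-- State at the start of iteration `k` of the (exponentiated) online-to-nonconvex conversion run
with generalized Leon: the current point and the state of the online learner. Iteration `k` takes
the increment `Δ_k` proposed by the learner, moves to `w_k = w_{k-1} + s_k Δ_k`, queries the
stochastic gradient `g(ξ_k, w_k)` once, and feeds the learner with the linear loss given by the
vector `β⁻ᵏ g(ξ_k, w_k)`. -/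
def o2ncState {Ξ : Type*} (H : Submodule ℝ (X →ₗ[ℝ] X)) (β η δ : ℝ) (g : Ξ → X → X) (w₀ : X)
    (ξ : ℕ → Ξ) (s : ℕ → ℝ) : ℕ → X × LeonState X
  | 0 => (w₀, leonInit δ)
  | k + 1 =>
    let st := o2ncState H β η δ g w₀ ξ s k
    let w := st.1 + s k • st.2.x
    (w, leonStep H η st.2 ((β ^ k)⁻¹ • g (ξ k) w))

/-- The query point `w_k` of iteration `k = 0, 1, …`. -/
def o2ncPoint {Ξ : Type*} (H : Submodule ℝ (X →ₗ[ℝ] X)) (β η δ : ℝ) (g : Ξ → X → X) (w₀ : X)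
    (ξ : ℕ → Ξ) (s : ℕ → ℝ) (k : ℕ) : X :=
  (o2ncState H β η δ g w₀ ξ s (k + 1)).1

/-- The exponential moving average
`wbar_n = ((1 - β) / (1 - β^(n+1))) ∑_{k ≤ n} β^(n-k) w_k` of the query points. -/
def o2ncAverage {Ξ : Type*} (H : Submodule ℝ (X →ₗ[ℝ] X)) (β η δ : ℝ) (g : Ξ → X → X) (w₀ : X)
    (ξ : ℕ → Ξ) (s : ℕ → ℝ) (n : ℕ) : X :=
  ((1 - β) / (1 - β ^ (n + 1))) •
    ∑ k ∈ Finset.range (n + 1), β ^ (n - k) • o2ncPoint H β η δ g w₀ ξ s k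

/-- Probability that the conversion run for `N` iterations outputs the moving average with index
`n ∈ {0, …, N - 1}`: it is `(1 - β^(n+1)) / N` for `n < N - 1`, and
`(1 - β^N) / ((1 - β) N)` for `n = N - 1`. -/
def outputProb (β : ℝ) (N n : ℕ) : ℝ :=
  if n + 1 < N then (1 - β ^ (n + 1)) / N else (1 - β ^ N) / ((1 - β) * N)

theorem sum_outputProb {β : ℝ} (hβ : β < 1) {N : ℕ} (hN : 0 < N) :
    ∑ n ∈ Finset.range N, outputProb β N n = 1 := by
  obtain ⟨M, rfl⟩ : ∃ M, N = M + 1 := ⟨N - 1, by omega⟩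
  have h1 : (1 - β) ≠ 0 := by linarith
  have h2 : ((M + 1 : ℕ) : ℝ) ≠ 0 := by positivity
  have key : ∀ K : ℕ, (1 - β) * ∑ n ∈ Finset.range K, (1 - β ^ (n + 1)) =
      (1 - β) * K - β + β ^ (K + 1) := by
    intro K
    induction K with
    | zero => simp
    | succ K ih => rw [Finset.sum_range_succ, mul_add, ih]; push_cast; ring
  rw [Finset.sum_range_succ, Finset.sum_congr rfl (g := fun n => (1 - β ^ (n + 1)) / (M + 1 : ℕ))
    (fun n hn => by simp only [outputProb]; rw [if_pos (by simpa using hn)]), ← Finset.sum_div]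
  simp only [outputProb, lt_irrefl, if_false]
  field_simp
  have := key M
  push_cast at *
  linarith

/-- The random inputs of the conversion: the pairs `(ξ_k, s_k)` are independent and identically
distributed, `ξ_k ∼ D` and `s_k ∼ Exp(1)` being independent, and the output index `τ` is
independent of them with law `outputProb β N`. -/
structure IsO2NCSampling {Ξ Ω : Type*} [MeasurableSpace Ξ] [MeasurableSpace Ω] (D : Measure Ξ)
    (P : Measure Ω) (β : ℝ) (N : ℕ) (ξ : ℕ → Ω → Ξ) (s : ℕ → Ω → ℝ) (τ : Ω → ℕ) : Prop where
  measurable_ξ : ∀ k, Measurable (ξ k)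
  measurable_s : ∀ k, Measurable (s k)
  measurable_τ : Measurable τ
  law : ∀ k, P.map (fun ω => (ξ k ω, s k ω)) = D.prod (expMeasure 1)
  indep : iIndepFun (fun k ω => (ξ k ω, s k ω)) P
  law_τ : ∀ n < N, P {ω | τ ω = n} = ENNReal.ofReal (outputProb β N n)
  indep_τ : IndepFun τ (fun ω k => (ξ k ω, s k ω)) P

/-- The output of the conversion after `N` iterations (with `τ` supported on `{0, …, N - 1}`). -/
def o2ncOutput {Ξ Ω : Type*} (H : Submodule ℝ (X →ₗ[ℝ] X)) (β η δ : ℝ) (g : Ξ → X → X) (w₀ : X)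
    (ξ : ℕ → Ω → Ξ) (s : ℕ → Ω → ℝ) (τ : Ω → ℕ) (ω : Ω) : X :=
  o2ncAverage H β η δ g w₀ (fun k => ξ k ω) (fun k => s k ω) (τ ω)

end Algorithm

end O2NC

end

open O2NC

/-! The analysis splits into a deterministic regret bound for the online learner and a probabilistic
reduction from stationarity to regret.

Everything about `tr √A` follows from the inequality `2 tr √A ≤ tr (P⁻¹ A) + tr P`, valid for every
positive definite `P` (`two_mul_trace_opSqrt_le`). If `P` lies in `H`, so does `P⁻¹`, because an
injective map `F ↦ A F A` of the finite-dimensional space `H` is onto (`inverse_mem`). Traces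
against elements of `H` do not see the projection, so `tr (P⁻¹ proj_H (x⟨x, ·⟩)) = ⟨x, P⁻¹ x⟩`. Each
estimate then amounts to a good choice of `P ∈ H`.

With `Q = √(proj_H (m⟨m, ·⟩) + S)`, matching second-order bounds give the gradient `η Q⁻¹ m` of the
regularizer, and `Q⁻¹ m` has primal norm at most 1. The test operator `Q + √S' - √S` shows that the
potential `tr Q` grows by at most its linearization plus `4 (tr √S' - tr √S)`
(`trace_leonRoot_step`). Telescoping and `‖m‖_* ≤ tr Q` bound the regret by `4 η tr √S`
(`regret_o2nc`); the test operator `δ I + t B` bounds `tr √S` by `δ dim X` plus dimension-free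
terms.

For `s ∼ Exp(1)` the density equals its own tail, so integration by parts gives `E f(w + s v) - f(w)
= E ⟨∇f(w + s v), v⟩`. Hence the expected linear losses of the learner are exact function
decrements, with no smoothness assumption. The dual norm of the discounted gradient sum is at most
that of the discounted loss sum, controlled by regret, plus that of the gradient noise, controlled
by orthogonality of martingale differences in `‖·‖_{B⁻¹}` (`lintegral_dualNorm_gradient_sum_le`).

The law of `τ` is chosen so that averaging the discounted decrements over the output index collapses
to `F_N - F_0` (`sum_outputWeight_mul`). The witness distribution puts the moving-average weights on
the query points `w_0, …, w_τ`. Increments have primal norm at most `η`, so its spread is of order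
`η / (1 - β)`, while the dual norm is of order `G √(1 - β) + δ dim X / N + Δ / (η N)`. Choosing `1 -
β` and `η` makes both at most `p / 2` times their targets in expectation; Markov's inequality and a
union bound give probability `1 - p`. -/

namespace O2NC

/-! ### Trace inequalities, inverses and square roots of positive operators. -/

section PositiveOperators

open scoped Ring

variable {X : Type*} [NormedAddCommGroup X] [InnerProductSpace ℝ X] [FiniteDimensional ℝ X]

local notation "tr" => LinearMap.trace ℝ X

theorem outer_apply (z x : X) : outer z x = ⟪z, x⟫ • z := by simp [outer]

theorem trace_outer_mul (z : X) (F : X →ₗ[ℝ] X) : tr (outer z * F) = ⟪z, F z⟫ := by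
  rw [LinearMap.trace_mul_comm]
  have h : F * outer z = (innerₛₗ ℝ z).smulRight (F z) := by
    ext x; simp [outer]
  rw [h, LinearMap.trace_smulRight]
  simp

theorem outer_smul (c : ℝ) (z : X) : outer (c • z) = c ^ 2 • outer z := by
  ext x
  simp only [outer_apply, LinearMap.smul_apply, real_inner_smul_left, smul_smul]
  congr 1; ring

theorem trace_id_eq_finrank : tr (1 : X →ₗ[ℝ] X) = Module.finrank ℝ X :=
  LinearMap.trace_one ℝ X

theorem isPositive_iff_real {A : X →ₗ[ℝ] X} :
    A.IsPositive ↔ A.IsSymmetric ∧ ∀ x, 0 ≤ ⟪x, A x⟫ := by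
  constructor
  · intro h
    exact ⟨h.isSymmetric, fun x => h.inner_nonneg_right x⟩
  · rintro ⟨h1, h2⟩
    exact ⟨h1, fun x => by rw [real_inner_comm]; exact h2 x⟩

theorem isPositive_conj {S A : X →ₗ[ℝ] X} (hS : S.IsSymmetric) (hA : A.IsPositive) :
    (S * A * S).IsPositive := by
  rw [isPositive_iff_real]
  refine ⟨fun x y => ?_, fun x => ?_⟩
  · simp only [Module.End.mul_apply]
    rw [hS, hA.isSymmetric, hS]
  · simp only [Module.End.mul_apply]
    rw [← hS]
    exact hA.inner_nonneg_right _

theorem opSqrt_mul_opSqrt {A : X →ₗ[ℝ] X} (hA : A.IsPositive) : opSqrt A * opSqrt A = A :=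
  opSqrt_mul_self hA

/-- By cyclicity the trace is that of the positive operator `√B A √B`. -/
theorem trace_mul_nonneg {A B : X →ₗ[ℝ] X} (hA : A.IsPositive) (hB : B.IsPositive) :
    0 ≤ tr (A * B) := by
  rw [← opSqrt_mul_opSqrt hB, ← mul_assoc, LinearMap.trace_mul_comm, ← mul_assoc]
  exact (isPositive_conj (opSqrt_isPositive B).isSymmetric hA).trace_nonneg

theorem trace_mul_le_trace_mul {A B C : X →ₗ[ℝ] X} (hAB : (B - A).IsPositive)
    (hC : C.IsPositive) : tr (C * A) ≤ tr (C * B) := by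
  have := trace_mul_nonneg hC hAB
  rw [mul_sub, map_sub] at this
  linarith

theorem IsPosDef.isPositive {A : X →ₗ[ℝ] X} (hA : IsPosDef A) : A.IsPositive := by
  rw [isPositive_iff_real]
  refine ⟨hA.1, fun x => ?_⟩
  by_cases hx : x = 0
  · simp [hx]
  · exact (hA.2 x hx).le

theorem IsPosDef.isUnit {A : X →ₗ[ℝ] X} (hA : IsPosDef A) : IsUnit A := by
  rw [LinearMap.isUnit_iff_ker_eq_bot, LinearMap.ker_eq_bot']
  intro x hx
  by_contra h
  have := hA.2 x h
  simp [hx] at this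

theorem IsPosDef.mul_inverse {A : X →ₗ[ℝ] X} (hA : IsPosDef A) : A * A⁻¹ʳ = 1 :=
  Ring.mul_inverse_cancel A hA.isUnit

theorem IsPosDef.inverse_mul {A : X →ₗ[ℝ] X} (hA : IsPosDef A) : A⁻¹ʳ * A = 1 :=
  Ring.inverse_mul_cancel A hA.isUnit

theorem IsPosDef.apply_inverse {A : X →ₗ[ℝ] X} (hA : IsPosDef A) (x : X) : A (A⁻¹ʳ x) = x := by
  rw [← Module.End.mul_apply, hA.mul_inverse, Module.End.one_apply]

theorem IsPosDef.inverse_apply {A : X →ₗ[ℝ] X} (hA : IsPosDef A) (x : X) : A⁻¹ʳ (A x) = x := by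
  rw [← Module.End.mul_apply, hA.inverse_mul, Module.End.one_apply]

theorem IsPosDef.inverse {A : X →ₗ[ℝ] X} (hA : IsPosDef A) : IsPosDef A⁻¹ʳ := by
  refine ⟨fun x y => ?_, fun x hx => ?_⟩
  · conv_lhs => rw [← hA.apply_inverse y]
    rw [← hA.1, hA.apply_inverse]
  · have h0 : A⁻¹ʳ x ≠ 0 := by
      intro h
      apply hx
      rw [← hA.apply_inverse x, h, map_zero]
    have := hA.2 _ h0
    rwa [hA.apply_inverse, real_inner_comm] at this

theorem IsPosDef.add_isPositive {A B : X →ₗ[ℝ] X} (hA : IsPosDef A) (hB : B.IsPositive) :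
    IsPosDef (A + B) := by
  refine ⟨hA.1.add hB.isSymmetric, fun x hx => ?_⟩
  rw [LinearMap.add_apply, inner_add_right]
  exact add_pos_of_pos_of_nonneg (hA.2 x hx) (hB.inner_nonneg_right x)

theorem isPosDef_smul_one {c : ℝ} (hc : 0 < c) : IsPosDef (c • (1 : X →ₗ[ℝ] X)) := by
  refine ⟨fun x y => by simp [real_inner_smul_left, real_inner_smul_right], fun x hx => ?_⟩
  simp only [LinearMap.smul_apply, Module.End.one_apply, real_inner_smul_right]
  have := real_inner_self_pos.2 hx
  positivity

theorem IsPosDef.smul {A : X →ₗ[ℝ] X} (hA : IsPosDef A) {c : ℝ} (hc : 0 < c) :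
    IsPosDef (c • A) := by
  refine ⟨fun x y => ?_, fun x hx => ?_⟩
  · simp only [LinearMap.smul_apply, real_inner_smul_left, real_inner_smul_right, hA.1 x y]
  · simp only [LinearMap.smul_apply, real_inner_smul_right]
    exact mul_pos hc (hA.2 x hx)

/-- The operator inequality behind all estimates of `tr √A`. -/
theorem two_mul_trace_le {S P : X →ₗ[ℝ] X} (hS : S.IsSymmetric) (hP : IsPosDef P) :
    2 * tr S ≤ tr (P⁻¹ʳ * (S * S)) + tr P := by
  have hs : (S - P).IsSymmetric := hS.sub hP.1
  have h := (isPositive_conj hs hP.inverse.isPositive).trace_nonneg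
  have e : (S - P) * P⁻¹ʳ * (S - P) = S * P⁻¹ʳ * S - S * (P⁻¹ʳ * P) - (P * P⁻¹ʳ) * S
      + (P * P⁻¹ʳ) * P := by noncomm_ring
  rw [e, hP.inverse_mul, hP.mul_inverse] at h
  simp only [mul_one, one_mul, map_add, map_sub] at h
  rw [mul_assoc, LinearMap.trace_mul_comm, mul_assoc] at h
  linarith

/-- Upper half of a variational formula for `tr √A`: every test operator `P` gives a bound, and `P =
√A` is optimal when it is invertible. -/
theorem two_mul_trace_opSqrt_le {A P : X →ₗ[ℝ] X} (hA : A.IsPositive) (hP : IsPosDef P) :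
    2 * tr (opSqrt A) ≤ tr (P⁻¹ʳ * A) + tr P := by
  have := two_mul_trace_le (opSqrt_isPositive A).isSymmetric hP
  rwa [opSqrt_mul_opSqrt hA] at this

/-- If `0 ≤ Q ≤ P` with `P` positive definite, then `Q P⁻¹ Q ≤ Q`. -/
theorem inner_inverse_apply_le {P Q : X →ₗ[ℝ] X} (hQ : Q.IsPositive) (hP : IsPosDef P)
    (hQP : (P - Q).IsPositive) (x : X) : ⟪Q x, P⁻¹ʳ (Q x)⟫ ≤ ⟪x, Q x⟫ := by
  -- Adding `⟨y - x, Q (y - x)⟩ ≥ 0` and `⟨y, (P - Q) y⟩ ≥ 0` at this `y` cancels `⟨y, Q y⟩` and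
  -- leaves the claim.
  set y := P⁻¹ʳ (Q x) with hy
  have hPy : P y = Q x := hP.apply_inverse _
  have h1 := hQ.inner_nonneg_right (y - x)
  have h2 := hQP.inner_nonneg_right y
  have h3 : ⟪x, Q y⟫ = ⟪y, Q x⟫ := by rw [← hQ.isSymmetric, real_inner_comm]
  have h4 : ⟪y, P y⟫ = ⟪y, Q x⟫ := by rw [hPy]
  simp only [map_sub, inner_sub_left, inner_sub_right, LinearMap.sub_apply] at h1 h2
  rw [real_inner_comm]
  linarith

theorem trace_inverse_mul_sq_le {P Q : X →ₗ[ℝ] X} (hQ : Q.IsPositive) (hP : IsPosDef P)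
    (hQP : (P - Q).IsPositive) : tr (P⁻¹ʳ * (Q * Q)) ≤ tr Q := by
  rw [← mul_assoc, LinearMap.trace_mul_comm, ← mul_assoc]
  rw [← sub_nonneg, ← map_sub]
  refine LinearMap.IsPositive.trace_nonneg (isPositive_iff_real.2 ⟨?_, fun x => ?_⟩)
  · exact hQ.isSymmetric.sub (isPositive_conj hQ.isSymmetric hP.inverse.isPositive).isSymmetric
  · simp only [LinearMap.sub_apply, Module.End.mul_apply, inner_sub_right]
    rw [← hQ.isSymmetric x (P⁻¹ʳ (Q x))]
    linarith [inner_inverse_apply_le hQ hP hQP x]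

theorem inner_inverse_antitone {P Q : X →ₗ[ℝ] X} (hQ : IsPosDef Q) (hP : IsPosDef P)
    (hQP : (P - Q).IsPositive) (x : X) : ⟪x, P⁻¹ʳ x⟫ ≤ ⟪x, Q⁻¹ʳ x⟫ := by
  have := inner_inverse_apply_le hQ.isPositive hP hQP (Q⁻¹ʳ x)
  rw [hQ.apply_inverse] at this
  rwa [real_inner_comm (Q⁻¹ʳ x) x]

theorem isPositive_inverse_sub_inverse {P Q : X →ₗ[ℝ] X} (hQ : IsPosDef Q) (hP : IsPosDef P)
    (hQP : (P - Q).IsPositive) : (Q⁻¹ʳ - P⁻¹ʳ).IsPositive := by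
  refine isPositive_iff_real.2 ⟨hQ.inverse.1.sub hP.inverse.1, fun x => ?_⟩
  rw [LinearMap.sub_apply, inner_sub_right]
  linarith [inner_inverse_antitone hQ hP hQP x]

theorem inverse_smul_apply {P : X →ₗ[ℝ] X} (hP : IsPosDef P) {t : ℝ} (ht : 0 < t) (x : X) :
    (t • P)⁻¹ʳ x = t⁻¹ • P⁻¹ʳ x := by
  have h := (hP.smul ht).inverse_apply (t⁻¹ • P⁻¹ʳ x)
  rwa [map_smul, LinearMap.smul_apply, hP.apply_inverse, smul_smul, inv_mul_cancel₀ ht.ne',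
    one_smul] at h

theorem inverse_smul_eq {P : X →ₗ[ℝ] X} (hP : IsPosDef P) {t : ℝ} (ht : 0 < t) :
    (t • P)⁻¹ʳ = t⁻¹ • P⁻¹ʳ := LinearMap.ext fun x => inverse_smul_apply hP ht x

theorem isPosDef_one : IsPosDef (1 : X →ₗ[ℝ] X) := by
  simpa using isPosDef_smul_one (X := X) one_pos

theorem inverse_smul_one {t : ℝ} (ht : 0 < t) :
    (t • (1 : X →ₗ[ℝ] X))⁻¹ʳ = t⁻¹ • 1 := by
  rw [inverse_smul_eq isPosDef_one ht, Ring.inverse_one]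

theorem isPositive_add_smul_one_sub {A : X →ₗ[ℝ] X} {t : ℝ} (ht : 0 ≤ t) :
    ((A + t • 1) - A).IsPositive := by
  rw [add_sub_cancel_left]
  exact LinearMap.isPositive_one.smul_of_nonneg ht

theorem isPosDef_add_smul_one {A : X →ₗ[ℝ] X} (hA : A.IsPositive) {t : ℝ} (ht : 0 < t) :
    IsPosDef (A + t • 1) := by
  rw [add_comm]; exact (isPosDef_smul_one ht).add_isPositive hA

/-- Positive operators with the same square have the same trace. -/
theorem trace_le_of_sq_le {S R : X →ₗ[ℝ] X} (hS : S.IsSymmetric) (hR : R.IsPositive)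
    (h : (R * R - S * S).IsPositive) : tr S ≤ tr R := by
  refine le_of_forall_pos_le_add fun e he => ?_
  -- `R` may be singular, so the test operator is `R + t • 1`; its extra trace `t dim X` is absorbed
  -- by `e`.
  obtain ⟨t, ht, hte⟩ : ∃ t : ℝ, 0 < t ∧ t * Module.finrank ℝ X ≤ e := by
    refine ⟨e / (Module.finrank ℝ X + 1), by positivity, ?_⟩
    rw [div_mul_eq_mul_div, div_le_iff₀ (by positivity)]
    nlinarith
  have hP := isPosDef_add_smul_one hR ht
  have h1 := two_mul_trace_le hS hP
  have h2 := trace_mul_le_trace_mul h hP.inverse.isPositive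
  have h3 := trace_inverse_mul_sq_le hR hP (isPositive_add_smul_one_sub ht.le)
  rw [map_add (LinearMap.trace ℝ X), map_smul, trace_id_eq_finrank, smul_eq_mul] at h1
  linarith

theorem trace_opSqrt_mono {A B : X →ₗ[ℝ] X} (hA : A.IsPositive) (hB : B.IsPositive)
    (h : (B - A).IsPositive) : tr (opSqrt A) ≤ tr (opSqrt B) := by
  refine trace_le_of_sq_le (opSqrt_isPositive A).isSymmetric (opSqrt_isPositive B) ?_
  rwa [opSqrt_mul_opSqrt hA, opSqrt_mul_opSqrt hB]

/-- `√(A²)` and `A` are positive with the same square; comparing traces in both directions replaces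
an appeal to uniqueness of the positive square root. -/
theorem traceNorm_eq_trace {A : X →ₗ[ℝ] X} (hA : A.IsPositive) : traceNorm A = tr A := by
  have hpos : (A * A).IsPositive := by
    have := isPositive_conj hA.isSymmetric (LinearMap.isPositive_one (𝕜 := ℝ) (E := X))
    rwa [mul_one] at this
  have hsq := opSqrt_mul_opSqrt hpos
  have : traceNorm A = tr (opSqrt (A * A)) := by
    rw [traceNorm, hA.adjoint_eq]; rfl
  rw [this]
  refine le_antisymm (trace_le_of_sq_le (opSqrt_isPositive _).isSymmetric hA ?_)
    (trace_le_of_sq_le hA.isSymmetric (opSqrt_isPositive _) ?_)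
  · simp [hsq]
  · simp [hsq]

/-- A symmetric operator with nonnegative eigenvalues is positive. -/
theorem isPositive_of_eigenvalues_nonneg {A : X →ₗ[ℝ] X} (hA : A.IsSymmetric)
    (h : ∀ (c : ℝ) (v : X), v ≠ 0 → A v = c • v → 0 ≤ c) : A.IsPositive := by
  refine isPositive_iff_real.2 ⟨hA, fun x => ?_⟩
  have hb := hA.eigenvectorBasis rfl
  have e : ⟪x, A x⟫ = ∑ i, hA.eigenvalues rfl i * ⟪x, hA.eigenvectorBasis rfl i⟫ ^ 2 := by
    rw [← (hA.eigenvectorBasis rfl).sum_inner_mul_inner x (A x)]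
    refine Finset.sum_congr rfl fun i _ => ?_
    rw [← hA, hA.apply_eigenvectorBasis, RCLike.ofReal_real_eq_id, id, real_inner_smul_left,
      real_inner_comm x]
    ring
  rw [e]
  refine Finset.sum_nonneg fun i _ => mul_nonneg ?_ (sq_nonneg _)
  refine h _ (hA.eigenvectorBasis rfl i) ?_ ?_
  · exact (hA.eigenvectorBasis rfl).orthonormal.ne_zero i
  · simp [hA.apply_eigenvectorBasis]

theorem apply_eq_zero_of_inner_eq_zero {A : X →ₗ[ℝ] X} (hA : A.IsPositive) {x : X}
    (h : ⟪x, A x⟫ = 0) : A x = 0 := by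
  have hs := opSqrt_mul_opSqrt hA
  have h1 : opSqrt A x = 0 := by
    rw [← hs, Module.End.mul_apply, ← (opSqrt_isPositive A).isSymmetric] at h
    exact inner_self_eq_zero.1 h
  rw [← hs, Module.End.mul_apply, h1, map_zero]

/-- The square root is operator monotone. -/
theorem isPositive_sub_of_sq {C D : X →ₗ[ℝ] X} (hC : C.IsPositive) (hD : D.IsPositive)
    (h : (C * C - D * D).IsPositive) : (C - D).IsPositive := by
  -- On an eigenvector of `C - D` with eigenvalue `c`, `⟨v, (C² - D²) v⟩ = c (⟨v, C v⟩ + ⟨v, D v⟩)`.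
  -- If `c < 0`, both summands vanish, so `C v = D v = 0` and `c v = 0`.
  refine isPositive_of_eigenvalues_nonneg (hC.isSymmetric.sub hD.isSymmetric) fun c v hv hcv => ?_
  by_contra! hc
  have h1 := h.inner_nonneg_right v
  have e1 : (C * C - D * D) v = C ((C - D) v) + (C - D) (D v) := by
    simp [Module.End.mul_apply]
  have e2 : ⟪v, (C - D) (D v)⟫ = c * ⟪v, D v⟫ := by
    rw [← (hC.isSymmetric.sub hD.isSymmetric), hcv, real_inner_smul_left]
  rw [e1, inner_add_right, e2, hcv, map_smul, real_inner_smul_right] at h1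
  have hCn := hC.inner_nonneg_right v
  have hDn := hD.inner_nonneg_right v
  have hC0 : ⟪v, C v⟫ = 0 := by nlinarith
  have hD0 : ⟪v, D v⟫ = 0 := by nlinarith
  have : c • v = 0 := by
    rw [← hcv, LinearMap.sub_apply, apply_eq_zero_of_inner_eq_zero hC hC0,
      apply_eq_zero_of_inner_eq_zero hD hD0, sub_zero]
  rcases smul_eq_zero.1 this with h | h
  · exact hc.ne h
  · exact hv h

theorem isPositive_opSqrt_sub {A B : X →ₗ[ℝ] X} (hA : A.IsPositive) (hB : B.IsPositive)
    (h : (B - A).IsPositive) : (opSqrt B - opSqrt A).IsPositive := by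
  refine isPositive_sub_of_sq (opSqrt_isPositive B) (opSqrt_isPositive A) ?_
  rwa [opSqrt_mul_opSqrt hA, opSqrt_mul_opSqrt hB]

theorem isPosDef_of_isPositive_of_isUnit {A : X →ₗ[ℝ] X} (hA : A.IsPositive)
    (h : ∀ x, A x = 0 → x = 0) : IsPosDef A := by
  refine ⟨hA.isSymmetric, fun x hx => lt_of_le_of_ne (hA.inner_nonneg_right x) fun h0 => hx ?_⟩
  exact h x (apply_eq_zero_of_inner_eq_zero hA h0.symm)

theorem isPosDef_opSqrt {A : X →ₗ[ℝ] X} (hA : IsPosDef A) : IsPosDef (opSqrt A) := by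
  refine isPosDef_of_isPositive_of_isUnit (opSqrt_isPositive A) fun x hx => ?_
  have : A x = 0 := by
    rw [← opSqrt_mul_opSqrt hA.isPositive, Module.End.mul_apply, hx, map_zero]
  rw [← hA.inverse_apply x, this, map_zero]

/-- Interpolating `√` at the eigenvalues gives the polynomial. This is how square roots are shown to
stay in `H`. -/
theorem opSqrt_eq_aeval {A : X →ₗ[ℝ] X} (hA : A.IsPositive) :
    ∃ q : Polynomial ℝ, opSqrt A = Polynomial.aeval A q := by
  classical
  set ev := hA.isSymmetric.eigenvalues rfl with hev
  let s : Finset ℝ := Finset.univ.image ev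
  refine ⟨Lagrange.interpolate s id Real.sqrt, ?_⟩
  refine (hA.isSymmetric.eigenvectorBasis rfl).toBasis.ext fun j => ?_
  rw [OrthonormalBasis.coe_toBasis, opSqrt_apply_eigenvector hA.isSymmetric]
  have hj : ev j ∈ s := Finset.mem_image_of_mem _ (Finset.mem_univ j)
  have h := Module.End.aeval_apply_of_hasEigenvector
    (p := Lagrange.interpolate s id Real.sqrt)
    (hA.isSymmetric.hasEigenvector_eigenvectorBasis rfl j)
  rw [h]
  congr 1
  exact (Lagrange.eval_interpolate_at_node (v := id) Real.sqrt (Set.injOn_id _) hj).symm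

theorem opNorm_le_iff {A : X →ₗ[ℝ] X} {c : ℝ} (hc : 0 ≤ c) :
    opNorm A ≤ c ↔ ∀ x, ‖A x‖ ≤ c * ‖x‖ := by
  rw [opNorm, ContinuousLinearMap.opNorm_le_iff hc]
  rfl

/-- Since `‖√A x‖² = ⟨x, A x⟩`, an operator-norm bound is an operator inequality without roots,
which is compatible with `projH`. -/
theorem opNorm_opSqrt_le_iff {A : X →ₗ[ℝ] X} (hA : A.IsPositive) {c : ℝ} (hc : 0 ≤ c) :
    opNorm (opSqrt A) ≤ c ↔ (c ^ 2 • 1 - A).IsPositive := by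
  have key : ∀ x, ‖opSqrt A x‖ ^ 2 = ⟪x, A x⟫ := fun x => by
    conv_rhs => rw [← opSqrt_mul_opSqrt hA]
    rw [Module.End.mul_apply, ← (opSqrt_isPositive A).isSymmetric, real_inner_self_eq_norm_sq]
  have hs : (c ^ 2 • 1 - A).IsSymmetric :=
    (LinearMap.isPositive_one.smul_of_nonneg (sq_nonneg c)).isSymmetric.sub hA.isSymmetric
  rw [opNorm_le_iff hc, isPositive_iff_real]
  constructor
  · intro h
    refine ⟨hs, fun x => ?_⟩
    simp only [LinearMap.sub_apply, LinearMap.smul_apply, Module.End.one_apply, inner_sub_right,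
      real_inner_smul_right, real_inner_self_eq_norm_sq]
    rw [← key, sub_nonneg, ← mul_pow]
    exact pow_le_pow_left₀ (norm_nonneg _) (h x) 2
  · rintro ⟨-, h⟩ x
    have h := h x
    simp only [LinearMap.sub_apply, LinearMap.smul_apply, Module.End.one_apply, inner_sub_right,
      real_inner_smul_right, real_inner_self_eq_norm_sq] at h
    rw [← key, sub_nonneg, ← mul_pow] at h
    exact (sq_le_sq₀ (norm_nonneg _) (by positivity)).1 h

end PositiveOperators

end O2NC

namespace O2NC

/-! ### Algebra of the preconditioner space and of its projection. -/

section PreconditionerSpace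

open scoped Ring

variable {X : Type*} [NormedAddCommGroup X] [InnerProductSpace ℝ X] [FiniteDimensional ℝ X]
  {H : Submodule ℝ (X →ₗ[ℝ] X)}

local notation "tr" => LinearMap.trace ℝ X

theorem projH_add (H : Submodule ℝ (X →ₗ[ℝ] X)) (A B : X →ₗ[ℝ] X) :
    projH H (A + B) = projH H A + projH H B :=
  letI : NormedAddCommGroup (X →ₗ[ℝ] X) := opInnerCore.toNormedAddCommGroup
  letI : InnerProductSpace ℝ (X →ₗ[ℝ] X) := InnerProductSpace.ofCore opInnerCore.toCore
  map_add H.starProjection A B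

theorem projH_smul (H : Submodule ℝ (X →ₗ[ℝ] X)) (c : ℝ) (A : X →ₗ[ℝ] X) :
    projH H (c • A) = c • projH H A :=
  letI : NormedAddCommGroup (X →ₗ[ℝ] X) := opInnerCore.toNormedAddCommGroup
  letI : InnerProductSpace ℝ (X →ₗ[ℝ] X) := InnerProductSpace.ofCore opInnerCore.toCore
  map_smul H.starProjection c A

theorem projH_sub (H : Submodule ℝ (X →ₗ[ℝ] X)) (A B : X →ₗ[ℝ] X) :
    projH H (A - B) = projH H A - projH H B := by
  rw [sub_eq_add_neg, projH_add, ← neg_one_smul ℝ B, projH_smul, neg_one_smul, ← sub_eq_add_neg]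

theorem eq_projH {A B : X →ₗ[ℝ] X} (hB : B ∈ H)
    (h : ∀ F ∈ H, LinearMap.trace ℝ X ((A - B) ∘ₗ F.adjoint) = 0) : projH H A = B :=
  letI : NormedAddCommGroup (X →ₗ[ℝ] X) := opInnerCore.toNormedAddCommGroup
  letI : InnerProductSpace ℝ (X →ₗ[ℝ] X) := InnerProductSpace.ofCore opInnerCore.toCore
  Submodule.eq_starProjection_of_mem_of_inner_eq_zero hB h

namespace IsPreconditionerSpace

variable (hH : IsPreconditionerSpace H)
include hH

theorem adjoint_eq {F : X →ₗ[ℝ] X} (hF : F ∈ H) : F.adjoint = F :=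
  LinearMap.isSelfAdjoint_iff'.1 ((LinearMap.isSymmetric_iff_isSelfAdjoint F).1 (hH.symm F hF))

theorem trace_projH_mul (A : X →ₗ[ℝ] X) {F : X →ₗ[ℝ] X} (hF : F ∈ H) :
    tr (projH H A * F) = tr (A * F) := by
  have h : tr ((A - projH H A) * F) = 0 := by
    have := trace_sub_projH H A F hF
    rwa [hH.adjoint_eq hF] at this
  rw [sub_mul, map_sub] at h
  linarith

/-- `A - projH H A` is orthogonal to `H`, so the projection is invisible to `F`. This turns the
traces in the variational bounds into quadratic forms. -/
theorem trace_mul_projH_outer (x : X) {F : X →ₗ[ℝ] X} (hF : F ∈ H) :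
    tr (F * projH H (outer x)) = ⟪x, F x⟫ := by
  rw [LinearMap.trace_mul_comm, hH.trace_projH_mul _ hF, trace_outer_mul]

theorem projH_eq_of_trace {A B : X →ₗ[ℝ] X} (hB : B ∈ H)
    (h : ∀ F ∈ H, tr (A * F) = tr (B * F)) : projH H A = B := by
  refine eq_projH hB fun F hF => ?_
  rw [hH.adjoint_eq hF]
  change tr ((A - B) * F) = 0
  rw [sub_mul, map_sub, h F hF, sub_self]

theorem conj_mem {A F : X →ₗ[ℝ] X} (hA : A ∈ H) (hF : F ∈ H) : A * F * A ∈ H :=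
  hH.mul_mem A hA F hF

theorem one_mem : (1 : X →ₗ[ℝ] X) ∈ H := hH.id_mem

/-- Conjugation by `P` preserves `H` and is self-adjoint for the trace pairing, so it commutes with
the orthogonal projection. -/
theorem projH_conj {P : X →ₗ[ℝ] X} (hP : P ∈ H) (A : X →ₗ[ℝ] X) :
    projH H (P * A * P) = P * projH H A * P := by
  refine hH.projH_eq_of_trace (hH.conj_mem hP (projH_mem H A)) fun F hF => ?_
  have e : ∀ B : X →ₗ[ℝ] X, tr (P * B * P * F) = tr (B * (P * F * P)) := fun B => by
    rw [mul_assoc, mul_assoc, LinearMap.trace_mul_comm]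
    simp only [mul_assoc]
  rw [e, e, hH.trace_projH_mul _ (hH.conj_mem hP hF)]

theorem projH_one : projH H (1 : X →ₗ[ℝ] X) = 1 :=
  hH.projH_eq_of_trace hH.one_mem fun _ _ => rfl

/-- `H` is closed under `A F A` but not under products, hence the recursion `A ^ (n + 2) = A A ^ n
A` with two base cases. -/
theorem pow_mem {A : X →ₗ[ℝ] X} (hA : A ∈ H) : ∀ n : ℕ, A ^ n ∈ H
  | 0 => by simpa using hH.one_mem
  | 1 => by simpa using hA
  | n + 2 => by
    have := hH.conj_mem hA (pow_mem hA n)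
    rwa [← pow_succ', ← pow_succ] at this

theorem aeval_mem {A : X →ₗ[ℝ] X} (hA : A ∈ H) (q : Polynomial ℝ) :
    Polynomial.aeval A q ∈ H := by
  rw [Polynomial.aeval_eq_sum_range]
  exact H.sum_mem fun i _ => H.smul_mem _ (hH.pow_mem hA i)

theorem opSqrt_mem {A : X →ₗ[ℝ] X} (hA : A.IsPositive) (hAH : A ∈ H) : opSqrt A ∈ H := by
  obtain ⟨q, hq⟩ := opSqrt_eq_aeval hA
  rw [hq]
  exact hH.aeval_mem hAH q

/-- The map `F ↦ A F A` is injective on the finite-dimensional space `H`, hence onto; a preimage `F`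
of `A` itself satisfies `A F = 1`. -/
theorem inverse_mem {A : X →ₗ[ℝ] X} (hA : IsPosDef A) (hAH : A ∈ H) : A⁻¹ʳ ∈ H := by
  let L : H →ₗ[ℝ] H :=
    { toFun := fun F => ⟨A * F.1 * A, hH.conj_mem hAH F.2⟩
      map_add' := fun F K => by ext1; simp [mul_add, add_mul]
      map_smul' := fun c F => by ext1; simp }
  have hinj : Function.Injective L := fun F K h => by
    have h' : A * F.1 * A = A * K.1 * A := congrArg Subtype.val h
    ext1
    exact hA.isUnit.mul_left_cancel (hA.isUnit.mul_right_cancel h')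
  obtain ⟨F, hF⟩ := LinearMap.injective_iff_surjective.1 hinj ⟨A, hAH⟩
  have h' : A * F.1 * A = A := congrArg Subtype.val hF
  have h1 : A * F.1 = 1 := hA.isUnit.mul_right_cancel (h'.trans (one_mul A).symm)
  have h2 : F.1 = A⁻¹ʳ := hA.isUnit.mul_left_cancel (h1.trans hA.mul_inverse.symm)
  exact h2 ▸ F.2

/-- The hypothesis covers positive definite operators only; it is applied to `A + t • 1` with `t`
small, using that the projection fixes the identity. -/
theorem isPositive_projH {A : X →ₗ[ℝ] X} (hA : A.IsPositive) : (projH H A).IsPositive := by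
  refine isPositive_iff_real.2 ⟨hH.symm _ (projH_mem H A), fun x => ?_⟩
  refine le_of_forall_pos_le_add fun e he => ?_
  obtain ⟨t, ht, hte⟩ : ∃ t : ℝ, 0 < t ∧ t * ⟪x, x⟫ ≤ e := by
    have := real_inner_self_nonneg (x := x)
    refine ⟨e / (⟪x, x⟫ + 1), by positivity, ?_⟩
    rw [div_mul_eq_mul_div, div_le_iff₀ (by positivity)]
    nlinarith
  have h := (hH.proj_posDef _ (isPosDef_add_smul_one hA ht)).isPositive.inner_nonneg_right x
  rw [projH_add, projH_smul, hH.projH_one, LinearMap.add_apply, inner_add_right,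
    LinearMap.smul_apply, Module.End.one_apply, real_inner_smul_right] at h
  linarith

theorem isPositive_projH_outer (x : X) : (projH H (outer x)).IsPositive :=
  hH.isPositive_projH (outer_isPositive x)

end IsPreconditionerSpace

/-- Fenchel–Young inequality for the quadratic form of `P`, with equality at `v = P⁻¹ x`. -/
theorem two_inner_le {P : X →ₗ[ℝ] X} (hP : IsPosDef P) (x v : X) :
    2 * ⟪x, v⟫ ≤ ⟪x, P⁻¹ʳ x⟫ + ⟪v, P v⟫ := by
  have h := hP.isPositive.inner_nonneg_right (P⁻¹ʳ x - v)
  rw [map_sub, hP.apply_inverse, inner_sub_left, inner_sub_right, inner_sub_right, ← hP.1,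
    hP.apply_inverse, real_inner_comm x (P⁻¹ʳ x), real_inner_comm x v] at h
  linarith

/-- Joint subadditivity of `(x, P) ↦ ⟨x, P⁻¹ x⟩`: the maximizer `z` of the dual problem for `(x + y,
P + Q)` is a test vector for both problems on the right. -/
theorem inner_inverse_add_le {P Q : X →ₗ[ℝ] X} (hP : IsPosDef P) (hQ : IsPosDef Q) (x y : X) :
    ⟪x + y, (P + Q)⁻¹ʳ (x + y)⟫ ≤ ⟪x, P⁻¹ʳ x⟫ + ⟪y, Q⁻¹ʳ y⟫ := by
  have hPQ := hP.add_isPositive hQ.isPositive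
  set z := (P + Q)⁻¹ʳ (x + y) with hz
  have h1 := two_inner_le hP x z
  have h2 := two_inner_le hQ y z
  have h3 : ⟪z, (P + Q) z⟫ = ⟪x + y, z⟫ := by rw [hz, hPQ.apply_inverse, real_inner_comm]
  rw [LinearMap.add_apply, inner_add_right, inner_add_left] at h3
  rw [inner_add_left]
  linarith

/-! ### The primal and dual norms are seminorms. -/

section Norms

theorem continuous_seminorm (q : Seminorm ℝ X) : Continuous q := by
  rw [← continuousOn_univ]
  exact q.convexOn.continuousOn isOpen_univ

/-- Young's inequality for rank-one operators: the difference is `t⁻¹ • outer (t • x - y)`. -/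
theorem isPositive_young_outer {t : ℝ} (ht : 0 < t) (x y : X) :
    ((1 + t) • outer x + (1 + t⁻¹) • outer y - outer (x + y)).IsPositive := by
  have e : (1 + t) • outer x + (1 + t⁻¹) • outer y - outer (x + y) =
      t⁻¹ • outer (t • x - y) := by
    ext z
    simp only [LinearMap.sub_apply, LinearMap.add_apply, LinearMap.smul_apply, outer_apply,
      inner_sub_left, inner_add_left, real_inner_smul_left]
    have := ht.ne'
    match_scalars <;> field_simp <;> ring
  rw [e]
  exact (outer_isPositive _).smul_of_nonneg (inv_nonneg.2 ht.le)

namespace IsPreconditionerSpace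

variable (hH : IsPreconditionerSpace H)
include hH

theorem primalNorm_nonneg (x : X) : 0 ≤ primalNorm H x := norm_nonneg _

theorem primalNorm_le_iff {x : X} {c : ℝ} (hc : 0 ≤ c) :
    primalNorm H x ≤ c ↔ (c ^ 2 • 1 - projH H (outer x)).IsPositive :=
  opNorm_opSqrt_le_iff (hH.isPositive_projH_outer x) hc

theorem primalNorm_add_le (x y : X) : primalNorm H (x + y) ≤ primalNorm H x + primalNorm H y := by
  refine le_of_forall_pos_le_add fun e he => ?_
  set c := primalNorm H x + e / 2 with hc
  set d := primalNorm H y + e / 2 with hd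
  have hx := hH.primalNorm_nonneg x
  have hy := hH.primalNorm_nonneg y
  have hc0 : 0 < c := by positivity
  have hd0 : 0 < d := by positivity
  have e1 := (hH.primalNorm_le_iff hc0.le).1 (show primalNorm H x ≤ c by linarith)
  have e2 := (hH.primalNorm_le_iff hd0.le).1 (show primalNorm H y ≤ d by linarith)
  have key : primalNorm H (x + y) ≤ c + d := by
    rw [hH.primalNorm_le_iff (by positivity)]
    -- The parameter `d / c` is optimal: `(1 + d / c) c² + (1 + c / d) d² = (c + d)²`. The `e / 2`
    -- in `c` and `d` keeps both positive.
    have e3 := hH.isPositive_projH (isPositive_young_outer (div_pos hd0 hc0) x y)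
    rw [projH_sub, projH_add, projH_smul, projH_smul] at e3
    have e4 := ((e1.smul_of_nonneg (show 0 ≤ 1 + d / c by positivity)).add
      (e2.smul_of_nonneg (show 0 ≤ 1 + (d / c)⁻¹ by positivity))).add e3
    convert e4 using 1
    have h1 : (c + d) ^ 2 = (1 + d / c) * c ^ 2 + (1 + (d / c)⁻¹) * d ^ 2 := by
      field_simp
      ring
    rw [h1]
    module
  linarith

theorem primalNorm_smul_le (c : ℝ) (x : X) : primalNorm H (c • x) ≤ ‖c‖ * primalNorm H x := by
  have hx := hH.primalNorm_nonneg x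
  rw [hH.primalNorm_le_iff (by positivity), outer_smul, projH_smul]
  have h := ((hH.primalNorm_le_iff hx).1 le_rfl).smul_of_nonneg (sq_nonneg c)
  convert h using 1
  rw [mul_pow, Real.norm_eq_abs, sq_abs]
  module

theorem dualNorm_eq (x : X) : dualNorm H x = tr (opSqrt (projH H (outer x))) :=
  traceNorm_eq_trace (opSqrt_isPositive _)

theorem dualNorm_nonneg (x : X) : 0 ≤ dualNorm H x := by
  rw [hH.dualNorm_eq]
  exact (opSqrt_isPositive _).trace_nonneg

theorem two_mul_dualNorm_le (x : X) {P : X →ₗ[ℝ] X} (hP : IsPosDef P) (hPH : P ∈ H) :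
    2 * dualNorm H x ≤ ⟪x, P⁻¹ʳ x⟫ + tr P := by
  have := two_mul_trace_opSqrt_le (hH.isPositive_projH_outer x) hP
  rwa [hH.trace_mul_projH_outer x (hH.inverse_mem hP hPH), ← hH.dualNorm_eq] at this

/-- Near-optimality in the bound of `two_mul_dualNorm_le`: shift the possibly singular root by `t •
1`. Thus the dual norm is half an infimum over `P ∈ H`. -/
theorem exists_posDef_le_dualNorm (x : X) {e : ℝ} (he : 0 < e) :
    ∃ P ∈ H, IsPosDef P ∧ ⟪x, P⁻¹ʳ x⟫ + tr P ≤ 2 * dualNorm H x + e := by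
  obtain ⟨t, ht, hte⟩ : ∃ t : ℝ, 0 < t ∧ t * Module.finrank ℝ X ≤ e := by
    refine ⟨e / (Module.finrank ℝ X + 1), by positivity, ?_⟩
    rw [div_mul_eq_mul_div, div_le_iff₀ (by positivity)]
    nlinarith
  have hA := hH.isPositive_projH_outer x
  have hQ := opSqrt_isPositive (projH H (outer x))
  have hP := isPosDef_add_smul_one hQ ht
  have hPH : opSqrt (projH H (outer x)) + t • 1 ∈ H :=
    H.add_mem (hH.opSqrt_mem hA (projH_mem H _)) (H.smul_mem _ hH.one_mem)
  refine ⟨_, hPH, hP, ?_⟩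
  have h1 := trace_inverse_mul_sq_le hQ hP (isPositive_add_smul_one_sub ht.le)
  rw [opSqrt_mul_opSqrt hA, hH.trace_mul_projH_outer x (hH.inverse_mem hP hPH)] at h1
  rw [map_add (LinearMap.trace ℝ X), map_smul, trace_id_eq_finrank, smul_eq_mul, hH.dualNorm_eq]
  linarith

/-- If `P` and `Q` are nearly optimal for `x` and `y`, then `P + Q` is a test operator for `x + y`,
and both terms of the objective are subadditive. -/
theorem dualNorm_add_le (x y : X) : dualNorm H (x + y) ≤ dualNorm H x + dualNorm H y := by
  refine le_of_forall_pos_le_add fun e he => ?_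
  obtain ⟨P, hPH, hP, h1⟩ := hH.exists_posDef_le_dualNorm x he
  obtain ⟨Q, hQH, hQ, h2⟩ := hH.exists_posDef_le_dualNorm y he
  have h3 := hH.two_mul_dualNorm_le (x + y) (hP.add_isPositive hQ.isPositive) (H.add_mem hPH hQH)
  have h4 := inner_inverse_add_le hP hQ x y
  rw [map_add (LinearMap.trace ℝ X)] at h3
  linarith

theorem dualNorm_smul_le (c : ℝ) (x : X) : dualNorm H (c • x) ≤ ‖c‖ * dualNorm H x := by
  have hA := hH.isPositive_projH_outer x
  have hQ := opSqrt_isPositive (projH H (outer x))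
  rw [hH.dualNorm_eq, hH.dualNorm_eq, ← smul_eq_mul, ← map_smul]
  refine trace_le_of_sq_le (opSqrt_isPositive _).isSymmetric
    (hQ.smul_of_nonneg (norm_nonneg c)) ?_
  rw [opSqrt_mul_opSqrt (hH.isPositive_projH_outer _), outer_smul, projH_smul, smul_mul_smul_comm,
    opSqrt_mul_opSqrt hA, Real.norm_eq_abs, abs_mul_abs_self, ← sq, sub_self]
  exact LinearMap.isPositive_zero

/-- The primal norm as a seminorm. -/
noncomputable def primalSeminorm : Seminorm ℝ X :=
  Seminorm.ofSMulLE (primalNorm H)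
    (le_antisymm (by simpa using hH.primalNorm_smul_le 0 0) (hH.primalNorm_nonneg 0))
    hH.primalNorm_add_le hH.primalNorm_smul_le

/-- The dual norm as a seminorm. -/
noncomputable def dualSeminorm : Seminorm ℝ X :=
  Seminorm.ofSMulLE (dualNorm H)
    (le_antisymm (by simpa using hH.dualNorm_smul_le 0 0) (hH.dualNorm_nonneg 0))
    hH.dualNorm_add_le hH.dualNorm_smul_le

theorem primalSeminorm_apply (x : X) : hH.primalSeminorm x = primalNorm H x := rfl

theorem continuous_primalNorm : Continuous (primalNorm H) :=
  continuous_seminorm hH.primalSeminorm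

theorem continuous_dualNorm : Continuous (dualNorm H) := continuous_seminorm hH.dualSeminorm

/-- Take the trace of `c² I - proj_H (x⟨x, ·⟩) ≥ 0`. The dimension enters harmlessly: the bound
serves only for integrability of the increments. -/
theorem norm_sq_le_of_primalNorm_le {x : X} {c : ℝ} (hc : 0 ≤ c) (h : primalNorm H x ≤ c) :
    ‖x‖ ^ 2 ≤ c ^ 2 * Module.finrank ℝ X := by
  have h1 := ((hH.primalNorm_le_iff hc).1 h).trace_nonneg
  have h2 := hH.trace_mul_projH_outer x hH.one_mem
  rw [one_mul, Module.End.one_apply, real_inner_self_eq_norm_sq] at h2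
  rw [map_sub, map_smul, trace_id_eq_finrank, h2, smul_eq_mul] at h1
  linarith

end IsPreconditionerSpace

end Norms

end PreconditionerSpace

end O2NC

namespace O2NC

/-! ### The Leon potential: its gradient and its growth in one step. -/

section Leon

open scoped Ring

variable {X : Type*} [NormedAddCommGroup X] [InnerProductSpace ℝ X] [FiniteDimensional ℝ X]
  {H : Submodule ℝ (X →ₗ[ℝ] X)}

local notation "tr" => LinearMap.trace ℝ X

/-- The operator `√(proj_H (m⟨m, ·⟩) + S)`. -/
noncomputable def leonRoot (H : Submodule ℝ (X →ₗ[ℝ] X)) (S : X →ₗ[ℝ] X) (m : X) : X →ₗ[ℝ] X :=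
  opSqrt (projH H (outer m) + S)

theorem dualReg_eq (η : ℝ) (S : X →ₗ[ℝ] X) (m : X) :
    dualReg H η S m = η * tr (leonRoot H S m) := by
  rw [dualReg, traceNorm_eq_trace (opSqrt_isPositive _)]
  rfl

namespace IsPreconditionerSpace

variable (hH : IsPreconditionerSpace H) {S : X →ₗ[ℝ] X}
include hH

theorem isPosDef_add (hS : IsPosDef S) (m : X) : IsPosDef (projH H (outer m) + S) := by
  rw [add_comm]
  exact hS.add_isPositive (hH.isPositive_projH_outer m)

theorem isPosDef_leonRoot (hS : IsPosDef S) (m : X) : IsPosDef (leonRoot H S m) :=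
  isPosDef_opSqrt (hH.isPosDef_add hS m)

theorem leonRoot_mul_self (hS : IsPosDef S) (m : X) :
    leonRoot H S m * leonRoot H S m = projH H (outer m) + S :=
  opSqrt_mul_opSqrt (hH.isPosDef_add hS m).isPositive

theorem leonRoot_mem (hS : IsPosDef S) (hSH : S ∈ H) (m : X) : leonRoot H S m ∈ H :=
  hH.opSqrt_mem (hH.isPosDef_add hS m).isPositive (H.add_mem (projH_mem H _) hSH)

omit hH in
theorem trace_inverse_mul_self_mul {P : X →ₗ[ℝ] X} (hP : IsPosDef P) :
    tr (P⁻¹ʳ * (P * P)) = tr P := by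
  rw [← mul_assoc, hP.inverse_mul, one_mul]

theorem trace_mul_add (m : X) {F : X →ₗ[ℝ] X} (hF : F ∈ H) (S : X →ₗ[ℝ] X) :
    tr (F * (projH H (outer m) + S)) = ⟪m, F m⟫ + tr (F * S) := by
  rw [mul_add, map_add, hH.trace_mul_projH_outer m hF]

/-- The root `Q` at `m` is optimal at `m` and still admissible as a test operator at `m + h`;
expanding the quadratic form gives the linear and quadratic terms. -/
theorem trace_leonRoot_add_le (hS : IsPosDef S) (hSH : S ∈ H) (m h : X) :
    tr (leonRoot H S (m + h)) ≤ tr (leonRoot H S m) + ⟪(leonRoot H S m)⁻¹ʳ m, h⟫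
      + 1 / 2 * ⟪h, (leonRoot H S m)⁻¹ʳ h⟫ := by
  set Q := leonRoot H S m with hQdef
  have hQ : IsPosDef Q := hH.isPosDef_leonRoot hS m
  have hQH : Q⁻¹ʳ ∈ H := hH.inverse_mem hQ (hH.leonRoot_mem hS hSH m)
  have h1 := two_mul_trace_opSqrt_le (hH.isPosDef_add hS (m + h)).isPositive hQ
  have h2 := trace_inverse_mul_self_mul hQ
  rw [hH.leonRoot_mul_self hS, hH.trace_mul_add m hQH] at h2
  rw [hH.trace_mul_add _ hQH] at h1
  have h3 : ⟪m, Q⁻¹ʳ h⟫ = ⟪Q⁻¹ʳ m, h⟫ := by rw [hQ.inverse.1]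
  have h4 : ⟪h, Q⁻¹ʳ m⟫ = ⟪Q⁻¹ʳ m, h⟫ := real_inner_comm _ _
  simp only [map_add, inner_add_left, inner_add_right] at h1
  rw [h3, h4] at h1
  change 2 * tr (leonRoot H S (m + h)) ≤ _ at h1
  linarith

/-- Convexity of the potential along the candidate gradient. Together with the upper bound it
squeezes the linearization error between zero and a quadratic form. -/
theorem le_trace_leonRoot_add (hS : IsPosDef S) (hSH : S ∈ H) (m h : X) :
    tr (leonRoot H S m) + ⟪(leonRoot H S m)⁻¹ʳ m, h⟫ ≤ tr (leonRoot H S (m + h)) := by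
  set Q := leonRoot H S m with hQdef
  set P := leonRoot H S (m + h) with hPdef
  have hQ : IsPosDef Q := hH.isPosDef_leonRoot hS m
  have hP : IsPosDef P := hH.isPosDef_leonRoot hS _
  have hPH : P ∈ H := hH.leonRoot_mem hS hSH _
  have hQiH : Q⁻¹ʳ ∈ H := hH.inverse_mem hQ (hH.leonRoot_mem hS hSH m)
  have hPiH : P⁻¹ʳ ∈ H := hH.inverse_mem hP hPH
  have hP2 := trace_inverse_mul_self_mul hP
  rw [hH.leonRoot_mul_self hS, hH.trace_mul_add _ hPiH] at hP2
  have hQ2 := trace_inverse_mul_self_mul hQ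
  rw [hH.leonRoot_mul_self hS, hH.trace_mul_add _ hQiH] at hQ2
  -- This is `(P⁻¹ - Q⁻¹) P (P⁻¹ - Q⁻¹)`. Pairing it with `S`, and using Fenchel–Young at `Q⁻¹ m`
  -- for the rank-one part, gives the inequality after `P²` and `Q²` are expanded.
  have hK : (P⁻¹ʳ - (2 : ℝ) • Q⁻¹ʳ + Q⁻¹ʳ * P * Q⁻¹ʳ).IsPositive := by
    refine isPositive_iff_real.2 ⟨H.add_mem (H.sub_mem hPiH (H.smul_mem 2 hQiH))
      (hH.conj_mem hQiH hPH) |> hH.symm _, fun x => ?_⟩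
    have := two_inner_le hP x (Q⁻¹ʳ x)
    simp only [LinearMap.add_apply, LinearMap.sub_apply, LinearMap.smul_apply,
      Module.End.mul_apply, inner_add_right, inner_sub_right, real_inner_smul_right]
    rw [← hQ.inverse.1 x (P _)]
    linarith
  have h1 := trace_mul_nonneg hK hS.isPositive
  simp only [add_mul, sub_mul, map_add, map_sub, smul_mul_assoc, map_smul, smul_eq_mul] at h1
  have h2 := two_inner_le hP (m + h) (Q⁻¹ʳ m)
  have h3 := hH.trace_mul_add m (hH.conj_mem hQiH hPH) S
  rw [← hH.leonRoot_mul_self hS] at h3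
  have h4 : Q⁻¹ʳ * P * Q⁻¹ʳ * (leonRoot H S m * leonRoot H S m) = Q⁻¹ʳ * (P * Q) := by
    rw [← hQdef]
    calc _ = Q⁻¹ʳ * P * (Q⁻¹ʳ * Q) * Q := by noncomm_ring
      _ = _ := by rw [hQ.inverse_mul]; noncomm_ring
  rw [h4, LinearMap.trace_mul_comm, mul_assoc, hQ.mul_inverse, mul_one, Module.End.mul_apply,
    Module.End.mul_apply, ← hQ.inverse.1 m (P _)] at h3
  rw [inner_add_left, real_inner_comm (Q⁻¹ʳ m) h] at h2
  linarith

theorem hasGradientAt_dualReg (hS : IsPosDef S) (hSH : S ∈ H) (η : ℝ) (m : X) :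
    HasGradientAt (dualReg H η S) (η • (leonRoot H S m)⁻¹ʳ m) m := by
  rw [hasGradientAt_iff_isLittleO_nhds_zero]
  set Q := leonRoot H S m with hQ
  set K := ‖LinearMap.toContinuousLinearMap Q⁻¹ʳ‖
  have hO : (fun h => dualReg H η S (m + h) - dualReg H η S m - ⟪η • Q⁻¹ʳ m, h⟫)
      =O[nhds 0] fun h => ‖h‖ ^ 2 := by
    refine Asymptotics.IsBigO.of_bound (|η| * K) (Filter.Eventually.of_forall fun h => ?_)
    have h1 := hH.trace_leonRoot_add_le hS hSH m h
    have h2 := hH.le_trace_leonRoot_add hS hSH m h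
    have h3 : ⟪h, Q⁻¹ʳ h⟫ ≤ K * ‖h‖ ^ 2 := by
      refine (real_inner_le_norm _ _).trans ?_
      have := (LinearMap.toContinuousLinearMap Q⁻¹ʳ).le_opNorm h
      rw [LinearMap.coe_toContinuousLinearMap'] at this
      nlinarith [norm_nonneg h]
    have h4 : 0 ≤ K * ‖h‖ ^ 2 := by positivity
    rw [dualReg_eq, dualReg_eq, real_inner_smul_left, ← mul_sub, ← mul_sub, norm_mul,
      Real.norm_eq_abs, Real.norm_eq_abs, mul_assoc, Real.norm_eq_abs,
      abs_of_nonneg (sq_nonneg ‖h‖)]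
    refine mul_le_mul_of_nonneg_left ?_ (abs_nonneg _)
    rw [← hQ] at h1 h2 ⊢
    rw [abs_of_nonneg (by linarith)]
    linarith
  exact hO.trans_isLittleO (Asymptotics.isLittleO_norm_pow_id one_lt_two)

theorem gradient_dualReg (hS : IsPosDef S) (hSH : S ∈ H) (η : ℝ) (m : X) :
    gradient (dualReg H η S) m = η • (leonRoot H S m)⁻¹ʳ m :=
  (hH.hasGradientAt_dualReg hS hSH η m).gradient

/-- By `projH_conj`, `proj_H` of the rank-one operator of `Q⁻¹ m` is `Q⁻¹ (Q² - S) Q⁻¹ = I - Q⁻¹ S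
Q⁻¹ ≤ I`. -/
theorem primalNorm_inverse_leonRoot_le (hS : IsPosDef S) (hSH : S ∈ H) (m : X) :
    primalNorm H ((leonRoot H S m)⁻¹ʳ m) ≤ 1 := by
  set Q := leonRoot H S m with hQdef
  have hQ : IsPosDef Q := hH.isPosDef_leonRoot hS m
  have hQiH : Q⁻¹ʳ ∈ H := hH.inverse_mem hQ (hH.leonRoot_mem hS hSH m)
  rw [hH.primalNorm_le_iff zero_le_one]
  have e1 : outer (Q⁻¹ʳ m) = Q⁻¹ʳ * outer m * Q⁻¹ʳ := by
    ext x
    simp only [outer_apply, Module.End.mul_apply, map_smul]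
    rw [hQ.inverse.1]
  have h := isPositive_conj hQ.inverse.1 hS.isPositive
  convert h using 1
  have e2 : S = Q * Q - projH H (outer m) := by
    rw [hQdef, hH.leonRoot_mul_self hS, add_sub_cancel_left]
  rw [e1, hH.projH_conj hQiH]
  conv_rhs => rw [e2]
  have e3 : Q⁻¹ʳ * (Q * Q - projH H (outer m)) * Q⁻¹ʳ =
      (Q⁻¹ʳ * Q) * (Q * Q⁻¹ʳ) - Q⁻¹ʳ * projH H (outer m) * Q⁻¹ʳ := by noncomm_ring
  rw [e3, hQ.inverse_mul, hQ.mul_inverse]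
  simp

/-- One step of generalized Leon: the potential `tr √(proj_H (m⟨m, ·⟩) + S)` grows by at most the
linearization plus the increment of `4 tr √S`. -/
theorem trace_leonRoot_step (hS : IsPosDef S) (hSH : S ∈ H) (m g : X) :
    tr (leonRoot H (S + projH H (outer g)) (m + g)) ≤ tr (leonRoot H S m)
      + ⟪(leonRoot H S m)⁻¹ʳ m, g⟫
      + 4 * (tr (opSqrt (S + projH H (outer g))) - tr (opSqrt S)) := by
  have hg := hH.isPositive_projH_outer g
  have hm := hH.isPositive_projH_outer m
  have hS' : IsPosDef (S + projH H (outer g)) := hS.add_isPositive hg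
  have hS'H : S + projH H (outer g) ∈ H := H.add_mem hSH (projH_mem H _)
  set S' := S + projH H (outer g) with hS'def
  set Q := leonRoot H S m with hQdef
  set R := opSqrt S' - opSqrt S with hRdef
  have hQ : IsPosDef Q := hH.isPosDef_leonRoot hS m
  have hQH : Q ∈ H := hH.leonRoot_mem hS hSH m
  have hQiH : Q⁻¹ʳ ∈ H := hH.inverse_mem hQ hQH
  have hR : R.IsPositive := isPositive_opSqrt_sub hS.isPositive hS'.isPositive
    (by rwa [hS'def, add_sub_cancel_left])
  have hrS'H := hH.opSqrt_mem hS'.isPositive hS'H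
  have hRH : R ∈ H := H.sub_mem hrS'H (hH.opSqrt_mem hS.isPositive hSH)
  -- Test operator for the new root: it dominates `Q`, which controls the old terms, and it
  -- dominates `√S'`, which controls those quadratic in `g`. The inequality is linear in `tr R`, so
  -- it will telescope.
  set P := Q + R with hPdef
  have hP : IsPosDef P := hQ.add_isPositive hR
  have hPH : P ∈ H := H.add_mem hQH hRH
  have hPiH : P⁻¹ʳ ∈ H := hH.inverse_mem hP hPH
  have hrS' := isPosDef_opSqrt hS'
  have hrS'iH := hH.inverse_mem hrS' hrS'H
  have hPS' : (P - opSqrt S').IsPositive := by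
    have : P - opSqrt S' = Q - opSqrt S := by rw [hPdef, hRdef]; abel
    rw [this]
    exact isPositive_opSqrt_sub hS.isPositive (hH.isPosDef_add hS m).isPositive
      (by rwa [add_sub_cancel_right])
  have hPQ : (P - Q).IsPositive := by rwa [hPdef, add_sub_cancel_left]
  have hS'tr : ∀ {F : X →ₗ[ℝ] X}, F ∈ H → tr (F * S') = ⟪g, F g⟫ + tr (F * S) := fun hF => by
    rw [hS'def, add_comm S, hH.trace_mul_add g hF]
  -- Pass from `P` to `√S'` by antitonicity of the inverse, then bound `tr √S` with test operator
  -- `√S'`.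
  have hgP : ⟪g, P⁻¹ʳ g⟫ ≤ 2 * tr R := by
    refine (inner_inverse_antitone hrS' hP hPS' g).trans ?_
    have h1 := two_mul_trace_opSqrt_le hS.isPositive hrS'
    have h2 := trace_inverse_mul_self_mul hrS'
    rw [opSqrt_mul_opSqrt hS'.isPositive, hS'tr hrS'iH] at h2
    rw [hRdef, map_sub]
    linarith
  have hmain := two_mul_trace_opSqrt_le (hH.isPosDef_add hS' (m + g)).isPositive hP
  rw [hH.trace_mul_add _ hPiH, hS'tr hPiH] at hmain
  change 2 * tr (leonRoot H S' (m + g)) ≤ _ at hmain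
  have hPQ2 := trace_inverse_mul_sq_le hQ.isPositive hP hPQ
  rw [hH.leonRoot_mul_self hS, hH.trace_mul_add m hPiH] at hPQ2
  -- Resolvent identity: the linearization uses `Q⁻¹`, and the error carries a factor `R`, to be
  -- split by Young's inequality in the form of `R`.
  have hcross : ⟪m, P⁻¹ʳ g⟫ = ⟪Q⁻¹ʳ m, g⟫ - ⟪Q⁻¹ʳ m, R (P⁻¹ʳ g)⟫ := by
    have e : R (P⁻¹ʳ g) = g - Q (P⁻¹ʳ g) := by
      rw [eq_sub_iff_add_eq, add_comm, ← LinearMap.add_apply, ← hPdef, hP.apply_inverse]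
    rw [e, inner_sub_right, sub_sub_cancel, ← hQ.1, hQ.apply_inverse]
  have hyoung := hR.inner_nonneg_right (Q⁻¹ʳ m + P⁻¹ʳ g)
  have hRg : ⟪P⁻¹ʳ g, R (P⁻¹ʳ g)⟫ ≤ ⟪g, P⁻¹ʳ g⟫ := by
    have h1 := hQ.isPositive.inner_nonneg_right (P⁻¹ʳ g)
    have h2 : ⟪P⁻¹ʳ g, P (P⁻¹ʳ g)⟫ = ⟪g, P⁻¹ʳ g⟫ := by rw [hP.apply_inverse, real_inner_comm]
    rw [hPdef, LinearMap.add_apply, inner_add_right, ← hPdef] at h2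
    linarith
  -- The `m` part of `Q²` is at most all of `Q²`, and `tr (Q⁻¹ R Q⁻¹ Q²) = tr R`.
  have hRm : ⟪Q⁻¹ʳ m, R (Q⁻¹ʳ m)⟫ ≤ tr R := by
    have hQRQ := isPositive_conj hQ.inverse.1 hR
    have h1 := hH.trace_mul_add m (hH.conj_mem hQiH hRH) S
    have h2 := trace_mul_nonneg hQRQ hS.isPositive
    rw [← hH.leonRoot_mul_self hS, ← hQdef] at h1
    have h4 : Q⁻¹ʳ * R * Q⁻¹ʳ * (Q * Q) = Q⁻¹ʳ * (R * Q) := by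
      calc _ = Q⁻¹ʳ * R * (Q⁻¹ʳ * Q) * Q := by noncomm_ring
        _ = _ := by rw [hQ.inverse_mul]; noncomm_ring
    rw [h4, LinearMap.trace_mul_comm, mul_assoc, hQ.mul_inverse, mul_one, Module.End.mul_apply,
      Module.End.mul_apply, ← hQ.inverse.1 m (R _)] at h1
    linarith
  have hsymm : ⟪P⁻¹ʳ g, R (Q⁻¹ʳ m)⟫ = ⟪Q⁻¹ʳ m, R (P⁻¹ʳ g)⟫ := by
    rw [← hR.isSymmetric, real_inner_comm]
  have hgm : ⟪g, P⁻¹ʳ m⟫ = ⟪m, P⁻¹ʳ g⟫ := by rw [← hP.inverse.1, real_inner_comm]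
  have htrP : tr P = tr Q + tr R := by rw [hPdef, map_add]
  -- Twice the potential collects `4 tr R` from two copies of `⟨g, P⁻¹ g⟩`, `3 tr R` from the cross
  -- term and `tr R` from `tr P`: eight in all, hence the constant 4.
  rw [← map_sub, ← hRdef]
  simp only [map_add, inner_add_left, inner_add_right] at hmain hyoung
  rw [hgm, hcross, htrP] at hmain
  rw [hsymm] at hyoung
  linarith

theorem dualNorm_le_trace_leonRoot (hS : IsPosDef S) (m : X) :
    dualNorm H m ≤ tr (leonRoot H S m) := by
  rw [hH.dualNorm_eq]
  refine trace_opSqrt_mono (hH.isPositive_projH_outer m) (hH.isPosDef_add hS m).isPositive ?_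
  rw [add_sub_cancel_left]
  exact hS.isPositive

end IsPreconditionerSpace

end Leon

end O2NC

namespace O2NC

/-! ### Deterministic regret bound along a run. -/

section Pathwise

open scoped Ring

variable {X : Type*} [NormedAddCommGroup X] [InnerProductSpace ℝ X] [FiniteDimensional ℝ X]
  {H : Submodule ℝ (X →ₗ[ℝ] X)}

local notation "tr" => LinearMap.trace ℝ X

theorem invNormSq_eq_norm_sq {B : X →ₗ[ℝ] X} (hB : IsPosDef B) (v : X) :
    invNormSq B v = ‖opSqrt B⁻¹ʳ v‖ ^ 2 := by
  rw [← real_inner_self_eq_norm_sq, (opSqrt_isPositive _).isSymmetric, ← Module.End.mul_apply,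
    opSqrt_mul_opSqrt hB.inverse.isPositive]
  rfl

theorem invNormSq_nonneg {B : X →ₗ[ℝ] X} (hB : IsPosDef B) (v : X) : 0 ≤ invNormSq B v := by
  rw [invNormSq_eq_norm_sq hB]
  positivity

theorem invNormSq_smul (B : X →ₗ[ℝ] X) (c : ℝ) (v : X) :
    invNormSq B (c • v) = c ^ 2 * invNormSq B v := by
  rw [invNormSq, map_smul, real_inner_smul_left, real_inner_smul_right, ← mul_assoc, ← sq]
  rfl

/-- Fenchel–Young with the vector `K⁻¹ v`. The constant depends on `B` and is used only for
integrability. -/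
theorem exists_norm_sq_le_invNormSq {B : X →ₗ[ℝ] X} (hB : IsPosDef B) :
    ∃ K : ℝ, 0 < K ∧ ∀ v, ‖v‖ ^ 2 ≤ K * invNormSq B v := by
  set K := ‖LinearMap.toContinuousLinearMap B‖ + 1
  have hK : 0 < K := by positivity
  refine ⟨K, hK, fun v => ?_⟩
  have h1 := two_inner_le hB v (K⁻¹ • v)
  have h2 : ⟪v, B v⟫ ≤ K * ‖v‖ ^ 2 := by
    refine (real_inner_le_norm _ _).trans ?_
    have := (LinearMap.toContinuousLinearMap B).le_opNorm v
    rw [LinearMap.coe_toContinuousLinearMap'] at this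
    nlinarith [norm_nonneg v]
  rw [map_smul, real_inner_smul_left, real_inner_smul_right, real_inner_smul_right,
    real_inner_self_eq_norm_sq] at h1
  have h3 : K⁻¹ * (K⁻¹ * ⟪v, B v⟫) ≤ K⁻¹ * ‖v‖ ^ 2 := by
    refine mul_le_mul_of_nonneg_left ?_ (inv_nonneg.2 hK.le)
    rw [inv_mul_le_iff₀ hK]
    exact h2
  have h4 : K⁻¹ * ‖v‖ ^ 2 ≤ invNormSq B v := by
    rw [invNormSq]
    linarith
  rwa [inv_mul_le_iff₀ hK] at h4

namespace IsPreconditionerSpace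

variable (hH : IsPreconditionerSpace H) {B : X →ₗ[ℝ] X}
include hH

/-- Test operator `t • B`, whose trace is `t` by the normalization of `B`. -/
theorem two_mul_dualNorm_le_invNormSq (hB : IsPosDef B) (hBH : B ∈ H) (htr : traceNorm B = 1)
    {t : ℝ} (ht : 0 < t) (v : X) : 2 * dualNorm H v ≤ t⁻¹ * invNormSq B v + t := by
  have h := hH.two_mul_dualNorm_le v (hB.smul ht) (H.smul_mem t hBH)
  rwa [map_smul, ← traceNorm_eq_trace hB.isPositive, htr, smul_eq_mul, mul_one,
    inverse_smul_apply hB ht, real_inner_smul_right] at h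

theorem dualNorm_le_of_invNormSq_le (hB : IsPosDef B) (hBH : B ∈ H) (htr : traceNorm B = 1)
    {t : ℝ} (ht : 0 < t) {v : X} (hv : invNormSq B v ≤ t ^ 2) : dualNorm H v ≤ t := by
  have h := hH.two_mul_dualNorm_le_invNormSq hB hBH htr ht v
  have : t⁻¹ * invNormSq B v ≤ t := by
    rw [inv_mul_le_iff₀ ht, ← sq]
    exact hv
  linarith

/-- Test operator `δ • 1 + t • B`: the first summand controls the initial `δ² I` and the second the
rank-one terms. The dimension is multiplied by `δ` only. -/
theorem two_mul_trace_opSqrt_sum_le (hB : IsPosDef B) (hBH : B ∈ H) (htr : traceNorm B = 1)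
    {δ t : ℝ} (hδ : 0 < δ) (ht : 0 < t) {ι : Type*} (s : Finset ι) (v : ι → X) :
    2 * tr (opSqrt (δ ^ 2 • 1 + ∑ i ∈ s, projH H (outer (v i)))) ≤
      2 * (δ * Module.finrank ℝ X) + t⁻¹ * ∑ i ∈ s, invNormSq B (v i) + t := by
  have hpos : (δ ^ 2 • 1 + ∑ i ∈ s, projH H (outer (v i))).IsPositive :=
    (LinearMap.isPositive_one.smul_of_nonneg (sq_nonneg δ)).add
      (LinearMap.isPositive_sum s fun i _ => hH.isPositive_projH_outer (v i))
  have hδ1 := isPosDef_smul_one (X := X) hδ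
  have htB := hB.smul ht
  set P := δ • 1 + t • B with hPdef
  have hP : IsPosDef P := hδ1.add_isPositive htB.isPositive
  have hPi := hH.inverse_mem hP (H.add_mem (H.smul_mem δ hH.one_mem) (H.smul_mem t hBH))
  have h1 := two_mul_trace_opSqrt_le hpos hP
  have h2 : tr (P⁻¹ʳ * (δ ^ 2 • 1)) ≤ δ * Module.finrank ℝ X := by
    have h := (isPositive_inverse_sub_inverse hδ1 hP
      (by rw [hPdef, add_sub_cancel_left]; exact htB.isPositive)).trace_nonneg
    rw [inverse_smul_one hδ, map_sub, map_smul, trace_id_eq_finrank, smul_eq_mul] at h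
    rw [mul_smul_comm, mul_one, map_smul, smul_eq_mul]
    calc δ ^ 2 * tr P⁻¹ʳ ≤ δ ^ 2 * (δ⁻¹ * Module.finrank ℝ X) := by gcongr; linarith
      _ = δ * Module.finrank ℝ X := by field_simp
  have h3 : tr (P⁻¹ʳ * ∑ i ∈ s, projH H (outer (v i))) ≤
      t⁻¹ * ∑ i ∈ s, invNormSq B (v i) := by
    rw [Finset.mul_sum, map_sum, Finset.mul_sum]
    refine Finset.sum_le_sum fun i _ => ?_
    rw [hH.trace_mul_projH_outer _ hPi]
    have h := inner_inverse_antitone htB hP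
      (by rw [hPdef, add_sub_cancel_right]; exact hδ1.isPositive) (v i)
    rwa [inverse_smul_apply hB ht, real_inner_smul_right] at h
  have h4 : tr P = δ * Module.finrank ℝ X + t := by
    rw [hPdef, map_add, map_smul, map_smul, trace_id_eq_finrank,
      ← traceNorm_eq_trace hB.isPositive, htr, smul_eq_mul, smul_eq_mul, mul_one]
  rw [mul_add, map_add] at h1
  linarith

end IsPreconditionerSpace

/-- The loss vector that iteration `k` feeds to the online learner. -/
noncomputable def o2ncLoss {Ξ : Type*} (H : Submodule ℝ (X →ₗ[ℝ] X)) (β η δ : ℝ) (g : Ξ → X → X)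
    (w₀ : X) (ξ : ℕ → Ξ) (s : ℕ → ℝ) (k : ℕ) : X :=
  (β ^ k)⁻¹ • g (ξ k) (o2ncPoint H β η δ g w₀ ξ s k)

section Run

variable {Ξ : Type*} (H : Submodule ℝ (X →ₗ[ℝ] X)) (β η δ : ℝ) (g : Ξ → X → X) (w₀ : X)
  (ξ : ℕ → Ξ) (s : ℕ → ℝ)

theorem o2ncState_succ_m (k : ℕ) :
    (o2ncState H β η δ g w₀ ξ s (k + 1)).2.m =
      (o2ncState H β η δ g w₀ ξ s k).2.m + o2ncLoss H β η δ g w₀ ξ s k := rfl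

theorem o2ncState_succ_S (k : ℕ) :
    (o2ncState H β η δ g w₀ ξ s (k + 1)).2.S =
      (o2ncState H β η δ g w₀ ξ s k).2.S + projH H (outer (o2ncLoss H β η δ g w₀ ξ s k)) := rfl

theorem o2ncState_succ_x (k : ℕ) :
    (o2ncState H β η δ g w₀ ξ s (k + 1)).2.x =
      -gradient (dualReg H η (o2ncState H β η δ g w₀ ξ s (k + 1)).2.S)
        (o2ncState H β η δ g w₀ ξ s (k + 1)).2.m := rfl

theorem o2ncState_m_eq_sum (n : ℕ) :
    (o2ncState H β η δ g w₀ ξ s n).2.m =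
      ∑ k ∈ Finset.range n, o2ncLoss H β η δ g w₀ ξ s k := by
  induction n with
  | zero => rfl
  | succ n ih => rw [o2ncState_succ_m, ih, Finset.sum_range_succ]

theorem o2ncState_S_eq_sum (n : ℕ) :
    (o2ncState H β η δ g w₀ ξ s n).2.S =
      δ ^ 2 • 1 + ∑ k ∈ Finset.range n, projH H (outer (o2ncLoss H β η δ g w₀ ξ s k)) := by
  induction n with
  | zero => rw [Finset.sum_range_zero, add_zero]; rfl
  | succ n ih => rw [o2ncState_succ_S, ih, Finset.sum_range_succ, add_assoc]

variable {H} {δ} (hH : IsPreconditionerSpace H) (hδ : 0 < δ)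
include hH hδ

theorem isPosDef_o2ncState_S (n : ℕ) : IsPosDef (o2ncState H β η δ g w₀ ξ s n).2.S := by
  rw [o2ncState_S_eq_sum]
  exact (isPosDef_smul_one (by positivity)).add_isPositive
    (LinearMap.isPositive_sum _ fun i _ => hH.isPositive_projH_outer _)

theorem o2ncState_S_mem (n : ℕ) : (o2ncState H β η δ g w₀ ξ s n).2.S ∈ H := by
  rw [o2ncState_S_eq_sum]
  exact H.add_mem (H.smul_mem _ hH.one_mem) (H.sum_mem fun i _ => projH_mem H _)

theorem o2ncState_x_eq (n : ℕ) :
    (o2ncState H β η δ g w₀ ξ s n).2.x =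
      -(η • (leonRoot H (o2ncState H β η δ g w₀ ξ s n).2.S
        (o2ncState H β η δ g w₀ ξ s n).2.m)⁻¹ʳ (o2ncState H β η δ g w₀ ξ s n).2.m) := by
  cases n with
  -- The prescribed initial increment `0` fits the formula because the initial `m` is zero.
  | zero => simp [o2ncState, leonInit]
  | succ n =>
    rw [o2ncState_succ_x, hH.gradient_dualReg (isPosDef_o2ncState_S β η g w₀ ξ s hH hδ _)
      (o2ncState_S_mem β η g w₀ ξ s hH hδ _)]

theorem primalNorm_o2ncState_x_le (hη : 0 ≤ η) (n : ℕ) :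
    primalNorm H (o2ncState H β η δ g w₀ ξ s n).2.x ≤ η := by
  rw [o2ncState_x_eq β η g w₀ ξ s hH hδ, ← neg_smul]
  refine (hH.primalNorm_smul_le _ _).trans ?_
  have := hH.primalNorm_inverse_leonRoot_le (isPosDef_o2ncState_S β η g w₀ ξ s hH hδ n)
    (o2ncState_S_mem β η g w₀ ξ s hH hδ n) (o2ncState H β η δ g w₀ ξ s n).2.m
  rw [norm_neg, Real.norm_of_nonneg hη]
  nlinarith

/-- Telescoped form of `trace_leonRoot_step`. At `n = 0` the potential equals `tr √S`, so `3 η tr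
√S` must be added on the left for equality with `4 η tr √S`. -/
theorem sum_inner_o2ncLoss_add_potential_le (hη : 0 ≤ η) (n : ℕ) :
    ∑ k ∈ Finset.range n,
        ⟪(o2ncState H β η δ g w₀ ξ s k).2.x, o2ncLoss H β η δ g w₀ ξ s k⟫ +
      η * tr (leonRoot H (o2ncState H β η δ g w₀ ξ s n).2.S (o2ncState H β η δ g w₀ ξ s n).2.m) +
      3 * η * tr (opSqrt (o2ncState H β η δ g w₀ ξ s 0).2.S) ≤
    4 * η * tr (opSqrt (o2ncState H β η δ g w₀ ξ s n).2.S) := by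
  induction n with
  | zero =>
    have h : leonRoot H (o2ncState H β η δ g w₀ ξ s 0).2.S (o2ncState H β η δ g w₀ ξ s 0).2.m =
        opSqrt (o2ncState H β η δ g w₀ ξ s 0).2.S := by
      have h0 : (o2ncState H β η δ g w₀ ξ s 0).2.m = (0 : ℝ) • (0 : X) := (smul_zero _).symm
      rw [leonRoot, h0, outer_smul, projH_smul]
      simp
    rw [h, Finset.sum_range_zero]
    linarith
  | succ n ih =>
    have h := hH.trace_leonRoot_step (isPosDef_o2ncState_S β η g w₀ ξ s hH hδ n)
      (o2ncState_S_mem β η g w₀ ξ s hH hδ n) (o2ncState H β η δ g w₀ ξ s n).2.m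
      (o2ncLoss H β η δ g w₀ ξ s n)
    rw [← o2ncState_succ_S, ← o2ncState_succ_m] at h
    have h' := mul_le_mul_of_nonneg_left h hη
    have hx : ⟪(o2ncState H β η δ g w₀ ξ s n).2.x, o2ncLoss H β η δ g w₀ ξ s n⟫ =
        -(η * ⟪(leonRoot H (o2ncState H β η δ g w₀ ξ s n).2.S
          (o2ncState H β η δ g w₀ ξ s n).2.m)⁻¹ʳ (o2ncState H β η δ g w₀ ξ s n).2.m,
          o2ncLoss H β η δ g w₀ ξ s n⟫) := by
      rw [o2ncState_x_eq β η g w₀ ξ s hH hδ, inner_neg_left, real_inner_smul_left]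
    rw [Finset.sum_range_succ, hx]
    linarith

/-- Regret bound for generalized Leon, against the best comparator in the primal unit ball. -/
theorem regret_o2nc {B : X →ₗ[ℝ] X} (hB : IsPosDef B) (hBH : B ∈ H) (htr : traceNorm B = 1)
    {t : ℝ} (ht : 0 < t) (hη : 0 ≤ η) (n : ℕ) :
    ∑ k ∈ Finset.range n,
        ⟪(o2ncState H β η δ g w₀ ξ s k).2.x, o2ncLoss H β η δ g w₀ ξ s k⟫ +
      η * dualNorm H (∑ k ∈ Finset.range n, o2ncLoss H β η δ g w₀ ξ s k) ≤
    2 * η * (2 * (δ * Module.finrank ℝ X) +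
      t⁻¹ * ∑ k ∈ Finset.range n, invNormSq B (o2ncLoss H β η δ g w₀ ξ s k) + t) := by
  have h1 := sum_inner_o2ncLoss_add_potential_le β η g w₀ ξ s hH hδ hη n
  have h2 := hH.dualNorm_le_trace_leonRoot (isPosDef_o2ncState_S β η g w₀ ξ s hH hδ n)
    (o2ncState H β η δ g w₀ ξ s n).2.m
  have h3 := hH.two_mul_trace_opSqrt_sum_le hB hBH htr hδ ht (Finset.range n)
    (o2ncLoss H β η δ g w₀ ξ s)
  have h4 := (opSqrt_isPositive (o2ncState H β η δ g w₀ ξ s 0).2.S).trace_nonneg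
  rw [← o2ncState_S_eq_sum] at h3
  rw [← o2ncState_m_eq_sum]
  have h5 := mul_le_mul_of_nonneg_left h2 hη
  have h6 := mul_le_mul_of_nonneg_left h3 (mul_nonneg zero_le_two hη)
  have h7 := mul_nonneg hη h4
  linarith

end Run

end Pathwise

/-! ### Measurability of the iterates in the samples. -/

section Measurability

open scoped Ring

variable {X : Type*} [NormedAddCommGroup X] [InnerProductSpace ℝ X] [FiniteDimensional ℝ X]
  {H : Submodule ℝ (X →ₗ[ℝ] X)}

local notation "tr" => LinearMap.trace ℝ X

/-- With test operator `√B + r I`, both `tr P` and the perturbation `r² tr P⁻¹` cost at most `r dim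
X`. This quantitative bound gives continuity of `tr √A` up to singular operators. -/
theorem trace_opSqrt_le_add {A B : X →ₗ[ℝ] X} (hA : A.IsPositive) (hB : B.IsPositive) {r : ℝ}
    (hr : 0 < r) (h : (r ^ 2 • 1 - (A - B)).IsPositive) :
    tr (opSqrt A) ≤ tr (opSqrt B) + r * Module.finrank ℝ X := by
  have hQ := opSqrt_isPositive B
  have hr1 := isPosDef_smul_one (X := X) hr
  set P := opSqrt B + r • 1 with hPdef
  have hP : IsPosDef P := isPosDef_add_smul_one hQ hr
  have h1 := two_mul_trace_opSqrt_le hA hP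
  have h2 := trace_inverse_mul_sq_le hQ hP (isPositive_add_smul_one_sub hr.le)
  rw [opSqrt_mul_opSqrt hB] at h2
  have h3 := trace_mul_le_trace_mul h hP.inverse.isPositive
  rw [mul_sub, map_sub, mul_smul_comm, mul_one, map_smul, smul_eq_mul] at h3
  have h4 := (isPositive_inverse_sub_inverse hr1 hP
    (by rw [hPdef, add_sub_cancel_right]; exact hQ)).trace_nonneg
  rw [inverse_smul_one hr, map_sub, map_smul, trace_id_eq_finrank, smul_eq_mul] at h4
  have h5 : r ^ 2 * tr P⁻¹ʳ ≤ r * Module.finrank ℝ X := by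
    calc r ^ 2 * tr P⁻¹ʳ ≤ r ^ 2 * (r⁻¹ * Module.finrank ℝ X) := by gcongr; linarith
      _ = r * Module.finrank ℝ X := by field_simp
  have h6 : tr P = tr (opSqrt B) + r * Module.finrank ℝ X := by
    rw [hPdef, map_add, map_smul, trace_id_eq_finrank, smul_eq_mul]
  linarith

theorem isPositive_norm_smul_one_sub (A : X →L[ℝ] X) (hA : (A : X →ₗ[ℝ] X).IsSymmetric) {r : ℝ}
    (hr : ‖A‖ ≤ r) : (r • 1 - (A : X →ₗ[ℝ] X)).IsPositive := by
  have h1 : (r • (1 : X →ₗ[ℝ] X)).IsSymmetric :=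
    (LinearMap.isPositive_one.smul_of_nonneg ((norm_nonneg _).trans hr)).isSymmetric
  refine isPositive_iff_real.2 ⟨h1.sub hA, fun x => ?_⟩
  simp only [LinearMap.sub_apply, LinearMap.smul_apply, Module.End.one_apply, inner_sub_right,
    real_inner_smul_right, real_inner_self_eq_norm_sq, ContinuousLinearMap.coe_coe]
  have h2 := real_inner_le_norm x (A x)
  have h3 := A.le_opNorm x
  have h4 : ‖x‖ * ‖A x‖ ≤ ‖x‖ * (r * ‖x‖) := by
    gcongr
    exact h3.trans (by gcongr)
  linarith [h4, show ‖x‖ * (r * ‖x‖) = r * ‖x‖ ^ 2 by ring]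

theorem continuous_trace_opSqrt :
    Continuous fun A : {A : X →L[ℝ] X // (A : X →ₗ[ℝ] X).IsPositive} =>
      tr (opSqrt (A.1 : X →ₗ[ℝ] X)) := by
  rw [Metric.continuous_iff]
  intro B e he
  set r := e / (Module.finrank ℝ X + 1) with hr
  have hr0 : 0 < r := by positivity
  refine ⟨r ^ 2, by positivity, fun A hAB => ?_⟩
  rw [Subtype.dist_eq, dist_eq_norm] at hAB
  have h1 := trace_opSqrt_le_add A.2 B.2 hr0
    (isPositive_norm_smul_one_sub (A.1 - B.1) (A.2.isSymmetric.sub B.2.isSymmetric) hAB.le)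
  rw [norm_sub_rev] at hAB
  have h2 := trace_opSqrt_le_add B.2 A.2 hr0
    (isPositive_norm_smul_one_sub (B.1 - A.1) (B.2.isSymmetric.sub A.2.isSymmetric) hAB.le)
  have h3 : r * Module.finrank ℝ X < e := by
    rw [hr, div_mul_eq_mul_div, div_lt_iff₀ (by positivity)]
    nlinarith
  rw [Real.dist_eq, abs_lt]
  constructor <;> linarith

theorem continuous_projH_outer (H : Submodule ℝ (X →ₗ[ℝ] X)) :
    Continuous fun x : X => LinearMap.toContinuousLinearMap (projH H (outer x)) := by
  have h1 : Continuous fun x : X => LinearMap.toContinuousLinearMap (outer x) := by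
    rw [continuous_clm_apply]
    intro y
    simp only [LinearMap.coe_toContinuousLinearMap', outer_apply]
    fun_prop
  let T : (X →L[ℝ] X) →ₗ[ℝ] (X →L[ℝ] X) :=
    { toFun := fun A => LinearMap.toContinuousLinearMap (projH H (A : X →ₗ[ℝ] X))
      map_add' := fun A B => by
        rw [ContinuousLinearMap.toLinearMap_add, projH_add, map_add]
      map_smul' := fun c A => by
        rw [ContinuousLinearMap.toLinearMap_smul, projH_smul, map_smul]; rfl }
  exact (LinearMap.continuous_of_finiteDimensional T).comp h1

theorem continuous_dualReg (hH : IsPreconditionerSpace H) (η : ℝ) :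
    Continuous (Function.uncurry
      fun (S : {A : X →L[ℝ] X // (A : X →ₗ[ℝ] X).IsPositive}) (m : X) =>
        dualReg H η (S.1 : X →ₗ[ℝ] X) m) := by
  have hpos : ∀ p : {A : X →L[ℝ] X // (A : X →ₗ[ℝ] X).IsPositive} × X,
      ((LinearMap.toContinuousLinearMap (projH H (outer p.2)) + p.1.1 : X →L[ℝ] X) :
        X →ₗ[ℝ] X).IsPositive := fun p => (hH.isPositive_projH_outer p.2).add p.1.2
  have hc : Continuous fun p : {A : X →L[ℝ] X // (A : X →ₗ[ℝ] X).IsPositive} × X =>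
      (⟨_, hpos p⟩ : {A : X →L[ℝ] X // (A : X →ₗ[ℝ] X).IsPositive}) :=
    Continuous.subtype_mk (((continuous_projH_outer H).comp continuous_snd).add
      (continuous_subtype_val.comp continuous_fst)) _
  refine (continuous_const.mul (continuous_trace_opSqrt.comp hc) :
    Continuous fun p => η * _).congr fun p => ?_
  rw [Function.uncurry, dualReg_eq]
  rfl

variable [MeasurableSpace X] [BorelSpace X]

/-- Joint continuity of the regularizer in `(S, m)` suffices, since the derivative of a continuous
parametrized family is jointly measurable. -/
theorem measurable_gradient_dualReg (hH : IsPreconditionerSpace H) (η : ℝ) :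
    Measurable fun p : {A : X →L[ℝ] X // (A : X →ₗ[ℝ] X).IsPositive} × X =>
      gradient (dualReg H η (p.1.1 : X →ₗ[ℝ] X)) p.2 :=
  (InnerProductSpace.toDual ℝ X).symm.continuous.measurable.comp
    (measurable_fderiv_with_param ℝ (continuous_dualReg hH η))

/-- The state before iteration `k` is a measurable function of the samples with index below `k`. -/
theorem measurable_o2ncState {Ξ Ω : Type*} [MeasurableSpace Ξ] [MeasurableSpace Ω]
    (hH : IsPreconditionerSpace H) (β η : ℝ) {δ : ℝ} (hδ : 0 < δ) {g : Ξ → X → X}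
    (hg : Measurable (Function.uncurry g)) (w₀ : X) {ξ : ℕ → Ω → Ξ} {s : ℕ → Ω → ℝ} (n : ℕ)
    (hξ : ∀ k < n, Measurable (ξ k)) (hs : ∀ k < n, Measurable (s k)) :
    Measurable (fun ω => (o2ncState H β η δ g w₀ (fun k => ξ k ω) (fun k => s k ω) n).1) ∧
    Measurable (fun ω => (o2ncState H β η δ g w₀ (fun k => ξ k ω) (fun k => s k ω) n).2.x) ∧
    Measurable (fun ω => (o2ncState H β η δ g w₀ (fun k => ξ k ω) (fun k => s k ω) n).2.m) ∧
    Measurable (fun ω => LinearMap.toContinuousLinearMap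
      (o2ncState H β η δ g w₀ (fun k => ξ k ω) (fun k => s k ω) n).2.S) := by
  induction n with
  | zero => exact ⟨measurable_const, measurable_const, measurable_const,
      measurable_const (a := LinearMap.toContinuousLinearMap (leonInit (X := X) δ).S)⟩
  | succ n ih =>
    obtain ⟨h1, h2, h3, h4⟩ := ih (fun k hk => hξ k (by omega)) (fun k hk => hs k (by omega))
    have hw : Measurable fun ω =>
        (o2ncState H β η δ g w₀ (fun k => ξ k ω) (fun k => s k ω) (n + 1)).1 :=
      h1.add ((hs n (by omega)).smul h2)
    have hl : Measurable fun ω => o2ncLoss H β η δ g w₀ (fun k => ξ k ω) (fun k => s k ω) n :=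
      (hg.comp ((hξ n (by omega)).prodMk hw)).const_smul _
    have hm : Measurable fun ω =>
        (o2ncState H β η δ g w₀ (fun k => ξ k ω) (fun k => s k ω) (n + 1)).2.m := h3.add hl
    have hS : Measurable fun ω => LinearMap.toContinuousLinearMap
        (o2ncState H β η δ g w₀ (fun k => ξ k ω) (fun k => s k ω) (n + 1)).2.S := by
      simp only [o2ncState_succ_S, map_add]
      exact h4.add ((continuous_projH_outer H).measurable.comp hl)
    refine ⟨hw, ?_, hm, hS⟩
    have hpos : ∀ ω, ((LinearMap.toContinuousLinearMap (o2ncState H β η δ g w₀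
        (fun k => ξ k ω) (fun k => s k ω) (n + 1)).2.S : X →L[ℝ] X) : X →ₗ[ℝ] X).IsPositive :=
      fun ω => (isPosDef_o2ncState_S β η g w₀ _ _ hH hδ (n + 1)).isPositive
    exact ((measurable_gradient_dualReg hH η).comp ((hS.subtype_mk (h := hpos)).prodMk hm)).neg

end Measurability

end O2NC

namespace O2NC

/-! ### Integration by parts for `Exp(1)`. -/

section Exponential

open Set Filter Topology

theorem expMeasure_one_eq : expMeasure 1 =
    (volume.restrict (Ioi (0 : ℝ))).withDensity fun x => ENNReal.ofReal (Real.exp (-x)) := by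
  rw [Measure.restrict_congr_set Ioi_ae_eq_Ici, ← withDensity_indicator measurableSet_Ici]
  rw [expMeasure, gammaMeasure]
  congr 1
  ext x
  by_cases hx : 0 ≤ x
  · rw [indicator_of_mem (by exact hx), gammaPDF_of_nonneg hx]
    simp
  · rw [indicator_of_notMem (by exact hx), gammaPDF_of_neg (not_le.1 hx)]

theorem integrable_expMeasure_iff {φ : ℝ → ℝ} :
    Integrable φ (expMeasure 1) ↔ IntegrableOn (fun x => Real.exp (-x) * φ x) (Ioi 0) := by
  rw [expMeasure_one_eq, integrable_withDensity_iff_integrable_smul' (by fun_prop)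
    (Eventually.of_forall fun x => ENNReal.ofReal_lt_top)]
  simp [IntegrableOn, ENNReal.toReal_ofReal (Real.exp_pos _).le]

theorem integral_expMeasure (φ : ℝ → ℝ) :
    ∫ x, φ x ∂(expMeasure 1) = ∫ x in Ioi 0, Real.exp (-x) * φ x := by
  rw [expMeasure_one_eq, integral_withDensity_eq_integral_toReal_smul (by fun_prop)
    (Eventually.of_forall fun x => ENNReal.ofReal_lt_top)]
  simp [ENNReal.toReal_ofReal (Real.exp_pos _).le]

instance : IsProbabilityMeasure (expMeasure 1) := isProbabilityMeasure_expMeasure one_pos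

theorem ae_expMeasure_nonneg : ∀ᵐ x ∂(expMeasure 1), 0 ≤ x := by
  rw [expMeasure_one_eq]
  refine (withDensity_absolutelyContinuous _ _).ae_le ?_
  filter_upwards [ae_restrict_mem measurableSet_Ioi] with x hx using le_of_lt hx

theorem integrable_id_expMeasure : Integrable (fun x : ℝ => x) (expMeasure 1) := by
  rw [integrable_expMeasure_iff]
  have := Real.GammaIntegral_convergent (s := 2) two_pos
  norm_num at this
  exact this

theorem integral_id_expMeasure : ∫ x, x ∂(expMeasure 1) = 1 := by
  rw [integral_expMeasure]
  have := Real.Gamma_eq_integral (s := 2) two_pos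
  norm_num at this
  exact this.symm

theorem integral_abs_expMeasure : ∫ x, |x| ∂(expMeasure 1) = 1 := by
  rw [integral_congr_ae (ae_expMeasure_nonneg.mono fun x hx => abs_of_nonneg hx),
    integral_id_expMeasure]

/-- Integration by parts for the exponential distribution. -/
theorem integral_deriv_expMeasure {φ φ' : ℝ → ℝ} (h : ∀ x, HasDerivAt φ (φ' x) x) {K : ℝ}
    (hK : ∀ x, |φ' x| ≤ K) :
    Integrable φ (expMeasure 1) ∧ Integrable φ' (expMeasure 1) ∧
      ∫ x, φ x ∂(expMeasure 1) - φ 0 = ∫ x, φ' x ∂(expMeasure 1) := by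
  have hφ' : φ' = deriv φ := funext fun x => (h x).deriv.symm
  have hmeas' : Measurable φ' := hφ' ▸ measurable_deriv φ
  have hcont : Continuous φ := continuous_iff_continuousAt.2 fun x => (h x).continuousAt
  have hgrowth : ∀ x, |φ x| ≤ |φ 0| + K * |x| := fun x => by
    -- A bounded derivative gives linear growth, which makes `φ` integrable and kills the boundary
    -- term at infinity.
    have h1 := convex_univ.norm_image_sub_le_of_norm_hasDerivWithin_le
      (fun y _ => (h y).hasDerivWithinAt) (fun y _ => hK y) (mem_univ 0) (mem_univ x)
    rw [sub_zero, Real.norm_eq_abs, Real.norm_eq_abs] at h1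
    linarith [abs_sub_abs_le_abs_sub (φ x) (φ 0)]
  have hi' : Integrable φ' (expMeasure 1) :=
    Integrable.of_bound hmeas'.aestronglyMeasurable K (Eventually.of_forall hK)
  have hi : Integrable φ (expMeasure 1) := by
    refine ((integrable_const (|φ 0|)).add
      ((integrable_id_expMeasure.abs).const_mul K)).mono' hcont.aestronglyMeasurable ?_
    exact Eventually.of_forall hgrowth
  refine ⟨hi, hi', ?_⟩
  have hio := integrable_expMeasure_iff.1 hi
  have hio' := integrable_expMeasure_iff.1 hi'
  have hlim : Tendsto (fun x => Real.exp (-x) * φ x) atTop (𝓝 0) := by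
    have h0 : Tendsto (fun x => |φ 0| * Real.exp (-x) + K * (x ^ 1 * Real.exp (-x))) atTop
        (𝓝 (|φ 0| * 0 + K * 0)) :=
      (Real.tendsto_exp_neg_atTop_nhds_zero.const_mul _).add
        ((Real.tendsto_pow_mul_exp_neg_atTop_nhds_zero 1).const_mul K)
    rw [mul_zero, mul_zero, add_zero] at h0
    refine squeeze_zero_norm' ?_ h0
    filter_upwards [eventually_ge_atTop 0] with x hx
    rw [norm_mul, Real.norm_of_nonneg (Real.exp_pos _).le, Real.norm_eq_abs]
    have := mul_le_mul_of_nonneg_left (hgrowth x) (Real.exp_pos (-x)).le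
    rw [abs_of_nonneg hx] at this
    linarith
  have hd : ∀ x ∈ Ici (0 : ℝ), HasDerivAt (fun x => Real.exp (-x) * φ x)
      (Real.exp (-x) * φ' x - Real.exp (-x) * φ x) x := fun x _ => by
    have h1 : HasDerivAt (fun x : ℝ => Real.exp (-x)) (Real.exp (-x) * (-1)) x :=
      (hasDerivAt_neg x).exp
    exact (h1.mul (h x)).congr_deriv (by ring)
  have key := integral_Ioi_of_hasDerivAt_of_tendsto' hd (hio'.sub hio) hlim
  rw [integral_sub hio' hio, ← integral_expMeasure, ← integral_expMeasure] at key
  simp only [neg_zero, Real.exp_zero, one_mul] at key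
  linarith

end Exponential

/-! ### Independence of fresh samples from the past. -/

section Independence

variable {Ω Ξ : Type*} [MeasurableSpace Ω] [MeasurableSpace Ξ]

/-- The σ-algebra generated by the samples with index below `k`. -/
@[reducible] def past (ξ : ℕ → Ω → Ξ) (s : ℕ → Ω → ℝ) (k : ℕ) : MeasurableSpace Ω :=
  ⨆ i ∈ Set.Iio k, MeasurableSpace.comap (fun ω => (ξ i ω, s i ω)) inferInstance

theorem measurable_past_pair (ξ : ℕ → Ω → Ξ) (s : ℕ → Ω → ℝ) {i k : ℕ} (h : i < k) :
    Measurable[past ξ s k] fun ω => (ξ i ω, s i ω) := by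
  have h1 : MeasurableSpace.comap (fun ω => (ξ i ω, s i ω)) inferInstance ≤ past ξ s k :=
    le_iSup₂_of_le (f := fun i (_ : i ∈ Set.Iio k) =>
      MeasurableSpace.comap (fun ω => (ξ i ω, s i ω)) inferInstance) i h le_rfl
  exact measurable_iff_comap_le.2 h1

variable {D : Measure Ξ} {P : Measure Ω} [IsProbabilityMeasure D] [IsProbabilityMeasure P]
  {β : ℝ} {N : ℕ} {ξ : ℕ → Ω → Ξ} {s : ℕ → Ω → ℝ} {τ : Ω → ℕ}

namespace IsO2NCSampling

variable (h : IsO2NCSampling D P β N ξ s τ)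
include h

theorem measurable_pair (k : ℕ) : Measurable fun ω => (ξ k ω, s k ω) :=
  (h.measurable_ξ k).prodMk (h.measurable_s k)

theorem past_le (k : ℕ) : past ξ s k ≤ ‹MeasurableSpace Ω› :=
  iSup₂_le fun i _ => (h.measurable_pair i).comap_le

theorem map_s (k : ℕ) : P.map (s k) = expMeasure 1 := by
  have : P.map (s k) = (P.map fun ω => (ξ k ω, s k ω)).map Prod.snd := by
    rw [Measure.map_map measurable_snd (h.measurable_pair k)]; rfl
  rw [this, h.law, Measure.map_snd_prod, measure_univ, one_smul]

theorem map_ξ (k : ℕ) : P.map (ξ k) = D := by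
  have : P.map (ξ k) = (P.map fun ω => (ξ k ω, s k ω)).map Prod.fst := by
    rw [Measure.map_map measurable_fst (h.measurable_pair k)]; rfl
  rw [this, h.law, Measure.map_fst_prod, measure_univ, one_smul]

theorem indepFun_pair {α : Type*} [MeasurableSpace α] {k : ℕ} {U : Ω → α}
    (hU : Measurable[past ξ s k] U) : IndepFun U (fun ω => (ξ k ω, s k ω)) P := by
  have h1 := indep_iSup_of_disjoint (fun i => (h.measurable_pair i).comap_le) h.indep
    (S := Set.Iio k) (T := {k}) (by simp)
  rw [IndepFun_iff_Indep]
  refine indep_of_indep_of_le_left (indep_of_indep_of_le_right h1 ?_) hU.comap_le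
  simp

theorem indepFun_s {α : Type*} [MeasurableSpace α] {k : ℕ} {U : Ω → α}
    (hU : Measurable[past ξ s k] U) : IndepFun U (s k) P :=
  (h.indepFun_pair hU).comp measurable_id measurable_snd

/-- The query point uses `s k` as well as the past, so unbiasedness needs `ξ k` independent of both.
This is a rearrangement of product measures, using that `ξ k` and `s k` are independent. -/
theorem indepFun_ξ {α : Type*} [MeasurableSpace α] {k : ℕ} {U : Ω → α}
    (hU : Measurable[past ξ s k] U) : IndepFun (fun ω => (U ω, s k ω)) (ξ k) P := by
  have hUm : Measurable U := hU.mono (h.past_le k) le_rfl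
  have h1 := (indepFun_iff_map_prod_eq_prod_map_map hUm.aemeasurable
    (h.measurable_pair k).aemeasurable).1 (h.indepFun_pair hU)
  have h2 := (indepFun_iff_map_prod_eq_prod_map_map hUm.aemeasurable
    (h.measurable_s k).aemeasurable).1 (h.indepFun_s hU)
  have : IsProbabilityMeasure (P.map U) := Measure.isProbabilityMeasure_map hUm.aemeasurable
  rw [h.law] at h1
  rw [h.map_s] at h2
  rw [indepFun_iff_map_prod_eq_prod_map_map (hUm.prodMk (h.measurable_s k)).aemeasurable
    (h.measurable_ξ k).aemeasurable, h2, h.map_ξ]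
  let Φ : α × Ξ × ℝ → (α × ℝ) × Ξ := fun p => ((p.1, p.2.2), p.2.1)
  have hΦ : Measurable Φ := by fun_prop
  have e1 : P.map (fun ω => ((U ω, s k ω), ξ k ω)) =
      (P.map fun ω => (U ω, ξ k ω, s k ω)).map Φ := by
    rw [Measure.map_map hΦ (hUm.prodMk (h.measurable_pair k))]; rfl
  rw [e1, h1]
  have m1 : MeasurePreserving (Prod.map id Prod.swap : α × Ξ × ℝ → α × ℝ × Ξ)
      ((P.map U).prod (D.prod (expMeasure 1))) ((P.map U).prod ((expMeasure 1).prod D)) :=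
    (MeasurePreserving.id _).prod Measure.measurePreserving_swap
  have m2 := (measurePreserving_prodAssoc (P.map U) (expMeasure 1) D).symm
  exact (m2.comp m1).map_eq

end IsO2NCSampling

end Independence

/-! ### Expectations after integrating out a fresh sample. -/

section Expectation

variable {X : Type*} [NormedAddCommGroup X] [InnerProductSpace ℝ X] [FiniteDimensional ℝ X]
  [MeasurableSpace X] [BorelSpace X] {Ω Ξ : Type*} [MeasurableSpace Ω] [MeasurableSpace Ξ]
  {D : Measure Ξ} {P : Measure Ω} [IsProbabilityMeasure D] [IsProbabilityMeasure P]

theorem measurable_gradient (f : X → ℝ) : Measurable (gradient f) :=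
  (InnerProductSpace.toDual ℝ X).symm.continuous.measurable.comp (measurable_fderiv ℝ f)

theorem norm_image_sub_le_of_gradient_bound {f : X → ℝ} (hf : Differentiable ℝ f) {K : ℝ}
    (hK : ∀ x, ‖gradient f x‖ ≤ K) (x y : X) : |f y - f x| ≤ K * ‖y - x‖ := by
  refine convex_univ.norm_image_sub_le_of_norm_fderiv_le (𝕜 := ℝ) (fun z _ => hf z)
    (fun z _ => ?_) (Set.mem_univ x) (Set.mem_univ y)
  have : ‖gradient f z‖ = ‖fderiv ℝ f z‖ := LinearIsometryEquiv.norm_map _ _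
  rw [← this]
  exact hK z

theorem integrable_comp_of_gradient_bound {f : X → ℝ} (hf : Differentiable ℝ f) {K : ℝ}
    (hK : ∀ x, ‖gradient f x‖ ≤ K) {W : Ω → X} (hWi : Integrable W P) :
    Integrable (fun ω => f (W ω)) P := by
  refine ((integrable_const |f 0|).add (hWi.norm.const_mul K)).mono'
    (hf.continuous.comp_aestronglyMeasurable hWi.1) (Filter.Eventually.of_forall fun ω => ?_)
  have := norm_image_sub_le_of_gradient_bound hf hK 0 (W ω)
  rw [sub_zero] at this
  have h2 := abs_sub_abs_le_abs_sub (f (W ω)) (f 0)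
  simp only [Real.norm_eq_abs, Pi.add_apply]
  linarith

theorem hasDerivAt_comp_line {f : X → ℝ} (hf : Differentiable ℝ f) (w v : X) (t : ℝ) :
    HasDerivAt (fun t : ℝ => f (w + t • v)) ⟪gradient f (w + t • v), v⟫ t := by
  have h1 : HasDerivAt (fun t : ℝ => w + t • v) ((1 : ℝ) • v) t :=
    ((hasDerivAt_id t).smul_const v).const_add w
  have h2 := (hf (w + t • v)).hasGradientAt.hasFDerivAt.comp_hasDerivAt t h1
  rw [one_smul] at h2
  exact h2

/-- A step of exponentially distributed random length along `V` changes `f` in expectation by the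
expected directional derivative at the new point. -/
theorem integral_exponential_step {f : X → ℝ} (hf : Differentiable ℝ f) {K : ℝ}
    (hK : ∀ x, ‖gradient f x‖ ≤ K) {W V : Ω → X} {σ : Ω → ℝ} (hWi : Integrable W P)
    (hW : Measurable W) (hV : Measurable V) (hσ : Measurable σ) {c : ℝ} (hc : ∀ ω, ‖V ω‖ ≤ c)
    (hlaw : P.map σ = expMeasure 1) (hind : IndepFun (fun ω => (W ω, V ω)) σ P) :
    Integrable (fun ω => W ω + σ ω • V ω) P ∧
    ∫ ω, f (W ω + σ ω • V ω) ∂P - ∫ ω, f (W ω) ∂P =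
      ∫ ω, ⟪gradient f (W ω + σ ω • V ω), V ω⟫ ∂P := by
  have hK0 : 0 ≤ K := (norm_nonneg _).trans (hK 0)
  have hσi : Integrable σ P := by
    have h1 := integrable_id_expMeasure
    rw [← hlaw] at h1
    exact (integrable_map_measure (by fun_prop) hσ.aemeasurable).1 h1
  have hstep : Integrable (fun ω => W ω + σ ω • V ω) P := by
    refine hWi.add ((hσi.norm.mul_const c).mono' (hσ.smul hV).aestronglyMeasurable
      (Filter.Eventually.of_forall fun ω => ?_))
    rw [norm_smul]
    exact mul_le_mul_of_nonneg_left (hc ω) (norm_nonneg _)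
  refine ⟨hstep, ?_⟩
  have hWV : Measurable fun ω => (W ω, V ω) := hW.prodMk hV
  set μ := P.map fun ω => (W ω, V ω) with hμ
  have : IsProbabilityMeasure μ := Measure.isProbabilityMeasure_map hWV.aemeasurable
  have hmap := (indepFun_iff_map_prod_eq_prod_map_map hWV.aemeasurable hσ.aemeasurable).1 hind
  rw [hlaw, ← hμ] at hmap
  have hj : Measurable fun ω => ((W ω, V ω), σ ω) := hWV.prodMk hσ
  let Φ : (X × X) × ℝ → ℝ := fun p => f (p.1.1 + p.2 • p.1.2)
  let Γ : (X × X) × ℝ → ℝ := fun p => ⟪gradient f (p.1.1 + p.2 • p.1.2), p.1.2⟫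
  have hΦm : Measurable Φ := hf.continuous.measurable.comp (by fun_prop)
  have hΓm : Measurable Γ :=
    ((measurable_gradient f).comp (by fun_prop)).inner (by fun_prop)
  have hΦi : Integrable Φ (μ.prod (expMeasure 1)) := by
    rw [← hmap, integrable_map_measure hΦm.aestronglyMeasurable hj.aemeasurable]
    exact integrable_comp_of_gradient_bound hf hK hstep
  have hΓi : Integrable Γ (μ.prod (expMeasure 1)) := by
    rw [← hmap, integrable_map_measure hΓm.aestronglyMeasurable hj.aemeasurable]
    refine Integrable.of_bound (hΓm.comp hj).aestronglyMeasurable (K * c)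
      (Filter.Eventually.of_forall fun ω => ?_)
    exact (norm_inner_le_norm _ _).trans (mul_le_mul (hK _) (hc ω) (norm_nonneg _) hK0)
  have hfm : Measurable fun p : X × X => f p.1 := hf.continuous.measurable.comp measurable_fst
  have hfi : Integrable (fun p : X × X => f p.1) μ := by
    rw [hμ, integrable_map_measure hfm.aestronglyMeasurable hWV.aemeasurable]
    exact integrable_comp_of_gradient_bound hf hK hWi
  have e1 : ∫ ω, f (W ω + σ ω • V ω) ∂P = ∫ p, Φ p ∂(μ.prod (expMeasure 1)) := by
    rw [← hmap, integral_map hj.aemeasurable hΦm.aestronglyMeasurable]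
  have e2 : ∫ ω, ⟪gradient f (W ω + σ ω • V ω), V ω⟫ ∂P = ∫ p, Γ p ∂(μ.prod (expMeasure 1)) := by
    rw [← hmap, integral_map hj.aemeasurable hΓm.aestronglyMeasurable]
  have e3 : ∫ ω, f (W ω) ∂P = ∫ p : X × X, f p.1 ∂μ := by
    rw [hμ, integral_map hWV.aemeasurable hfm.aestronglyMeasurable]
  rw [e1, e2, e3, integral_prod _ hΦi, integral_prod _ hΓi,
    ← integral_sub hΦi.integral_prod_left hfi]
  -- With the start and the direction frozen, the claim is integration by parts on a line.
  refine integral_congr_ae (Filter.Eventually.of_forall fun p => ?_)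
  obtain ⟨-, -, h⟩ := integral_deriv_expMeasure (hasDerivAt_comp_line hf p.1 p.2)
    (K := K * ‖p.2‖) (fun t => (abs_real_inner_le_norm _ _).trans
      (mul_le_mul_of_nonneg_right (hK _) (norm_nonneg _)))
  rw [zero_smul, add_zero] at h
  exact h

/-- Expectation of a measurable function of a stochastic query and an independent history. -/
theorem integral_comp_prodMk_of_indepFun {α : Type*} [MeasurableSpace α] {U : Ω → α}
    {ζ : Ω → Ξ} (hU : Measurable U) (hζ : Measurable ζ) (hlaw : P.map ζ = D)
    (hind : IndepFun U ζ P) {Φ : α × Ξ → ℝ} (hΦ : Measurable Φ)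
    (hi : Integrable (fun ω => Φ (U ω, ζ ω)) P) :
    ∫ ω, Φ (U ω, ζ ω) ∂P = ∫ ω, ∫ x, Φ (U ω, x) ∂D ∂P := by
  have hmap := (indepFun_iff_map_prod_eq_prod_map_map hU.aemeasurable hζ.aemeasurable).1 hind
  rw [hlaw] at hmap
  have : IsProbabilityMeasure (P.map U) := Measure.isProbabilityMeasure_map hU.aemeasurable
  have hj := hU.prodMk hζ
  have h1 : Integrable Φ ((P.map U).prod D) := by
    rw [← hmap, integrable_map_measure hΦ.aestronglyMeasurable hj.aemeasurable]
    exact hi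
  have e1 : ∫ ω, Φ (U ω, ζ ω) ∂P = ∫ p, Φ p ∂((P.map U).prod D) := by
    rw [← hmap, integral_map hj.aemeasurable hΦ.aestronglyMeasurable]
  rw [e1, integral_prod _ h1, integral_map hU.aemeasurable h1.integral_prod_left.1]

theorem integrable_comp_prodMk_of_indepFun {α : Type*} [MeasurableSpace α] {U : Ω → α}
    {ζ : Ω → Ξ} (hU : Measurable U) (hζ : Measurable ζ) (hlaw : P.map ζ = D)
    (hind : IndepFun U ζ P) {Φ : α × Ξ → ℝ} (hΦ : Measurable Φ) (h0 : ∀ p, 0 ≤ Φ p)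
    (hi : ∀ u, Integrable (fun x => Φ (u, x)) D) {C : ℝ} (hC : ∀ u, ∫ x, Φ (u, x) ∂D ≤ C) :
    Integrable (fun ω => Φ (U ω, ζ ω)) P := by
  have hmap := (indepFun_iff_map_prod_eq_prod_map_map hU.aemeasurable hζ.aemeasurable).1 hind
  rw [hlaw] at hmap
  have : IsProbabilityMeasure (P.map U) := Measure.isProbabilityMeasure_map hU.aemeasurable
  have hj := hU.prodMk hζ
  have h1 : Integrable Φ ((P.map U).prod D) := by
    rw [integrable_prod_iff hΦ.aestronglyMeasurable]
    refine ⟨Filter.Eventually.of_forall hi, Integrable.of_bound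
      (hΦ.norm.stronglyMeasurable.integral_prod_right').aestronglyMeasurable C
      (Filter.Eventually.of_forall fun u => ?_)⟩
    simp only [Real.norm_of_nonneg (h0 _)]
    rw [Real.norm_of_nonneg (integral_nonneg fun x => h0 _)]
    exact hC u
  rw [← hmap, integrable_map_measure hΦ.aestronglyMeasurable hj.aemeasurable] at h1
  exact h1

end Expectation

end O2NC

namespace O2NC

/-! ### Moments of the stochastic gradient. -/

section StochasticGradient

open scoped Ring

variable {X : Type*} [NormedAddCommGroup X] [InnerProductSpace ℝ X] [FiniteDimensional ℝ X]
  [MeasurableSpace X] [BorelSpace X] {Ξ : Type*} [MeasurableSpace Ξ]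
  {D : Measure Ξ} [IsProbabilityMeasure D] {f : X → ℝ} {g : Ξ → X → X} {B : X →ₗ[ℝ] X} {G : ℝ}

theorem invNormSq_add_smul (hB : IsPosDef B) (v w : X) (c : ℝ) :
    invNormSq B (v + c • w) = invNormSq B v + 2 * c * ⟪w, B⁻¹ʳ v⟫ + c ^ 2 * invNormSq B w := by
  have h : ⟪v, B⁻¹ʳ w⟫ = ⟪w, B⁻¹ʳ v⟫ := by rw [← hB.inverse.1, real_inner_comm]
  simp only [invNormSq, map_add, map_smul, inner_add_left, inner_add_right, real_inner_smul_left,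
    real_inner_smul_right, h]
  ring

theorem invNormSq_sub (hB : IsPosDef B) (v w : X) :
    invNormSq B (v - w) = invNormSq B v - 2 * ⟪v, B⁻¹ʳ w⟫ + invNormSq B w := by
  have h : ⟪v, B⁻¹ʳ w⟫ = ⟪w, B⁻¹ʳ v⟫ := by rw [← hB.inverse.1, real_inner_comm]
  rw [sub_eq_add_neg, ← neg_one_smul ℝ w, invNormSq_add_smul hB, h]
  ring

theorem continuous_invNormSq (B : X →ₗ[ℝ] X) : Continuous (invNormSq B) :=
  continuous_id.inner (LinearMap.continuous_of_finiteDimensional _)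

namespace IsStochasticGradient

variable (hg : IsStochasticGradient D f g B G)
include hg

theorem integral_inner_eq (x v : X) :
    Integrable (fun ξ => ⟪g ξ x, v⟫) D ∧ ∫ ξ, ⟪g ξ x, v⟫ ∂D = ⟪gradient f x, v⟫ := by
  refine ⟨(hg.integrable x).inner_const v, ?_⟩
  simp only [real_inner_comm v]
  rw [integral_inner (hg.integrable x), hg.unbiased]

theorem integrable_sub_and_integral (hB : IsPosDef B) (x : X) :
    Integrable (fun ξ => invNormSq B (g ξ x - gradient f x)) D ∧
    ∫ ξ, invNormSq B (g ξ x - gradient f x) ∂D =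
      ∫ ξ, invNormSq B (g ξ x) ∂D - invNormSq B (gradient f x) := by
  obtain ⟨h1, h2⟩ := hg.integral_inner_eq x (B⁻¹ʳ (gradient f x))
  have h3 : Integrable (fun ξ => invNormSq B (g ξ x) -
      2 * ⟪g ξ x, B⁻¹ʳ (gradient f x)⟫) D := (hg.integrable_sq x).sub (h1.const_mul 2)
  simp only [invNormSq_sub hB]
  refine ⟨h3.add (integrable_const _), ?_⟩
  rw [integral_add h3 (integrable_const _), integral_sub (hg.integrable_sq x) (h1.const_mul 2),
    integral_const_mul, h2, integral_const]
  simp only [probReal_univ, one_smul, invNormSq]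
  ring

/-- Jensen's inequality, as nonnegativity of the variance in `‖·‖_{B⁻¹}`. -/
theorem invNormSq_gradient_le (hB : IsPosDef B) (x : X) : invNormSq B (gradient f x) ≤ G ^ 2 := by
  have h1 := (hg.integrable_sub_and_integral hB x).2
  have h2 : 0 ≤ ∫ ξ, invNormSq B (g ξ x - gradient f x) ∂D :=
    integral_nonneg fun ξ => invNormSq_nonneg hB _
  linarith [hg.second_moment x]

theorem variance_le (hB : IsPosDef B) (x : X) :
    ∫ ξ, invNormSq B (g ξ x - gradient f x) ∂D ≤ G ^ 2 := by
  have h1 := (hg.integrable_sub_and_integral hB x).2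
  linarith [hg.second_moment x, invNormSq_nonneg hB (gradient f x)]

/-- So `f` is Lipschitz. The constant depends on `B`, but it enters integrability arguments only. -/
theorem exists_norm_gradient_le (hB : IsPosDef B) : ∃ K, ∀ x, ‖gradient f x‖ ≤ K := by
  obtain ⟨K, hK, h⟩ := exists_norm_sq_le_invNormSq hB
  refine ⟨Real.sqrt (K * G ^ 2), fun x => Real.le_sqrt_of_sq_le ((h _).trans ?_)⟩
  exact mul_le_mul_of_nonneg_left (hg.invNormSq_gradient_le hB x) hK.le

end IsStochasticGradient

theorem past_mono {Ω : Type*} [MeasurableSpace Ω] (ξ : ℕ → Ω → Ξ) (s : ℕ → Ω → ℝ) :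
    Monotone (past ξ s) := fun _ _ h =>
  biSup_mono fun _ hi => lt_of_lt_of_le hi h

/-! ### Random walks with predictable directions and exponential step lengths. -/

section Walk

variable {Ω : Type*} [MeasurableSpace Ω] {P : Measure Ω} [IsProbabilityMeasure P]
  {β : ℝ} {N : ℕ} {ξ : ℕ → Ω → Ξ} {s : ℕ → Ω → ℝ} {τ : Ω → ℕ} {W V : ℕ → Ω → X} {w₀ : X} {c : ℝ}

/-- The iterates `W` move by the increments `s_k V_k`, where `V_k` is bounded and depends only on
the samples with index below `k`. -/
structure IsExponentialWalk (ξ : ℕ → Ω → Ξ) (s : ℕ → Ω → ℝ) (w₀ : X) (c : ℝ)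
    (W V : ℕ → Ω → X) : Prop where
  zero : ∀ ω, W 0 ω = w₀
  succ : ∀ k ω, W (k + 1) ω = W k ω + s k ω • V k ω
  measurable_W : ∀ k, Measurable[past ξ s k] (W k)
  measurable_V : ∀ k, Measurable[past ξ s k] (V k)
  bound : ∀ k ω, ‖V k ω‖ ≤ c

namespace IsExponentialWalk

variable (hw : IsExponentialWalk ξ s w₀ c W V) (h : IsO2NCSampling D P β N ξ s τ)
  (hg : IsStochasticGradient D f g B G) (hB : IsPosDef B)

include hw h

theorem measurable_W' (k : ℕ) : Measurable (W k) := (hw.measurable_W k).mono (h.past_le k) le_rfl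

theorem measurable_V' (k : ℕ) : Measurable (V k) := (hw.measurable_V k).mono (h.past_le k) le_rfl

include hg hB

theorem integrable_W_and_step (hf : Differentiable ℝ f) (k : ℕ) :
    Integrable (W k) P ∧ ∫ ω, f (W (k + 1) ω) ∂P - ∫ ω, f (W k ω) ∂P =
      ∫ ω, ⟪gradient f (W (k + 1) ω), V k ω⟫ ∂P := by
  obtain ⟨K, hK⟩ := hg.exists_norm_gradient_le hB
  have step : ∀ k, Integrable (W k) P → Integrable (fun ω => W k ω + s k ω • V k ω) P ∧
      ∫ ω, f (W k ω + s k ω • V k ω) ∂P - ∫ ω, f (W k ω) ∂P =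
        ∫ ω, ⟪gradient f (W k ω + s k ω • V k ω), V k ω⟫ ∂P := fun k hi =>
    integral_exponential_step hf hK hi (hw.measurable_W' h k) (hw.measurable_V' h k)
      (h.measurable_s k) (hw.bound k) (h.map_s k)
      (h.indepFun_s ((hw.measurable_W k).prodMk (hw.measurable_V k)))
  have hi : ∀ k, Integrable (W k) P := fun k => by
    induction k with
    | zero => exact (integrable_const w₀).congr (Filter.Eventually.of_forall fun ω => (hw.zero ω).symm)
    | succ k ih =>
      exact (step k ih).1.congr (Filter.Eventually.of_forall fun ω => (hw.succ k ω).symm)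
  refine ⟨hi k, ?_⟩
  simp only [hw.succ]
  exact (step k (hi k)).2

/-- `W (k + 1)` is the query point of iteration `k`: it involves `s k` but not `ξ k`, so the
pointwise second-moment bound applies with `(W k, V k, s k)` frozen. -/
theorem integrable_sq (k : ℕ) :
    Integrable (fun ω => invNormSq B (g (ξ k ω) (W (k + 1) ω))) P ∧
    ∫ ω, invNormSq B (g (ξ k ω) (W (k + 1) ω)) ∂P ≤ G ^ 2 := by
  have hU : Measurable fun ω => (W k ω, V k ω) :=
    (hw.measurable_W' h k).prodMk (hw.measurable_V' h k)
  have hU' := hU.prodMk (h.measurable_s k)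
  let Φ : ((X × X) × ℝ) × Ξ → ℝ := fun p => invNormSq B (g p.2 (p.1.1.1 + p.1.2 • p.1.1.2))
  have hΦ : Measurable Φ := (continuous_invNormSq B).measurable.comp
    (hg.measurable.comp (measurable_snd.prodMk (by fun_prop)))
  have hind := h.indepFun_ξ ((hw.measurable_W k).prodMk (hw.measurable_V k))
  have hi := integrable_comp_prodMk_of_indepFun hU' (h.measurable_ξ k) (h.map_ξ k) hind hΦ
    (fun p => invNormSq_nonneg hB _) (fun u => hg.integrable_sq (u.1.1 + u.2 • u.1.2))
    (fun u => hg.second_moment (u.1.1 + u.2 • u.1.2))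
  have he := integral_comp_prodMk_of_indepFun hU' (h.measurable_ξ k) (h.map_ξ k) hind hΦ hi
  simp only [hw.succ]
  refine ⟨hi, he.trans_le ?_⟩
  refine (integral_mono_of_nonneg (Filter.Eventually.of_forall fun ω =>
    integral_nonneg fun x => invNormSq_nonneg hB _) (integrable_const (μ := P) (G ^ 2))
    (Filter.Eventually.of_forall fun ω =>
      hg.second_moment (W k ω + s k ω • V k ω))).trans ?_
  simp

theorem integrable_noise_sq (k : ℕ) :
    Integrable (fun ω => invNormSq B (g (ξ k ω) (W (k + 1) ω) - gradient f (W (k + 1) ω))) P ∧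
    ∫ ω, invNormSq B (g (ξ k ω) (W (k + 1) ω) - gradient f (W (k + 1) ω)) ∂P ≤ G ^ 2 := by
  have hU : Measurable fun ω => (W k ω, V k ω) :=
    (hw.measurable_W' h k).prodMk (hw.measurable_V' h k)
  have hU' := hU.prodMk (h.measurable_s k)
  let Φ : ((X × X) × ℝ) × Ξ → ℝ := fun p => invNormSq B
    (g p.2 (p.1.1.1 + p.1.2 • p.1.1.2) - gradient f (p.1.1.1 + p.1.2 • p.1.1.2))
  have hΦ : Measurable Φ := (continuous_invNormSq B).measurable.comp
    ((hg.measurable.comp (measurable_snd.prodMk (by fun_prop))).sub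
      ((measurable_gradient f).comp (by fun_prop)))
  have hind := h.indepFun_ξ ((hw.measurable_W k).prodMk (hw.measurable_V k))
  have hi := integrable_comp_prodMk_of_indepFun hU' (h.measurable_ξ k) (h.map_ξ k) hind hΦ
    (fun p => invNormSq_nonneg hB _)
    (fun u => (hg.integrable_sub_and_integral hB (u.1.1 + u.2 • u.1.2)).1)
    (fun u => hg.variance_le hB (u.1.1 + u.2 • u.1.2))
  have he := integral_comp_prodMk_of_indepFun hU' (h.measurable_ξ k) (h.map_ξ k) hind hΦ hi
  simp only [hw.succ]
  refine ⟨hi, he.trans_le ?_⟩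
  refine (integral_mono_of_nonneg (Filter.Eventually.of_forall fun ω =>
    integral_nonneg fun x => invNormSq_nonneg hB _) (integrable_const (μ := P) (G ^ 2))
    (Filter.Eventually.of_forall fun ω =>
      hg.variance_le hB (W k ω + s k ω • V k ω))).trans ?_
  simp

/-- Replacing the stochastic gradient by the gradient in an inner product with a vector that
depends only on the past does not change the expectation. -/
theorem integral_inner_past {Y : Ω → X} {k : ℕ} (hY : Measurable[past ξ s k] Y)
    (hYi : Integrable (fun ω => ‖Y ω‖ ^ 2) P) :
    Integrable (fun ω => ⟪g (ξ k ω) (W (k + 1) ω), Y ω⟫) P ∧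
    Integrable (fun ω => ⟪gradient f (W (k + 1) ω), Y ω⟫) P ∧
    ∫ ω, ⟪g (ξ k ω) (W (k + 1) ω), Y ω⟫ ∂P = ∫ ω, ⟪gradient f (W (k + 1) ω), Y ω⟫ ∂P := by
  have hYm : Measurable Y := hY.mono (h.past_le k) le_rfl
  have hwm := hw.measurable_W' h (k + 1)
  have hgm : Measurable fun ω => g (ξ k ω) (W (k + 1) ω) :=
    hg.measurable.comp ((h.measurable_ξ k).prodMk hwm)
  have young : ∀ {Z : Ω → X}, Measurable Z → Integrable (fun ω => ‖Z ω‖ ^ 2) P →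
      Integrable (fun ω => ⟪Z ω, Y ω⟫) P := fun {Z} hZ hZi => by
    refine (hZi.add hYi).mono' (hZ.inner hYm).aestronglyMeasurable
      (Filter.Eventually.of_forall fun ω => (norm_inner_le_norm _ _).trans ?_)
    simp only [Pi.add_apply]
    nlinarith [sq_nonneg (‖Z ω‖ - ‖Y ω‖), sq_nonneg (‖Z ω‖ + ‖Y ω‖)]
  obtain ⟨K, hK, hKle⟩ := exists_norm_sq_le_invNormSq hB
  have hgi : Integrable (fun ω => ‖g (ξ k ω) (W (k + 1) ω)‖ ^ 2) P :=
    ((hw.integrable_sq h hg hB k).1.const_mul K).mono' (hgm.norm.pow_const 2).aestronglyMeasurable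
      (Filter.Eventually.of_forall fun ω => by
        rw [Real.norm_of_nonneg (sq_nonneg _)]; exact hKle _)
  obtain ⟨K', hK'⟩ := hg.exists_norm_gradient_le hB
  have hdm : Measurable fun ω => gradient f (W (k + 1) ω) := (measurable_gradient f).comp hwm
  have hdi : Integrable (fun ω => ‖gradient f (W (k + 1) ω)‖ ^ 2) P :=
    Integrable.of_bound (hdm.norm.pow_const 2).aestronglyMeasurable (K' ^ 2)
      (Filter.Eventually.of_forall fun ω => by
        rw [Real.norm_of_nonneg (sq_nonneg _)]
        exact pow_le_pow_left₀ (norm_nonneg _) (hK' _) 2)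
  refine ⟨young hgm hgi, young hdm hdi, ?_⟩
  -- `Y` joins the frozen history, so integrating out `ξ k` replaces the stochastic gradient by its
  -- mean in the inner product.
  have hpast : Measurable[past ξ s k] fun ω => ((W k ω, V k ω), Y ω) :=
    ((hw.measurable_W k).prodMk (hw.measurable_V k)).prodMk hY
  have hU' := (hpast.mono (h.past_le k) le_rfl).prodMk (h.measurable_s k)
  let Φ : (((X × X) × X) × ℝ) × Ξ → ℝ := fun p =>
    ⟪g p.2 (p.1.1.1.1 + p.1.2 • p.1.1.1.2), p.1.1.2⟫
  have hΦ : Measurable Φ :=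
    (hg.measurable.comp (measurable_snd.prodMk (by fun_prop))).inner (by fun_prop)
  have hi := young hgm hgi
  simp only [hw.succ] at hi ⊢
  have he := integral_comp_prodMk_of_indepFun hU' (h.measurable_ξ k) (h.map_ξ k)
    (h.indepFun_ξ hpast) hΦ hi
  refine he.trans (integral_congr_ae (Filter.Eventually.of_forall fun ω => ?_))
  exact (hg.integral_inner_eq (W k ω + s k ω • V k ω) (Y ω)).2

/-- The weighted sums of the gradient noise are orthogonal. -/
theorem integral_noise_sum_sq_le (a : ℕ → ℝ) (n : ℕ) :
    Integrable (fun ω => invNormSq B (∑ k ∈ Finset.range n,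
      a k • (g (ξ k ω) (W (k + 1) ω) - gradient f (W (k + 1) ω)))) P ∧
    ∫ ω, invNormSq B (∑ k ∈ Finset.range n,
      a k • (g (ξ k ω) (W (k + 1) ω) - gradient f (W (k + 1) ω))) ∂P ≤
      ∑ k ∈ Finset.range n, a k ^ 2 * G ^ 2 := by
  induction n with
  | zero => simp [invNormSq]
  | succ n ih =>
    obtain ⟨ih1, ih2⟩ := ih
    set M : Ω → X := fun ω => ∑ k ∈ Finset.range n,
      a k • (g (ξ k ω) (W (k + 1) ω) - gradient f (W (k + 1) ω)) with hM
    have hMm : Measurable[past ξ s n] M := by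
      refine Finset.measurable_fun_sum _ fun k hk => Measurable.const_smul ?_ (a k)
      have hk : k + 1 ≤ n := Finset.mem_range.1 hk
      have h1 : Measurable[past ξ s n] (W (k + 1)) :=
        (hw.measurable_W (k + 1)).mono (past_mono ξ s hk) le_rfl
      have h2 : Measurable[past ξ s n] (ξ k) := measurable_fst.comp (measurable_past_pair ξ s hk)
      exact (hg.measurable.comp (h2.prodMk h1)).sub ((measurable_gradient f).comp h1)
    have hL : Continuous (B⁻¹ʳ : X →ₗ[ℝ] X) := LinearMap.continuous_of_finiteDimensional _
    have hY : Measurable[past ξ s n] fun ω => B⁻¹ʳ (M ω) := hL.measurable.comp hMm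
    obtain ⟨K, hK, hKle⟩ := exists_norm_sq_le_invNormSq hB
    set K' := ‖LinearMap.toContinuousLinearMap (B⁻¹ʳ : X →ₗ[ℝ] X)‖
    have hYi : Integrable (fun ω => ‖B⁻¹ʳ (M ω)‖ ^ 2) P := by
      refine (ih1.const_mul (K' ^ 2 * K)).mono'
        ((hY.mono (h.past_le n) le_rfl).norm.pow_const 2).aestronglyMeasurable
        (Filter.Eventually.of_forall fun ω => ?_)
      rw [Real.norm_of_nonneg (sq_nonneg _)]
      have h1 := (LinearMap.toContinuousLinearMap (B⁻¹ʳ : X →ₗ[ℝ] X)).le_opNorm (M ω)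
      calc ‖B⁻¹ʳ (M ω)‖ ^ 2 ≤ (K' * ‖M ω‖) ^ 2 := pow_le_pow_left₀ (norm_nonneg _) h1 2
        _ = K' ^ 2 * ‖M ω‖ ^ 2 := mul_pow _ _ _
        _ ≤ K' ^ 2 * (K * invNormSq B (M ω)) := by gcongr; exact hKle _
        _ = _ := by ring
    -- The cross term of the new noise with `B⁻¹ M` has mean zero, since `M` depends only on samples
    -- with index below `n`.
    obtain ⟨d1, d2, d3⟩ := hw.integral_inner_past h hg hB hY hYi
    obtain ⟨v1, v2⟩ := hw.integrable_noise_sq h hg hB n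
    have e : ∀ ω, invNormSq B (∑ k ∈ Finset.range (n + 1),
        a k • (g (ξ k ω) (W (k + 1) ω) - gradient f (W (k + 1) ω))) =
        invNormSq B (M ω) + 2 * a n * (⟪g (ξ n ω) (W (n + 1) ω), B⁻¹ʳ (M ω)⟫ -
          ⟪gradient f (W (n + 1) ω), B⁻¹ʳ (M ω)⟫) +
        a n ^ 2 * invNormSq B (g (ξ n ω) (W (n + 1) ω) - gradient f (W (n + 1) ω)) := fun ω => by
      rw [Finset.sum_range_succ, invNormSq_add_smul hB, inner_sub_left]
    simp only [e]
    have i2 : Integrable (fun ω => 2 * a n * (⟪g (ξ n ω) (W (n + 1) ω), B⁻¹ʳ (M ω)⟫ -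
        ⟪gradient f (W (n + 1) ω), B⁻¹ʳ (M ω)⟫)) P := (d1.sub d2).const_mul (2 * a n)
    have i3 := v1.const_mul (a n ^ 2)
    have i12 : Integrable (fun ω => invNormSq B (M ω) +
        2 * a n * (⟪g (ξ n ω) (W (n + 1) ω), B⁻¹ʳ (M ω)⟫ -
          ⟪gradient f (W (n + 1) ω), B⁻¹ʳ (M ω)⟫)) P := ih1.add i2
    refine ⟨i12.add i3, ?_⟩
    rw [integral_add i12 i3, integral_add ih1 i2, integral_const_mul, integral_const_mul,
      integral_sub d1 d2, d3, sub_self, mul_zero, add_zero, Finset.sum_range_succ]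
    gcongr

end IsExponentialWalk

end Walk

end StochasticGradient

end O2NC

namespace O2NC

/-! ### Discount weights and the law of the output index. -/

section Weights

/-- The unnormalized output weights: `1`, and `1 / (1 - β)` for the last index. -/
noncomputable def outputWeight (β : ℝ) (N n : ℕ) : ℝ := if n + 1 < N then 1 else (1 - β)⁻¹

/-- The weight of the `k`-th query point in the exponential moving average with index `n`. -/
noncomputable def averageWeight (β : ℝ) (n k : ℕ) : ℝ := (1 - β) / (1 - β ^ (n + 1)) * β ^ (n - k)

variable {β : ℝ} (hβ₀ : 0 < β) (hβ₁ : β < 1)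
include hβ₀ hβ₁

theorem one_sub_pow_succ_pos (n : ℕ) : 0 < 1 - β ^ (n + 1) :=
  sub_pos.2 (pow_lt_one₀ hβ₀.le hβ₁ (Nat.succ_ne_zero n))

theorem averageWeight_nonneg (n k : ℕ) : 0 ≤ averageWeight β n k := by
  have h1 := one_sub_pow_succ_pos hβ₀ hβ₁ n
  have h2 : 0 < 1 - β := by linarith
  rw [averageWeight]
  positivity

theorem outputProb_nonneg (N n : ℕ) : 0 ≤ outputProb β N n := by
  have h1 := one_sub_pow_succ_pos hβ₀ hβ₁ n
  have h2 : 0 < 1 - β := by linarith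
  have h3 : 0 ≤ 1 - β ^ N := sub_nonneg.2 (pow_le_one₀ hβ₀.le hβ₁.le)
  rw [outputProb]
  split_ifs <;> positivity

theorem sum_pow_sub (n : ℕ) :
    ∑ k ∈ Finset.range (n + 1), β ^ (n - k) = (1 - β ^ (n + 1)) / (1 - β) := by
  have h := Finset.sum_range_reflect (fun j => β ^ j) (n + 1)
  simp only [Nat.add_sub_cancel] at h
  rw [h, geom_sum_eq hβ₁.ne, ← neg_div_neg_eq, neg_sub, neg_sub]

theorem sum_averageWeight (n : ℕ) : ∑ k ∈ Finset.range (n + 1), averageWeight β n k = 1 := by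
  have h1 := one_sub_pow_succ_pos hβ₀ hβ₁ n
  have h2 : 0 < 1 - β := by linarith
  simp only [averageWeight]
  rw [← Finset.mul_sum, sum_pow_sub hβ₀ hβ₁]
  field_simp

/-- The factor `1 - β^(n+1)` in the output law cancels the normalization of the moving average,
leaving weights that are constant except at the last index. -/
theorem outputProb_mul_eq {N n : ℕ} (hn : n < N) :
    outputProb β N n * ((1 - β) / (1 - β ^ (n + 1))) = outputWeight β N n * (1 - β) / N := by
  have h1 := one_sub_pow_succ_pos hβ₀ hβ₁ n
  have h2 : 0 < 1 - β := by linarith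
  rw [outputProb, outputWeight]
  split_ifs with h
  · field_simp
  · obtain rfl : n + 1 = N := by omega
    field_simp

/-- Exchanging the sums, `d k` receives a truncated geometric series, and the last weight `(1 -
β)⁻¹` supplies exactly the missing tail. Applied to function decrements, the right side telescopes.
-/
theorem sum_outputWeight_mul (d : ℕ → ℝ) {N : ℕ} (hN : 0 < N) :
    ∑ n ∈ Finset.range N, outputWeight β N n *
      (β ^ n * ∑ k ∈ Finset.range (n + 1), (β ^ k)⁻¹ * d k) =
      (1 - β)⁻¹ * ∑ k ∈ Finset.range N, d k := by
  have h2 : 1 - β ≠ 0 := by linarith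
  obtain ⟨M, rfl⟩ : ∃ M, N = M + 1 := ⟨N - 1, by omega⟩
  set S : ℕ → ℝ := fun n => ∑ k ∈ Finset.range (n + 1), (β ^ k)⁻¹ * d k with hS
  have key : ∀ M : ℕ, ∑ n ∈ Finset.range M, β ^ n * S n + (1 - β)⁻¹ * (β ^ M * S M) =
      (1 - β)⁻¹ * ∑ k ∈ Finset.range (M + 1), d k := by
    intro M
    induction M with
    | zero => simp [hS]
    | succ M ih =>
      have hs : S (M + 1) = S M + (β ^ (M + 1))⁻¹ * d (M + 1) := Finset.sum_range_succ _ _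
      have hp : β ^ (M + 1) ≠ 0 := by positivity
      rw [Finset.sum_range_succ _ (M + 1), mul_add, ← ih, Finset.sum_range_succ, hs, mul_add,
        mul_inv_cancel_left₀ hp]
      field_simp
      ring
  rw [← key, Finset.sum_range_succ]
  congr 1
  · refine Finset.sum_congr rfl fun n hn => ?_
    rw [outputWeight, if_pos (by simpa using hn), one_mul]
  · rw [outputWeight, if_neg (by simp)]

theorem sum_outputWeight_mul_pow {N : ℕ} (hN : 0 < N) :
    ∑ n ∈ Finset.range N, outputWeight β N n * β ^ n = (1 - β)⁻¹ := by
  have h := sum_outputWeight_mul hβ₀ hβ₁ (fun k => if k = 0 then 1 else 0) hN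
  simpa [hN] using h

theorem sum_outputWeight_le (N : ℕ) :
    ∑ n ∈ Finset.range N, outputWeight β N n ≤ N + (1 - β)⁻¹ := by
  have h2 : 0 < 1 - β := by linarith
  rcases N with _ | M
  · simp [h2.le]
  · rw [Finset.sum_range_succ, Finset.sum_congr rfl (g := fun _ => (1 : ℝ)) fun n hn => by
      rw [outputWeight, if_pos (by simpa using hn)]]
    rw [outputWeight, if_neg (by simp)]
    simp

theorem sum_pow_sub_mul_le (n : ℕ) :
    ∑ k ∈ Finset.range (n + 1), β ^ (n - k) * ((n - k : ℕ) : ℝ) ≤ ((1 - β) ^ 2)⁻¹ := by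
  have h := Finset.sum_range_reflect (fun j => β ^ j * (j : ℝ)) (n + 1)
  simp only [Nat.add_sub_cancel] at h
  rw [h]
  have hs := hasSum_coe_mul_geometric_of_norm_lt_one (r := β)
    (by rwa [Real.norm_of_nonneg hβ₀.le])
  have h1 := sum_le_hasSum (Finset.range (n + 1)) (fun i _ => by positivity) hs
  simp only [mul_comm (β ^ _)]
  refine h1.trans ?_
  rw [div_eq_mul_inv]
  exact mul_le_of_le_one_left (by positivity) hβ₁.le

/-- After rescaling by `β^n`, the discounted second moments form a geometric series in `β²`, here
bounded by the one in `β`. -/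
theorem sum_inv_pow_sq_mul_le (n : ℕ) :
    (β ^ n) ^ 2 * ∑ k ∈ Finset.range (n + 1), ((β ^ k)⁻¹) ^ 2 ≤ (1 - β)⁻¹ := by
  have h2 : 0 < 1 - β := by linarith
  have h := sum_pow_sub hβ₀ hβ₁ n
  rw [Finset.mul_sum]
  have h3 : ∑ k ∈ Finset.range (n + 1), (β ^ n) ^ 2 * ((β ^ k)⁻¹) ^ 2 ≤
      ∑ k ∈ Finset.range (n + 1), β ^ (n - k) := by
    refine Finset.sum_le_sum fun k hk => ?_
    have hk : k ≤ n := by simpa [Nat.lt_succ_iff] using hk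
    have e : β ^ n * (β ^ k)⁻¹ = β ^ (n - k) := (pow_sub₀ β hβ₀.ne' hk).symm
    rw [← mul_pow, e]
    exact pow_le_of_le_one (by positivity) (pow_le_one₀ hβ₀.le hβ₁.le) two_ne_zero
  refine h3.trans ?_
  rw [h, div_eq_mul_inv]
  refine mul_le_of_le_one_left (by positivity) ?_
  have : 0 < β ^ (n + 1) := by positivity
  linarith

end Weights

/-! ### Finitely supported distributions. -/

section Mixture

variable {X : Type*} [NormedAddCommGroup X] [InnerProductSpace ℝ X] [FiniteDimensional ℝ X]
  [MeasurableSpace X] [BorelSpace X]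

/-- The finitely supported measure that gives mass `q k` to `z k` for `k ≤ n`. -/
noncomputable def mixture (q : ℕ → ℝ) (z : ℕ → X) (n : ℕ) : Measure X :=
  ∑ k ∈ Finset.range (n + 1), ENNReal.ofReal (q k) • Measure.dirac (z k)

theorem isProbabilityMeasure_mixture {q : ℕ → ℝ} (hq : ∀ k, 0 ≤ q k) {n : ℕ}
    (h1 : ∑ k ∈ Finset.range (n + 1), q k = 1) (z : ℕ → X) :
    IsProbabilityMeasure (mixture q z n) := by
  constructor
  simp only [mixture, Measure.coe_finsetSum, Finset.sum_apply, Measure.smul_apply, measure_univ,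
    smul_eq_mul, mul_one]
  rw [← ENNReal.ofReal_sum_of_nonneg fun k _ => hq k, h1, ENNReal.ofReal_one]

theorem integrable_mixture {E : Type*} [NormedAddCommGroup E] (q : ℕ → ℝ) (z : ℕ → X) (n : ℕ)
    (φ : X → E) : Integrable φ (mixture q z n) := by
  rw [mixture, integrable_finsetSum_measure]
  intro k _
  exact (integrable_dirac (by simp)).smul_measure ENNReal.ofReal_ne_top

theorem integral_mixture {E : Type*} [NormedAddCommGroup E] [NormedSpace ℝ E] [CompleteSpace E]
    {q : ℕ → ℝ} (hq : ∀ k, 0 ≤ q k) (z : ℕ → X) (n : ℕ) (φ : X → E) :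
    ∫ x, φ x ∂(mixture q z n) = ∑ k ∈ Finset.range (n + 1), q k • φ (z k) := by
  rw [mixture, integral_finsetSum_measure fun k _ =>
    (integrable_dirac (by simp)).smul_measure ENNReal.ofReal_ne_top]
  refine Finset.sum_congr rfl fun k _ => ?_
  rw [integral_smul_measure, integral_dirac, ENNReal.toReal_ofReal (hq k)]

theorem lintegral_ofReal_mixture {q : ℕ → ℝ} (hq : ∀ k, 0 ≤ q k) (z : ℕ → X) (n : ℕ) {φ : X → ℝ}
    (hφ : ∀ x, 0 ≤ φ x) :
    ∫⁻ x, ENNReal.ofReal (φ x) ∂(mixture q z n) =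
      ENNReal.ofReal (∑ k ∈ Finset.range (n + 1), q k * φ (z k)) := by
  rw [mixture, lintegral_finsetSum_measure,
    ENNReal.ofReal_sum_of_nonneg fun k _ => mul_nonneg (hq k) (hφ _)]
  refine Finset.sum_congr rfl fun k _ => ?_
  rw [lintegral_smul_measure, lintegral_dirac, smul_eq_mul, ENNReal.ofReal_mul (hq k)]

theorem measurable_mixture {Ω : Type*} [MeasurableSpace Ω] (q : ℕ → ℝ) {z : ℕ → Ω → X}
    (hz : ∀ k, Measurable (z k)) (n : ℕ) : Measurable fun ω => mixture q (fun k => z k ω) n := by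
  refine Measure.measurable_of_measurable_coe _ fun t ht => ?_
  simp only [mixture, Measure.coe_finsetSum, Finset.sum_apply, Measure.smul_apply, smul_eq_mul]
  refine Finset.measurable_fun_sum _ fun k _ => Measurable.const_mul ?_ _
  simp only [Measure.dirac_apply' _ ht]
  exact (measurable_const.indicator ht (f := fun _ => (1 : ENNReal))).comp (hz k)

theorem measurable_comp_index {Ω α : Type*} [MeasurableSpace Ω] [MeasurableSpace α] {τ : Ω → ℕ}
    (hτ : Measurable τ) {F : ℕ → Ω → α} (hF : ∀ n, Measurable (F n)) :
    Measurable fun ω => F (τ ω) ω := by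
  have h : Measurable fun p : ℕ × Ω => F p.1 p.2 := measurable_from_prod_countable_right hF
  exact h.comp (hτ.prodMk measurable_id)

end Mixture

/-! ### Expectations at the random output index. -/

section Output

variable {Ω Ξ : Type*} [MeasurableSpace Ω] [MeasurableSpace Ξ]
  {D : Measure Ξ} {P : Measure Ω} [IsProbabilityMeasure D] [IsProbabilityMeasure P]
  {β : ℝ} {N : ℕ} {ξ : ℕ → Ω → Ξ} {s : ℕ → Ω → ℝ} {τ : Ω → ℕ}

theorem past_le_comap (ξ : ℕ → Ω → Ξ) (s : ℕ → Ω → ℝ) (k : ℕ) :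
    past ξ s k ≤ MeasurableSpace.comap (fun ω i => (ξ i ω, s i ω)) inferInstance := by
  refine iSup₂_le fun i _ => ?_
  have h1 : Measurable[MeasurableSpace.comap (fun ω i => (ξ i ω, s i ω)) inferInstance]
      fun ω (i : ℕ) => (ξ i ω, s i ω) := comap_measurable _
  exact ((measurable_pi_apply i).comp h1).comap_le

theorem IsO2NCSampling.ae_lt (h : IsO2NCSampling D P β N ξ s τ) (hβ₀ : 0 < β) (hβ₁ : β < 1)
    (hN : 0 < N) : ∀ᵐ ω ∂P, τ ω < N := by
  have hm : MeasurableSet {ω | τ ω < N} := h.measurable_τ measurableSet_Iio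
  have e : {ω | τ ω < N} = ⋃ n ∈ Finset.range N, {ω | τ ω = n} := by ext; simp
  have h1 : P {ω | τ ω < N} = 1 := by
    have hd : (Finset.range N : Set ℕ).PairwiseDisjoint fun n => {ω | τ ω = n} :=
      fun a _ b _ hab => Set.disjoint_left.2 fun ω (h1 : τ ω = a) (h2 : τ ω = b) =>
        hab (h1.symm.trans h2)
    rw [e, measure_biUnion_finset hd (fun n _ => h.measurable_τ (measurableSet_singleton n)),
      Finset.sum_congr rfl fun n hn => h.law_τ n (Finset.mem_range.1 hn),
      ← ENNReal.ofReal_sum_of_nonneg fun n _ => outputProb_nonneg hβ₀ hβ₁ N n,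
      sum_outputProb hβ₁ hN, ENNReal.ofReal_one]
  exact (prob_compl_eq_zero_iff hm).2 h1

/-- The expectation at the random output index is the mixture of the expectations. -/
theorem IsO2NCSampling.lintegral_output (h : IsO2NCSampling D P β N ξ s τ) (hβ₀ : 0 < β)
    (hβ₁ : β < 1) (hN : 0 < N) {Φ : ℕ → Ω → ENNReal}
    (hΦ : ∀ n, Measurable[past ξ s (n + 1)] (Φ n)) :
    ∫⁻ ω, Φ (τ ω) ω ∂P =
      ∑ n ∈ Finset.range N, ENNReal.ofReal (outputProb β N n) * ∫⁻ ω, Φ n ω ∂P := by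
  have hm : ∀ n, MeasurableSet {ω | τ ω = n} := fun n =>
    h.measurable_τ (measurableSet_singleton n)
  have hΦm : ∀ n, Measurable (Φ n) := fun n => (hΦ n).mono (h.past_le _) le_rfl
  have hae : (fun ω => Φ (τ ω) ω) =ᵐ[P] fun ω => ∑ n ∈ Finset.range N,
      ({ω | τ ω = n}.indicator 1 ω : ENNReal) * Φ n ω := by
    filter_upwards [h.ae_lt hβ₀ hβ₁ hN] with ω hω
    rw [Finset.sum_eq_single_of_mem (τ ω) (Finset.mem_range.2 hω)]
    · simp
    · intro n _ hn
      have h' : ω ∉ {ω | τ ω = n} := fun h' => hn (Eq.symm h')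
      rw [Set.indicator_of_notMem h', zero_mul]
  have hmul : ∀ n ∈ Finset.range N, Measurable fun ω =>
      ({ω | τ ω = n}.indicator 1 ω : ENNReal) * Φ n ω := fun n _ =>
    (measurable_one.indicator (hm n)).mul (hΦm n)
  rw [lintegral_congr_ae hae, lintegral_finsetSum _ hmul]
  refine Finset.sum_congr rfl fun n hn => ?_
  have hind : IndepFun ({ω | τ ω = n}.indicator (1 : Ω → ENNReal)) (Φ n) P := by
    rw [IndepFun_iff_Indep]
    have h1 := (IndepFun_iff_Indep _ _ _).1 h.indep_τ
    refine indep_of_indep_of_le_left (indep_of_indep_of_le_right h1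
      ((hΦ n).mono (past_le_comap ξ s (n + 1)) le_rfl).comap_le) ?_
    have : Measurable[MeasurableSpace.comap τ inferInstance]
        ({ω | τ ω = n}.indicator (1 : Ω → ENNReal)) :=
      (measurable_of_countable (({n} : Set ℕ).indicator (1 : ℕ → ENNReal))).comp
        (comap_measurable τ)
    exact this.comap_le
  have e := lintegral_mul_eq_lintegral_mul_lintegral_of_indepFun
    (measurable_one.indicator (hm n)) (hΦm n) hind
  simp only [Pi.mul_apply] at e
  rw [e, lintegral_indicator_one (hm n), h.law_τ n (Finset.mem_range.1 hn)]

end Output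

end O2NC

namespace O2NC

/-! ### Dual norm of the discounted gradient sum. -/

section DualBound

variable {X : Type*} [NormedAddCommGroup X] [InnerProductSpace ℝ X] [FiniteDimensional ℝ X]
  {H : Submodule ℝ (X →ₗ[ℝ] X)} {B : X →ₗ[ℝ] X} {Ξ : Type*}

/-- Up to the factor `β^n`, the gradient sum is the loss sum `m` minus the noise sum `M`. The regret
bound divided by `η` controls `m`; `two_mul_dualNorm_le_invNormSq` controls `M`. The two uses of `t`
add up to `2 + 1/2`. -/
theorem dualNorm_gradient_sum_le (hH : IsPreconditionerSpace H) (hB : IsPosDef B) (hBH : B ∈ H)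
    (htr : traceNorm B = 1) {β η δ t : ℝ} (hβ₀ : 0 < β) (hη : 0 < η) (hδ : 0 < δ) (ht : 0 < t)
    (f : X → ℝ) (g : Ξ → X → X) (w₀ : X) (ξ : ℕ → Ξ) (s : ℕ → ℝ) (n : ℕ) :
    dualNorm H (∑ k ∈ Finset.range (n + 1),
      β ^ (n - k) • gradient f (o2ncPoint H β η δ g w₀ ξ s k)) ≤
    β ^ n * (4 * (δ * Module.finrank ℝ X)
      + 2 * t⁻¹ * ∑ k ∈ Finset.range (n + 1),
        ((β ^ k)⁻¹) ^ 2 * invNormSq B (g (ξ k) (o2ncPoint H β η δ g w₀ ξ s k))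
      - η⁻¹ * ∑ k ∈ Finset.range (n + 1), (β ^ k)⁻¹ *
        ⟪g (ξ k) (o2ncPoint H β η δ g w₀ ξ s k), (o2ncState H β η δ g w₀ ξ s k).2.x⟫
      + t⁻¹ / 2 * invNormSq B (∑ k ∈ Finset.range (n + 1), (β ^ k)⁻¹ •
        (g (ξ k) (o2ncPoint H β η δ g w₀ ξ s k) - gradient f (o2ncPoint H β η δ g w₀ ξ s k)))
      + 5 / 2 * t) := by
  set M := ∑ k ∈ Finset.range (n + 1), (β ^ k)⁻¹ •
    (g (ξ k) (o2ncPoint H β η δ g w₀ ξ s k) - gradient f (o2ncPoint H β η δ g w₀ ξ s k)) with hM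
  set m := ∑ k ∈ Finset.range (n + 1), o2ncLoss H β η δ g w₀ ξ s k with hm
  have e : ∑ k ∈ Finset.range (n + 1),
      β ^ (n - k) • gradient f (o2ncPoint H β η δ g w₀ ξ s k) = β ^ n • (m + (-1 : ℝ) • M) := by
    rw [hm, hM, Finset.smul_sum (r := (-1 : ℝ)), ← Finset.sum_add_distrib, Finset.smul_sum]
    refine Finset.sum_congr rfl fun k hk => ?_
    have hk : k ≤ n := Nat.lt_succ_iff.1 (Finset.mem_range.1 hk)
    rw [pow_sub₀ β hβ₀.ne' hk, o2ncLoss]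
    module
  have hp : 0 < β ^ n := by positivity
  have h1 : dualNorm H (β ^ n • (m + (-1 : ℝ) • M)) ≤ β ^ n * (dualNorm H m + dualNorm H M) := by
    refine (hH.dualNorm_smul_le _ _).trans ?_
    rw [Real.norm_of_nonneg hp.le]
    refine mul_le_mul_of_nonneg_left ((hH.dualNorm_add_le _ _).trans ?_) hp.le
    have := hH.dualNorm_smul_le (-1) M
    rw [norm_neg, norm_one, one_mul] at this
    linarith
  rw [e]
  refine h1.trans (mul_le_mul_of_nonneg_left ?_ hp.le)
  have h2 := hH.two_mul_dualNorm_le_invNormSq hB hBH htr ht M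
  have h3 := regret_o2nc β η g w₀ ξ s hH hδ hB hBH htr ht hη.le (n + 1)
  have e1 : ∑ k ∈ Finset.range (n + 1), invNormSq B (o2ncLoss H β η δ g w₀ ξ s k) =
      ∑ k ∈ Finset.range (n + 1),
        ((β ^ k)⁻¹) ^ 2 * invNormSq B (g (ξ k) (o2ncPoint H β η δ g w₀ ξ s k)) :=
    Finset.sum_congr rfl fun k _ => invNormSq_smul B _ _
  have e2 : ∑ k ∈ Finset.range (n + 1),
      ⟪(o2ncState H β η δ g w₀ ξ s k).2.x, o2ncLoss H β η δ g w₀ ξ s k⟫ =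
      ∑ k ∈ Finset.range (n + 1), (β ^ k)⁻¹ *
        ⟪g (ξ k) (o2ncPoint H β η δ g w₀ ξ s k), (o2ncState H β η δ g w₀ ξ s k).2.x⟫ :=
    Finset.sum_congr rfl fun k _ => by
      rw [o2ncLoss, real_inner_smul_right, real_inner_comm]
  rw [e1, e2, ← hm] at h3
  have h4 := mul_le_mul_of_nonneg_left h3 (inv_nonneg.2 hη.le)
  rw [mul_add, inv_mul_cancel_left₀ hη.ne', mul_comm 2 η, mul_assoc, inv_mul_cancel_left₀ hη.ne']
    at h4
  linarith

variable [MeasurableSpace X] [BorelSpace X] {Ω : Type*} [MeasurableSpace Ω] [MeasurableSpace Ξ]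
  {D : Measure Ξ} {P : Measure Ω} [IsProbabilityMeasure D] [IsProbabilityMeasure P]

theorem isExponentialWalk_o2nc (hH : IsPreconditionerSpace H) (β : ℝ) {η δ : ℝ} (hη : 0 < η)
    (hδ : 0 < δ) {g : Ξ → X → X} (hg : Measurable (Function.uncurry g)) (w₀ : X)
    (ξ : ℕ → Ω → Ξ) (s : ℕ → Ω → ℝ) :
    IsExponentialWalk ξ s w₀ (Real.sqrt (η ^ 2 * Module.finrank ℝ X))
      (fun k ω => (o2ncState H β η δ g w₀ (fun k => ξ k ω) (fun k => s k ω) k).1)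
      (fun k ω => (o2ncState H β η δ g w₀ (fun k => ξ k ω) (fun k => s k ω) k).2.x) := by
  -- The measurability lemma is applied with `past ξ s n` as the σ-algebra on `Ω`, which gives
  -- adaptedness.
  have hm := fun n => @measurable_o2ncState X _ _ _ H _ _ Ξ Ω _ (past ξ s n) hH β η δ hδ g hg w₀
    ξ s n (fun k hk => measurable_fst.comp (measurable_past_pair ξ s hk))
    (fun k hk => measurable_snd.comp (measurable_past_pair ξ s hk))
  refine ⟨fun _ => rfl, fun _ _ => rfl, fun k => (hm k).1, fun k => (hm k).2.1, fun k ω => ?_⟩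
  exact Real.le_sqrt_of_sq_le (hH.norm_sq_le_of_primalNorm_le hη.le
    (primalNorm_o2ncState_x_le β η g w₀ _ _ hH hδ hη.le k))

variable {f : X → ℝ} {g : Ξ → X → X} {β η δ G : ℝ} {N : ℕ} {ξ : ℕ → Ω → Ξ} {s : ℕ → Ω → ℝ}
  {τ : Ω → ℕ}

/-- Expected dual norm of the exponentially weighted sum of the gradients. -/
theorem lintegral_dualNorm_gradient_sum_le (hH : IsPreconditionerSpace H) (hB : IsPosDef B)
    (hBH : B ∈ H) (htr : traceNorm B = 1) (hβ₀ : 0 < β) (hβ₁ : β < 1) (hη : 0 < η) (hδ : 0 < δ)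
    (hG : 0 < G) (hf : Differentiable ℝ f) (hg : IsStochasticGradient D f g B G)
    (h : IsO2NCSampling D P β N ξ s τ) (w₀ : X) {r : ℝ} (hr : 0 < r) (hr2 : r ^ 2 = (1 - β)⁻¹)
    (n : ℕ) :
    ∃ a : ℝ, 0 ≤ a ∧
      ∫⁻ ω, ENNReal.ofReal (dualNorm H (∑ k ∈ Finset.range (n + 1), β ^ (n - k) •
        gradient f (o2ncPoint H β η δ g w₀ (fun k => ξ k ω) (fun k => s k ω) k))) ∂P ≤
        ENNReal.ofReal a ∧
      a = 4 * (δ * Module.finrank ℝ X) * β ^ n + 5 * G * r -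
        η⁻¹ * (β ^ n * ∑ k ∈ Finset.range (n + 1), (β ^ k)⁻¹ *
          (∫ ω, f (o2ncState H β η δ g w₀ (fun k => ξ k ω) (fun k => s k ω) (k + 1)).1 ∂P -
            ∫ ω, f (o2ncState H β η δ g w₀ (fun k => ξ k ω) (fun k => s k ω) k).1 ∂P)) := by
  have hw := isExponentialWalk_o2nc hH β hη hδ hg.measurable w₀ ξ s
  have hp : 0 < β ^ n := by positivity
  -- This balances `t` against `t⁻¹` times the discounted second moments: after multiplication by
  -- `β^n`, the contributions are at most `2 G r`, `G r / 2` and `5 G r / 2`, together `5 G r`.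
  set t : ℝ := G * r * (β ^ n)⁻¹ with ht
  have ht0 : 0 < t := by positivity
  have hpath := fun ω => dualNorm_gradient_sum_le hH hB hBH htr hβ₀ hη hδ ht0 f g w₀
    (fun k => ξ k ω) (fun k => s k ω) n
  have hsq := fun k => hw.integrable_sq h hg hB k
  have hVi : ∀ k, Integrable (fun ω =>
      ‖(o2ncState H β η δ g w₀ (fun k => ξ k ω) (fun k => s k ω) k).2.x‖ ^ 2) P := fun k =>
    Integrable.of_bound ((hw.measurable_V' h k).norm.pow_const 2).aestronglyMeasurable
      (Real.sqrt (η ^ 2 * Module.finrank ℝ X) ^ 2) (Filter.Eventually.of_forall fun ω => by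
        rw [Real.norm_of_nonneg (sq_nonneg _)]
        exact pow_le_pow_left₀ (norm_nonneg _) (hw.bound k ω) 2)
  have hin := fun k => hw.integral_inner_past h hg hB (hw.measurable_V k) (hVi k)
  have hstep := fun k => (hw.integrable_W_and_step h hg hB hf k).2
  obtain ⟨hn1, hn2⟩ := hw.integral_noise_sum_sq_le h hg hB (fun k => (β ^ k)⁻¹) (n + 1)
  have i1 : Integrable (fun ω => ∑ k ∈ Finset.range (n + 1), ((β ^ k)⁻¹) ^ 2 *
      invNormSq B (g (ξ k ω) (o2ncPoint H β η δ g w₀ (fun k => ξ k ω) (fun k => s k ω) k))) P :=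
    integrable_finsetSum _ fun k _ => (hsq k).1.const_mul _
  have i2 : Integrable (fun ω => ∑ k ∈ Finset.range (n + 1), (β ^ k)⁻¹ *
      ⟪g (ξ k ω) (o2ncPoint H β η δ g w₀ (fun k => ξ k ω) (fun k => s k ω) k),
        (o2ncState H β η δ g w₀ (fun k => ξ k ω) (fun k => s k ω) k).2.x⟫) P :=
    integrable_finsetSum _ fun k _ => (hin k).1.const_mul _
  have s1 : ∫ ω, ∑ k ∈ Finset.range (n + 1), ((β ^ k)⁻¹) ^ 2 *
      invNormSq B (g (ξ k ω) (o2ncPoint H β η δ g w₀ (fun k => ξ k ω) (fun k => s k ω) k)) ∂P ≤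
      (∑ k ∈ Finset.range (n + 1), ((β ^ k)⁻¹) ^ 2) * G ^ 2 := by
    refine (integral_finsetSum _ fun k _ => (hsq k).1.const_mul _).trans_le ?_
    rw [Finset.sum_mul]
    refine Finset.sum_le_sum fun k _ => ?_
    rw [integral_const_mul]
    exact mul_le_mul_of_nonneg_left (hsq k).2 (sq_nonneg _)
  have s2 : ∫ ω, ∑ k ∈ Finset.range (n + 1), (β ^ k)⁻¹ *
      ⟪g (ξ k ω) (o2ncPoint H β η δ g w₀ (fun k => ξ k ω) (fun k => s k ω) k),
        (o2ncState H β η δ g w₀ (fun k => ξ k ω) (fun k => s k ω) k).2.x⟫ ∂P =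
      ∑ k ∈ Finset.range (n + 1), (β ^ k)⁻¹ *
        (∫ ω, f (o2ncState H β η δ g w₀ (fun k => ξ k ω) (fun k => s k ω) (k + 1)).1 ∂P -
          ∫ ω, f (o2ncState H β η δ g w₀ (fun k => ξ k ω) (fun k => s k ω) k).1 ∂P) := by
    refine (integral_finsetSum _ fun k _ => (hin k).1.const_mul _).trans ?_
    refine Finset.sum_congr rfl fun k _ => ?_
    rw [integral_const_mul, hstep k]
    exact congrArg _ (hin k).2.2
  rw [← Finset.sum_mul] at hn2
  set A := ∑ k ∈ Finset.range (n + 1), ((β ^ k)⁻¹) ^ 2 with hA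
  have hAle : (β ^ n) ^ 2 * A ≤ r ^ 2 := hr2 ▸ sum_inv_pow_sq_mul_le hβ₀ hβ₁ n
  have hA2 : β ^ n * (t⁻¹ * (A * G ^ 2)) ≤ G * r := by
    have e : β ^ n * (t⁻¹ * (A * G ^ 2)) = (β ^ n) ^ 2 * A * (G * r⁻¹) := by
      rw [ht]; field_simp
    rw [e]
    calc (β ^ n) ^ 2 * A * (G * r⁻¹) ≤ r ^ 2 * (G * r⁻¹) := by gcongr
      _ = G * r := by field_simp
  have hβt : β ^ n * t = G * r := by rw [ht]; field_simp
  let R : Ω → ℝ := fun ω => β ^ n * (4 * (δ * Module.finrank ℝ X)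
      + 2 * t⁻¹ * ∑ k ∈ Finset.range (n + 1), ((β ^ k)⁻¹) ^ 2 *
        invNormSq B (g (ξ k ω) (o2ncPoint H β η δ g w₀ (fun k => ξ k ω) (fun k => s k ω) k))
      - η⁻¹ * ∑ k ∈ Finset.range (n + 1), (β ^ k)⁻¹ *
        ⟪g (ξ k ω) (o2ncPoint H β η δ g w₀ (fun k => ξ k ω) (fun k => s k ω) k),
          (o2ncState H β η δ g w₀ (fun k => ξ k ω) (fun k => s k ω) k).2.x⟫
      + t⁻¹ / 2 * invNormSq B (∑ k ∈ Finset.range (n + 1), (β ^ k)⁻¹ •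
        (g (ξ k ω) (o2ncPoint H β η δ g w₀ (fun k => ξ k ω) (fun k => s k ω) k) -
          gradient f (o2ncPoint H β η δ g w₀ (fun k => ξ k ω) (fun k => s k ω) k)))
      + 5 / 2 * t)
  have j1 := (integrable_const (μ := P) (4 * (δ * Module.finrank ℝ X))).add (i1.const_mul (2 * t⁻¹))
  have j2 := j1.sub (i2.const_mul η⁻¹)
  have j3 := j2.add (hn1.const_mul (t⁻¹ / 2))
  have j4 := j3.add (integrable_const (5 / 2 * t))
  have hRi : Integrable R P := j4.const_mul (β ^ n)
  have hR : ∫ ω, R ω ∂P = β ^ n * (4 * (δ * Module.finrank ℝ X)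
      + 2 * t⁻¹ * ∫ ω, ∑ k ∈ Finset.range (n + 1), ((β ^ k)⁻¹) ^ 2 *
        invNormSq B (g (ξ k ω) (o2ncPoint H β η δ g w₀ (fun k => ξ k ω) (fun k => s k ω) k)) ∂P
      - η⁻¹ * ∫ ω, ∑ k ∈ Finset.range (n + 1), (β ^ k)⁻¹ *
        ⟪g (ξ k ω) (o2ncPoint H β η δ g w₀ (fun k => ξ k ω) (fun k => s k ω) k),
          (o2ncState H β η δ g w₀ (fun k => ξ k ω) (fun k => s k ω) k).2.x⟫ ∂P
      + t⁻¹ / 2 * ∫ ω, invNormSq B (∑ k ∈ Finset.range (n + 1), (β ^ k)⁻¹ •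
        (g (ξ k ω) (o2ncPoint H β η δ g w₀ (fun k => ξ k ω) (fun k => s k ω) k) -
          gradient f (o2ncPoint H β η δ g w₀ (fun k => ξ k ω) (fun k => s k ω) k))) ∂P
      + 5 / 2 * t) := by
    refine (integral_const_mul _ _).trans (congrArg _ ?_)
    refine (integral_add j3 (integrable_const _)).trans ?_
    refine (congrArg (· + _) (integral_add j2 (hn1.const_mul (t⁻¹ / 2)))).trans ?_
    refine (congrArg (· + _ + _) (integral_sub j1 (i2.const_mul η⁻¹))).trans ?_
    refine (congrArg (· - _ + _ + _) (integral_add (integrable_const _)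
      (i1.const_mul (2 * t⁻¹)))).trans ?_
    simp only [integral_const_mul, integral_const, probReal_univ, one_smul]
    rfl
  have hRle : ∫ ω, R ω ∂P ≤ 4 * (δ * Module.finrank ℝ X) * β ^ n + 5 * G * r -
        η⁻¹ * (β ^ n * ∑ k ∈ Finset.range (n + 1), (β ^ k)⁻¹ *
          (∫ ω, f (o2ncState H β η δ g w₀ (fun k => ξ k ω) (fun k => s k ω) (k + 1)).1 ∂P -
            ∫ ω, f (o2ncState H β η δ g w₀ (fun k => ξ k ω) (fun k => s k ω) k).1 ∂P)) := by
    rw [hR, s2]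
    have b1 := mul_le_mul_of_nonneg_left s1 (show 0 ≤ β ^ n * t⁻¹ by positivity)
    have b2 := mul_le_mul_of_nonneg_left hn2 (show 0 ≤ β ^ n * t⁻¹ by positivity)
    rw [mul_assoc (β ^ n) t⁻¹ (A * G ^ 2)] at b1 b2
    have b3 := b1.trans hA2
    have b4 := b2.trans hA2
    change β ^ n * t⁻¹ * ∫ ω, invNormSq B (∑ k ∈ Finset.range (n + 1), (β ^ k)⁻¹ •
        (g (ξ k ω) (o2ncPoint H β η δ g w₀ (fun k => ξ k ω) (fun k => s k ω) k) -
          gradient f (o2ncPoint H β η δ g w₀ (fun k => ξ k ω) (fun k => s k ω) k))) ∂P ≤ _ at b4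
    change β ^ n * t⁻¹ * ∫ ω, ∑ k ∈ Finset.range (n + 1), ((β ^ k)⁻¹) ^ 2 *
        invNormSq B (g (ξ k ω) (o2ncPoint H β η δ g w₀ (fun k => ξ k ω) (fun k => s k ω) k)) ∂P ≤ _
      at b3
    linarith
  have hR0 : ∀ ω, 0 ≤ R ω := fun ω => (hH.dualNorm_nonneg _).trans (hpath ω)
  refine ⟨_, (integral_nonneg hR0).trans hRle, ?_, rfl⟩
  calc _ ≤ ∫⁻ ω, ENNReal.ofReal (R ω) ∂P :=
        lintegral_mono fun ω => ENNReal.ofReal_le_ofReal (hpath ω)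
    _ = ENNReal.ofReal (∫ ω, R ω ∂P) :=
        (ofReal_integral_eq_lintegral_ofReal hRi (Filter.Eventually.of_forall hR0)).symm
    _ ≤ _ := ENNReal.ofReal_le_ofReal hRle

end DualBound

end O2NC

namespace O2NC

/-! ### Averages in the two seminorms. -/

section Averages

/-- The distance from `y` to the mean is at most the average distance from `y` to the points. So the
mean may be replaced by any convenient `y` at the price of a factor 2. -/
theorem sum_mul_seminorm_sub_average_le {X : Type*} [AddCommGroup X] [Module ℝ X]
    (q : Seminorm ℝ X) {ι : Type*} (t : Finset ι) {a : ι → ℝ} (ha : ∀ k, 0 ≤ a k)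
    (h1 : ∑ k ∈ t, a k = 1) (z : ι → X) (y : X) :
    ∑ k ∈ t, a k * q (z k - ∑ j ∈ t, a j • z j) ≤ 2 * ∑ k ∈ t, a k * q (z k - y) := by
  have h2 : q (y - ∑ j ∈ t, a j • z j) ≤ ∑ k ∈ t, a k * q (z k - y) := by
    have e : y - ∑ j ∈ t, a j • z j = ∑ j ∈ t, a j • (y - z j) := by
      simp only [smul_sub, Finset.sum_sub_distrib, ← Finset.sum_smul, h1, one_smul]
    rw [e]
    refine (Finset.le_sum_of_subadditive q (map_zero q).le (map_add_le_add q) t _).trans (Finset.sum_le_sum fun k _ => ?_)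
    rw [map_smul_eq_mul, Real.norm_of_nonneg (ha k), map_sub_rev]
  calc ∑ k ∈ t, a k * q (z k - ∑ j ∈ t, a j • z j)
      ≤ ∑ k ∈ t, (a k * q (z k - y) + a k * q (y - ∑ j ∈ t, a j • z j)) := by
        refine Finset.sum_le_sum fun k _ => ?_
        rw [← mul_add]
        refine mul_le_mul_of_nonneg_left ?_ (ha k)
        have := map_add_le_add q (z k - y) (y - ∑ j ∈ t, a j • z j)
        rwa [sub_add_sub_cancel] at this
    _ ≤ 2 * ∑ k ∈ t, a k * q (z k - y) := by
        rw [Finset.sum_add_distrib, ← Finset.sum_mul, h1]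
        linarith

variable {X : Type*} [NormedAddCommGroup X] [InnerProductSpace ℝ X] [FiniteDimensional ℝ X]
  {H : Submodule ℝ (X →ₗ[ℝ] X)} {B : X →ₗ[ℝ] X} {Ξ : Type*}

theorem o2ncAverage_eq_sum (H : Submodule ℝ (X →ₗ[ℝ] X)) (β η δ : ℝ) (g : Ξ → X → X) (w₀ : X)
    (ξ : ℕ → Ξ) (s : ℕ → ℝ) (n : ℕ) :
    o2ncAverage H β η δ g w₀ ξ s n =
      ∑ k ∈ Finset.range (n + 1), averageWeight β n k • o2ncPoint H β η δ g w₀ ξ s k := by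
  simp only [o2ncAverage, averageWeight, Finset.smul_sum, smul_smul]

theorem primalNorm_o2ncPoint_sub_le (hH : IsPreconditionerSpace H) (β : ℝ) {η δ : ℝ} (hη : 0 < η)
    (hδ : 0 < δ) (g : Ξ → X → X) (w₀ : X) (ξ : ℕ → Ξ) (s : ℕ → ℝ) (k m : ℕ) :
    primalNorm H (o2ncPoint H β η δ g w₀ ξ s k - o2ncPoint H β η δ g w₀ ξ s (k + m)) ≤
      ∑ i ∈ Finset.range m, η * |s (k + i + 1)| := by
  induction m with
  | zero =>
    have := map_zero hH.primalSeminorm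
    rw [hH.primalSeminorm_apply] at this
    simp [this]
  | succ m ih =>
    have e : o2ncPoint H β η δ g w₀ ξ s (k + (m + 1)) = o2ncPoint H β η δ g w₀ ξ s (k + m) +
      s (k + m + 1) • (o2ncState H β η δ g w₀ ξ s (k + m + 1)).2.x := rfl
    have h1 := hH.primalNorm_add_le
      (o2ncPoint H β η δ g w₀ ξ s k - o2ncPoint H β η δ g w₀ ξ s (k + m))
      ((-s (k + m + 1)) • (o2ncState H β η δ g w₀ ξ s (k + m + 1)).2.x)
    have h2 := hH.primalNorm_smul_le (-s (k + m + 1))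
      (o2ncState H β η δ g w₀ ξ s (k + m + 1)).2.x
    have h3 := mul_le_mul_of_nonneg_left
      (primalNorm_o2ncState_x_le β η g w₀ ξ s hH hδ hη.le (k + m + 1)) (abs_nonneg (s (k + m + 1)))
    rw [norm_neg, Real.norm_eq_abs] at h2
    rw [e, Finset.sum_range_succ, ← sub_sub, sub_eq_add_neg _ (s _ • _), ← neg_smul]
    linarith

/-- Convexity of the dual norm. It settles the case of small `G`, where every average of gradients
is already small. -/
theorem dualNorm_average_le (hH : IsPreconditionerSpace H) {a : ℕ → ℝ} (ha : ∀ k, 0 ≤ a k) {n : ℕ}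
    (h1 : ∑ k ∈ Finset.range n, a k = 1) {v : ℕ → X} {G : ℝ} (hv : ∀ k, dualNorm H (v k) ≤ G) :
    dualNorm H (∑ k ∈ Finset.range n, a k • v k) ≤ G := by
  have h2 := Finset.le_sum_of_subadditive hH.dualSeminorm (map_zero _).le (map_add_le_add _)
    (Finset.range n) fun k => a k • v k
  refine h2.trans ((Finset.sum_le_sum fun k _ => ?_).trans_eq (b := ∑ k ∈ Finset.range n, a k * G) ?_)
  · rw [map_smul_eq_mul, Real.norm_of_nonneg (ha k)]
    exact mul_le_mul_of_nonneg_left (hv k) (ha k)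
  · rw [← Finset.sum_mul, h1, one_mul]

end Averages

/-! ### Expected bounds for the output. -/

section Totals

variable {X : Type*} [NormedAddCommGroup X] [InnerProductSpace ℝ X] [FiniteDimensional ℝ X]
  [MeasurableSpace X] [BorelSpace X]
  {H : Submodule ℝ (X →ₗ[ℝ] X)} {B : X →ₗ[ℝ] X} {Ω Ξ : Type*} [MeasurableSpace Ω]
  [MeasurableSpace Ξ] {D : Measure Ξ} {P : Measure Ω} [IsProbabilityMeasure D]
  [IsProbabilityMeasure P] {f : X → ℝ} {g : Ξ → X → X} {β η δ G : ℝ} {N : ℕ} {ξ : ℕ → Ω → Ξ}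
  {s : ℕ → Ω → ℝ} {τ : Ω → ℕ}

theorem IsO2NCSampling.lintegral_output_le (h : IsO2NCSampling D P β N ξ s τ) (hβ₀ : 0 < β)
    (hβ₁ : β < 1) (hN : 0 < N) {Φ : ℕ → Ω → ENNReal}
    (hΦ : ∀ n, Measurable[past ξ s (n + 1)] (Φ n)) {b : ℕ → ℝ} (hb : ∀ n, 0 ≤ b n)
    (hΦb : ∀ n, ∫⁻ ω, Φ n ω ∂P ≤ ENNReal.ofReal (b n)) :
    ∫⁻ ω, Φ (τ ω) ω ∂P ≤ ENNReal.ofReal (∑ n ∈ Finset.range N, outputProb β N n * b n) := by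
  rw [h.lintegral_output hβ₀ hβ₁ hN hΦ, ENNReal.ofReal_sum_of_nonneg fun n _ =>
    mul_nonneg (outputProb_nonneg hβ₀ hβ₁ N n) (hb n)]
  refine Finset.sum_le_sum fun n _ => ?_
  rw [ENNReal.ofReal_mul (outputProb_nonneg hβ₀ hβ₁ N n)]
  exact mul_le_mul_right (hΦb n) _

theorem sum_outputProb_mul_div (hβ₀ : 0 < β) (hβ₁ : β < 1) (N : ℕ) (c : ℕ → ℝ) :
    ∑ n ∈ Finset.range N, outputProb β N n * ((1 - β) / (1 - β ^ (n + 1)) * c n) =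
      (1 - β) / N * ∑ n ∈ Finset.range N, outputWeight β N n * c n := by
  rw [Finset.mul_sum]
  refine Finset.sum_congr rfl fun n hn => ?_
  rw [← mul_assoc, outputProb_mul_eq hβ₀ hβ₁ (Finset.mem_range.1 hn)]
  ring

/-- Compare all points with the last one `w_n`: the expected distance of `w_k` from it is at most `η
(n - k)`, and `∑ j β^j ≤ (1 - β)⁻²`. -/
theorem lintegral_primalNorm_o2ncPoint_sub_le (hH : IsPreconditionerSpace H) (hη : 0 < η)
    (hδ : 0 < δ) (h : IsO2NCSampling D P β N ξ s τ) (w₀ : X) (g : Ξ → X → X)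
    (hβ₀ : 0 < β) (hβ₁ : β < 1) (n : ℕ) :
    ∫⁻ ω, ENNReal.ofReal (∑ k ∈ Finset.range (n + 1), averageWeight β n k *
      primalNorm H (o2ncPoint H β η δ g w₀ (fun k => ξ k ω) (fun k => s k ω) k -
        o2ncAverage H β η δ g w₀ (fun k => ξ k ω) (fun k => s k ω) n)) ∂P ≤
      ENNReal.ofReal ((1 - β) / (1 - β ^ (n + 1)) * (2 * η * ((1 - β) ^ 2)⁻¹)) := by
  have hq := averageWeight_nonneg hβ₀ hβ₁ n
  have hs : ∀ i, Integrable (fun ω => |s i ω|) P ∧ ∫ ω, |s i ω| ∂P = 1 := fun i => by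
    have h1 : Integrable (fun x : ℝ => |x|) (P.map (s i)) := by
      rw [h.map_s]; exact integrable_id_expMeasure.abs
    refine ⟨h1.comp_measurable (h.measurable_s i), ?_⟩
    rw [← integral_abs_expMeasure, ← h.map_s i]
    exact (integral_map (h.measurable_s i).aemeasurable h1.aestronglyMeasurable).symm
  let R : Ω → ℝ := fun ω => 2 * ∑ k ∈ Finset.range (n + 1), averageWeight β n k *
    ∑ i ∈ Finset.range (n - k), η * |s (k + i + 1) ω|
  have i1 : ∀ k, Integrable (fun ω => ∑ i ∈ Finset.range (n - k), η * |s (k + i + 1) ω|) P :=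
    fun k => integrable_finsetSum _ fun i _ => (hs _).1.const_mul _
  have hRi : Integrable R P := (integrable_finsetSum _ fun k _ => (i1 k).const_mul _).const_mul _
  have hle : ∀ ω, ∑ k ∈ Finset.range (n + 1), averageWeight β n k *
      primalNorm H (o2ncPoint H β η δ g w₀ (fun k => ξ k ω) (fun k => s k ω) k -
        o2ncAverage H β η δ g w₀ (fun k => ξ k ω) (fun k => s k ω) n) ≤ R ω := fun ω => by
    rw [o2ncAverage_eq_sum]
    refine (sum_mul_seminorm_sub_average_le hH.primalSeminorm (Finset.range (n + 1)) hq
      (sum_averageWeight hβ₀ hβ₁ n) _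
      (o2ncPoint H β η δ g w₀ (fun k => ξ k ω) (fun k => s k ω) n)).trans ?_
    refine mul_le_mul_of_nonneg_left (Finset.sum_le_sum fun k hk => ?_) two_pos.le
    refine mul_le_mul_of_nonneg_left ?_ (hq k)
    have hk : k ≤ n := Nat.lt_succ_iff.1 (Finset.mem_range.1 hk)
    have := primalNorm_o2ncPoint_sub_le hH β hη hδ g w₀ (fun k => ξ k ω) (fun k => s k ω) k (n - k)
    rwa [Nat.add_sub_cancel' hk] at this
  have hR : ∫ ω, R ω ∂P = (1 - β) / (1 - β ^ (n + 1)) * (2 * η *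
      ∑ k ∈ Finset.range (n + 1), β ^ (n - k) * ((n - k : ℕ) : ℝ)) := by
    refine (integral_const_mul _ _).trans ?_
    rw [integral_finsetSum _ fun k _ => (i1 k).const_mul _, Finset.mul_sum, Finset.mul_sum,
      Finset.mul_sum]
    refine Finset.sum_congr rfl fun k _ => ?_
    rw [integral_const_mul, integral_finsetSum _ fun i _ => (hs _).1.const_mul _]
    simp only [integral_const_mul, (hs _).2, Finset.sum_const, Finset.card_range, averageWeight]
    rw [nsmul_eq_mul]
    ring
  have hR0 : ∀ ω, 0 ≤ R ω := fun ω => mul_nonneg two_pos.le (Finset.sum_nonneg fun k _ =>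
    mul_nonneg (hq k) (Finset.sum_nonneg fun i _ => mul_nonneg hη.le (abs_nonneg _)))
  calc _ ≤ ∫⁻ ω, ENNReal.ofReal (R ω) ∂P :=
        lintegral_mono fun ω => ENNReal.ofReal_le_ofReal (hle ω)
    _ = ENNReal.ofReal (∫ ω, R ω ∂P) :=
        (ofReal_integral_eq_lintegral_ofReal hRi (Filter.Eventually.of_forall hR0)).symm
    _ ≤ _ := by
        refine ENNReal.ofReal_le_ofReal ?_
        rw [hR]
        have h1 := one_sub_pow_succ_pos hβ₀ hβ₁ n
        have h2 : 0 < 1 - β := by linarith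
        have h3 := sum_pow_sub_mul_le hβ₀ hβ₁ n
        gcongr

theorem measurable_o2ncPoint_past (hH : IsPreconditionerSpace H) (β : ℝ) (hη : 0 < η) (hδ : 0 < δ)
    (hg : Measurable (Function.uncurry g)) (w₀ : X) (ξ : ℕ → Ω → Ξ) (s : ℕ → Ω → ℝ) {k n : ℕ}
    (hk : k < n) : Measurable[past ξ s n]
      fun ω => o2ncPoint H β η δ g w₀ (fun k => ξ k ω) (fun k => s k ω) k :=
  ((isExponentialWalk_o2nc hH β hη hδ hg w₀ ξ s).measurable_W (k + 1)).mono
    (past_mono ξ s hk) le_rfl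

theorem measurable_o2ncAverage_past (hH : IsPreconditionerSpace H) (β : ℝ) (hη : 0 < η)
    (hδ : 0 < δ) (hg : Measurable (Function.uncurry g)) (w₀ : X) (ξ : ℕ → Ω → Ξ) (s : ℕ → Ω → ℝ)
    (n : ℕ) : Measurable[past ξ s (n + 1)]
      fun ω => o2ncAverage H β η δ g w₀ (fun k => ξ k ω) (fun k => s k ω) n := by
  simp only [o2ncAverage_eq_sum]
  exact Finset.measurable_fun_sum _ fun k hk =>
    (measurable_o2ncPoint_past hH β hη hδ hg w₀ ξ s (Finset.mem_range.1 hk)).const_smul _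

theorem measurable_primal_past (hH : IsPreconditionerSpace H) (β : ℝ) (hη : 0 < η)
    (hδ : 0 < δ) (hg : Measurable (Function.uncurry g)) (w₀ : X) (ξ : ℕ → Ω → Ξ) (s : ℕ → Ω → ℝ)
    (n : ℕ) : Measurable[past ξ s (n + 1)] fun ω =>
      ∑ k ∈ Finset.range (n + 1), averageWeight β n k *
        primalNorm H (o2ncPoint H β η δ g w₀ (fun k => ξ k ω) (fun k => s k ω) k -
        o2ncAverage H β η δ g w₀ (fun k => ξ k ω) (fun k => s k ω) n) :=
  Finset.measurable_fun_sum _ fun _ hk => (hH.continuous_primalNorm.measurable.comp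
    ((measurable_o2ncPoint_past hH β hη hδ hg w₀ ξ s (Finset.mem_range.1 hk)).sub
      (measurable_o2ncAverage_past hH β hη hδ hg w₀ ξ s n))).const_mul _

theorem measurable_dual_past (hH : IsPreconditionerSpace H) (β : ℝ) (hη : 0 < η)
    (hδ : 0 < δ) (f : X → ℝ) (hg : Measurable (Function.uncurry g)) (w₀ : X) (ξ : ℕ → Ω → Ξ)
    (s : ℕ → Ω → ℝ) (n : ℕ) : Measurable[past ξ s (n + 1)] fun ω =>
      dualNorm H (∑ k ∈ Finset.range (n + 1), averageWeight β n k •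
        gradient f (o2ncPoint H β η δ g w₀ (fun k => ξ k ω) (fun k => s k ω) k)) :=
  hH.continuous_dualNorm.measurable.comp (Finset.measurable_fun_sum _ fun _ hk =>
    ((measurable_gradient f).comp
      (measurable_o2ncPoint_past hH β hη hδ hg w₀ ξ s (Finset.mem_range.1 hk))).const_smul _)

/-- Expected distance of the query points from their moving average, at the output index. -/
theorem lintegral_primal_output_le (hH : IsPreconditionerSpace H) (hβ₀ : 0 < β) (hβ₁ : β < 1)
    (hη : 0 < η) (hδ : 0 < δ) (hg : Measurable (Function.uncurry g))
    (h : IsO2NCSampling D P β N ξ s τ) (w₀ : X) (hN : 0 < N) (hNβ : (1 - β)⁻¹ ≤ 2 * N) :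
    ∫⁻ ω, ENNReal.ofReal (∑ k ∈ Finset.range (τ ω + 1), averageWeight β (τ ω) k *
      primalNorm H (o2ncPoint H β η δ g w₀ (fun k => ξ k ω) (fun k => s k ω) k -
        o2ncOutput H β η δ g w₀ ξ s τ ω)) ∂P ≤ ENNReal.ofReal (6 * η / (1 - β)) := by
  have h2 : 0 < 1 - β := by linarith
  have hN' : (0 : ℝ) < N := by exact_mod_cast hN
  refine (h.lintegral_output_le hβ₀ hβ₁ hN
    (fun n => (measurable_primal_past hH β hη hδ hg w₀ ξ s n).ennreal_ofReal) (fun n => ?_)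
    (lintegral_primalNorm_o2ncPoint_sub_le hH hη hδ h w₀ g hβ₀ hβ₁)).trans
      (ENNReal.ofReal_le_ofReal ?_)
  · have h1 := one_sub_pow_succ_pos hβ₀ hβ₁ n
    positivity
  · rw [sum_outputProb_mul_div hβ₀ hβ₁ N, ← Finset.sum_mul]
    have h3 : ∑ n ∈ Finset.range N, outputWeight β N n ≤ 3 * N := by
      linarith [sum_outputWeight_le hβ₀ hβ₁ N]
    calc _ ≤ (1 - β) / N * (3 * N * (2 * η * ((1 - β) ^ 2)⁻¹)) := by gcongr
      _ = 6 * η / (1 - β) := by field_simp; norm_num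

/-- Expected dual norm of the averaged gradient, at the output index. -/
theorem lintegral_dual_output_le (hH : IsPreconditionerSpace H) (hB : IsPosDef B) (hBH : B ∈ H)
    (htr : traceNorm B = 1) (hβ₀ : 0 < β) (hβ₁ : β < 1) (hη : 0 < η) (hδ : 0 < δ) (hG : 0 < G)
    (hf : Differentiable ℝ f) (hfb : BddBelow (Set.range f)) (hg : IsStochasticGradient D f g B G)
    (h : IsO2NCSampling D P β N ξ s τ) (w₀ : X) (hN : 0 < N) (hNβ : (1 - β)⁻¹ ≤ N) :
    ∫⁻ ω, ENNReal.ofReal (dualNorm H (∑ k ∈ Finset.range (τ ω + 1), averageWeight β (τ ω) k •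
        gradient f (o2ncPoint H β η δ g w₀ (fun k => ξ k ω) (fun k => s k ω) k))) ∂P ≤
      ENNReal.ofReal (10 * G * Real.sqrt (1 - β) + 4 * (δ * Module.finrank ℝ X) / N +
        (f w₀ - ⨅ x, f x) / (η * N)) := by
  have h2 : 0 < 1 - β := by linarith
  have hN' : (0 : ℝ) < N := by exact_mod_cast hN
  set q := Real.sqrt (1 - β) with hqdef
  have hq : 0 < q := Real.sqrt_pos.2 h2
  have hq2 : q ^ 2 = 1 - β := Real.sq_sqrt h2.le
  choose a ha0 hale haeq using lintegral_dualNorm_gradient_sum_le (N := N) (τ := τ) hH hB hBH htr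
    hβ₀ hβ₁ hη hδ hG hf hg h w₀ (inv_pos.2 hq) (by rw [inv_pow, hq2])
  set F : ℕ → ℝ := fun k =>
    ∫ ω, f (o2ncState H β η δ g w₀ (fun k => ξ k ω) (fun k => s k ω) k).1 ∂P with hF
  refine (h.lintegral_output_le hβ₀ hβ₁ hN
    (fun n => (measurable_dual_past hH β hη hδ f hg.measurable w₀ ξ s n).ennreal_ofReal)
    (b := fun n => (1 - β) / (1 - β ^ (n + 1)) * a n) (fun n => ?_) (fun n => ?_)).trans
      (ENNReal.ofReal_le_ofReal ?_)
  · have h1 := one_sub_pow_succ_pos hβ₀ hβ₁ n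
    have := ha0 n
    positivity
  · have h1 := one_sub_pow_succ_pos hβ₀ hβ₁ n
    have h3 : 0 ≤ (1 - β) / (1 - β ^ (n + 1)) := by positivity
    rw [ENNReal.ofReal_mul h3]
    refine le_trans (lintegral_mono fun ω => ?_) ((lintegral_const_mul' _ _
      ENNReal.ofReal_ne_top).trans_le (mul_le_mul_right (hale n) _))
    rw [← ENNReal.ofReal_mul h3]
    refine ENNReal.ofReal_le_ofReal ?_
    have h4 := hH.dualNorm_smul_le ((1 - β) / (1 - β ^ (n + 1)))
      (∑ k ∈ Finset.range (n + 1), β ^ (n - k) •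
        gradient f (o2ncPoint H β η δ g w₀ (fun k => ξ k ω) (fun k => s k ω) k))
    rw [Finset.smul_sum, Real.norm_of_nonneg h3] at h4
    simpa only [smul_smul, averageWeight] using h4
  -- The only use of boundedness below: the total expected decrease of `f` over the run is at most
  -- the initial gap.
  · have hFN : F N - F 0 ≥ -(f w₀ - ⨅ x, f x) := by
      have hw := isExponentialWalk_o2nc hH β hη hδ hg.measurable w₀ ξ s
      obtain ⟨K, hK⟩ := hg.exists_norm_gradient_le hB
      have hi := (hw.integrable_W_and_step h hg hB hf N).1
      have hfi : Integrable (fun ω =>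
          f (o2ncState H β η δ g w₀ (fun k => ξ k ω) (fun k => s k ω) N).1) P := by
        refine (((hi.sub (integrable_const w₀)).norm.const_mul K).add
          (integrable_const |f w₀|)).mono' (hf.continuous.measurable.comp
            (hw.measurable_W' h N)).aestronglyMeasurable (Filter.Eventually.of_forall fun ω => ?_)
        have h4 := norm_image_sub_le_of_gradient_bound hf hK w₀
          (o2ncState H β η δ g w₀ (fun k => ξ k ω) (fun k => s k ω) N).1
        have h5 := abs_sub_abs_le_abs_sub
          (f (o2ncState H β η δ g w₀ (fun k => ξ k ω) (fun k => s k ω) N).1) (f w₀)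
        simp only [Real.norm_eq_abs, Pi.add_apply, Pi.sub_apply]
        linarith
      have h0 : F 0 = f w₀ := by simp [hF, o2ncState]
      have h6 : ⨅ x, f x ≤ F N := by
        have := integral_mono (integrable_const (μ := P) (⨅ x, f x)) hfi fun ω => ciInf_le hfb _
        simpa using this
      linarith
    -- Averaging over the output index turns the discounted decrements into an exact telescoping
    -- sum.
    have htel := sum_outputWeight_mul hβ₀ hβ₁ (fun k => F (k + 1) - F k) hN
    rw [Finset.sum_range_sub] at htel
    rw [sum_outputProb_mul_div hβ₀ hβ₁ N]
    have e : ∑ n ∈ Finset.range N, outputWeight β N n * a n =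
        4 * (δ * Module.finrank ℝ X) * (1 - β)⁻¹ +
          5 * G * q⁻¹ * ∑ n ∈ Finset.range N, outputWeight β N n -
          η⁻¹ * ((1 - β)⁻¹ * (F N - F 0)) := by
      rw [← htel, ← sum_outputWeight_mul_pow hβ₀ hβ₁ hN, Finset.mul_sum, Finset.mul_sum,
        Finset.mul_sum, ← Finset.sum_add_distrib, ← Finset.sum_sub_distrib]
      refine Finset.sum_congr rfl fun n _ => ?_
      rw [haeq n]
      ring
    have h3 : ∑ n ∈ Finset.range N, outputWeight β N n ≤ 2 * N := by
      linarith [sum_outputWeight_le hβ₀ hβ₁ N]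
    have h4 : -(F N - F 0) ≤ f w₀ - ⨅ x, f x := by linarith
    calc _ = (1 - β) / N * (4 * (δ * Module.finrank ℝ X) * (1 - β)⁻¹ +
          5 * G * q⁻¹ * ∑ n ∈ Finset.range N, outputWeight β N n +
          η⁻¹ * ((1 - β)⁻¹ * -(F N - F 0))) := by rw [e]; ring
      _ ≤ (1 - β) / N * (4 * (δ * Module.finrank ℝ X) * (1 - β)⁻¹ +
          5 * G * q⁻¹ * (2 * N) + η⁻¹ * ((1 - β)⁻¹ * (f w₀ - ⨅ x, f x))) := by gcongr
      _ = _ := by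
        rw [← hq2]
        field_simp
        ring

end Totals

end O2NC

namespace O2NC

/-! ### From bounds in expectation to stationarity. -/

section Stationarity

variable {X : Type*} [NormedAddCommGroup X] [InnerProductSpace ℝ X] [FiniteDimensional ℝ X]
  [MeasurableSpace X] [BorelSpace X]
  {H : Submodule ℝ (X →ₗ[ℝ] X)} {Ω : Type*} [MeasurableSpace Ω] {P : Measure Ω}

theorem measure_lt_ofReal_le {φ : Ω → ℝ} (hφ : Measurable φ) {a c : ℝ} (hc : 0 < c)
    (h : ∫⁻ ω, ENNReal.ofReal (φ ω) ∂P ≤ ENNReal.ofReal (a * c)) :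
    P {ω | c < φ ω} ≤ ENNReal.ofReal a := by
  have hc' : ENNReal.ofReal c ≠ 0 := (ENNReal.ofReal_pos.2 hc).ne'
  have h1 := mul_meas_ge_le_lintegral (μ := P) hφ.ennreal_ofReal (ENNReal.ofReal c)
  have h2 : P {ω | c < φ ω} ≤ P {ω | ENNReal.ofReal c ≤ ENNReal.ofReal (φ ω)} :=
    measure_mono fun ω (hω : c < φ ω) => ENNReal.ofReal_le_ofReal hω.le
  have h3 := (mul_le_mul_right h2 (ENNReal.ofReal c)).trans (h1.trans h)
  rw [mul_comm a, ENNReal.ofReal_mul hc.le] at h3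
  exact (ENNReal.mul_le_mul_iff_right hc' ENNReal.ofReal_ne_top).1 h3

/-- Bounds in expectation for a random finitely supported distribution give stationarity in
expectation and, by Markov's inequality, with high probability. -/
theorem isStationary_of_lintegral_le (hH : IsPreconditionerSpace H) (f : X → ℝ) {γ ε a : ℝ}
    (hγ : 0 < γ) (hε : 0 < ε) (ha₀ : 0 ≤ a) (ha₁ : a ≤ 1) {q : ℕ → ℕ → ℝ} (hq : ∀ n k, 0 ≤ q n k)
    (hq1 : ∀ n, ∑ k ∈ Finset.range (n + 1), q n k = 1) {z : ℕ → Ω → X} (hz : ∀ k, Measurable (z k))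
    {τ : Ω → ℕ} (hτ : Measurable τ) {xhat : Ω → X}
    (hx : ∀ ω, ∑ k ∈ Finset.range (τ ω + 1), q (τ ω) k • z k ω = xhat ω)
    (hd : ∫⁻ ω, ENNReal.ofReal (dualNorm H (∑ k ∈ Finset.range (τ ω + 1),
      q (τ ω) k • gradient f (z k ω))) ∂P ≤ ENNReal.ofReal (a * ε))
    (hp : ∫⁻ ω, ENNReal.ofReal (∑ k ∈ Finset.range (τ ω + 1),
      q (τ ω) k * primalNorm H (z k ω - xhat ω)) ∂P ≤ ENNReal.ofReal (a * γ)) :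
    IsStationaryInExpectation P H f γ ε xhat ∧
      P {ω | ¬ IsStationary H f γ ε (xhat ω)} ≤ ENNReal.ofReal (2 * a) := by
  have hxm : Measurable xhat := by
    have h1 : Measurable fun ω => ∑ k ∈ Finset.range (τ ω + 1), q (τ ω) k • z k ω :=
      measurable_comp_index hτ (F := fun n ω => ∑ k ∈ Finset.range (n + 1), q n k • z k ω)
        fun n => Finset.measurable_fun_sum _ fun k _ => (hz k).const_smul _
    exact (funext hx : _ = xhat) ▸ h1
  -- The same random mixture witnesses stationarity in expectation and, pathwise off two exceptional
  -- events, stationarity of the output.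
  let Q : Ω → Measure X := fun ω => mixture (q (τ ω)) (fun k => z k ω) (τ ω)
  have hQm : Measurable Q := measurable_comp_index hτ
    (F := fun n ω => mixture (q n) (fun k => z k ω) n) fun n => measurable_mixture (q n) hz n
  have hQp : ∀ ω, IsProbabilityMeasure (Q ω) := fun ω =>
    isProbabilityMeasure_mixture (hq _) (hq1 _) _
  have hmean : ∀ ω, ∫ x, x ∂(Q ω) = xhat ω := fun ω => by
    rw [← hx]; exact integral_mixture (hq _) _ _ _
  have hgrad : ∀ ω, ∫ x, gradient f x ∂(Q ω) =
      ∑ k ∈ Finset.range (τ ω + 1), q (τ ω) k • gradient f (z k ω) := fun ω =>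
    integral_mixture (hq _) _ _ _
  have hpri : ∀ ω, ∫ x, primalNorm H (x - xhat ω) ∂(Q ω) =
      ∑ k ∈ Finset.range (τ ω + 1), q (τ ω) k * primalNorm H (z k ω - xhat ω) := fun ω =>
    integral_mixture (hq _) _ _ _
  constructor
  · refine ⟨⟨Q, hQm⟩, ⟨hQp⟩, Filter.Eventually.of_forall fun ω =>
      ⟨integrable_mixture _ _ _ _, integrable_mixture _ _ _ _, hmean ω⟩, ?_, ?_⟩
    · change ∫⁻ ω, ENNReal.ofReal (dualNorm H (∫ x, gradient f x ∂(Q ω))) ∂P ≤ _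
      simp only [hgrad]
      exact hd.trans (ENNReal.ofReal_le_ofReal (mul_le_of_le_one_left hε.le ha₁))
    · change ∫⁻ ω, ∫⁻ x, ENNReal.ofReal (primalNorm H (x - xhat ω)) ∂(Q ω) ∂P ≤ _
      have e : ∀ ω, ∫⁻ x, ENNReal.ofReal (primalNorm H (x - xhat ω)) ∂(Q ω) =
          ENNReal.ofReal (∑ k ∈ Finset.range (τ ω + 1),
            q (τ ω) k * primalNorm H (z k ω - xhat ω)) := fun ω =>
        lintegral_ofReal_mixture (hq _) _ _ (φ := fun x => primalNorm H (x - xhat ω))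
          fun x => hH.primalNorm_nonneg _
      simp only [e]
      exact hp.trans (ENNReal.ofReal_le_ofReal (mul_le_of_le_one_left hγ.le ha₁))
  · set d : Ω → ℝ := fun ω => dualNorm H (∑ k ∈ Finset.range (τ ω + 1),
      q (τ ω) k • gradient f (z k ω)) with hdef
    set r : Ω → ℝ := fun ω => ∑ k ∈ Finset.range (τ ω + 1),
      q (τ ω) k * primalNorm H (z k ω - xhat ω) with hr
    have hdm : Measurable d := hH.continuous_dualNorm.measurable.comp (measurable_comp_index hτ
      (F := fun n ω => ∑ k ∈ Finset.range (n + 1), q n k • gradient f (z k ω)) fun n =>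
        Finset.measurable_fun_sum _ fun k _ => ((measurable_gradient f).comp (hz k)).const_smul _)
    have hrm : Measurable r := measurable_comp_index hτ
      (F := fun n ω => ∑ k ∈ Finset.range (n + 1), q n k * primalNorm H (z k ω - xhat ω)) fun n =>
        Finset.measurable_fun_sum _ fun k _ =>
          (hH.continuous_primalNorm.measurable.comp ((hz k).sub hxm)).const_mul _
    have hsub : {ω | ¬ IsStationary H f γ ε (xhat ω)} ⊆ {ω | ε < d ω} ∪ {ω | γ < r ω} := by
      intro ω hω
      by_contra hn
      simp only [Set.mem_union, Set.mem_ofPred_eq, not_or, not_lt] at hn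
      exact hω ⟨Q ω, hQp ω, integrable_mixture _ _ _ _, integrable_mixture _ _ _ _,
        integrable_mixture _ _ _ _, hmean ω, (hgrad ω).symm ▸ hn.1, (hpri ω).trans_le hn.2⟩
    calc P {ω | ¬ IsStationary H f γ ε (xhat ω)} ≤ P {ω | ε < d ω} + P {ω | γ < r ω} :=
          (measure_mono hsub).trans (measure_union_le _ _)
      _ ≤ ENNReal.ofReal a + ENNReal.ofReal a := add_le_add
          (measure_lt_ofReal_le hdm hε hd) (measure_lt_ofReal_le hrm hγ hp)
      _ = ENNReal.ofReal (2 * a) := by rw [← ENNReal.ofReal_add ha₀ ha₀, two_mul]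

end Stationarity

end O2NC

/-! ### Choice of the parameters and conclusion. -/

theorem mainTheorem5 (p : ℝ) (hp₀ : 0 < p) (hp₁ : p < 1) :
    ∃ C : ℝ, 0 < C ∧ ∀ G γ ε : ℝ, 0 < G → 0 < γ → 0 < ε →
      ∃ β η : ℝ, 0 < β ∧ β < 1 ∧ 0 < η ∧
        ∀ (X : Type*) [NormedAddCommGroup X] [InnerProductSpace ℝ X] [FiniteDimensional ℝ X]
          [MeasurableSpace X] [BorelSpace X]
          (H : Submodule ℝ (X →ₗ[ℝ] X)) (_ : IsPreconditionerSpace H)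
          (B : X →ₗ[ℝ] X) (_ : B ∈ H) (_ : IsPosDef B) (_ : traceNorm B = 1)
          (f : X → ℝ) (_ : Differentiable ℝ f) (_ : BddBelow (Set.range f))
          (Ξ : Type*) [MeasurableSpace Ξ] (D : Measure Ξ) [IsProbabilityMeasure D]
          (g : Ξ → X → X) (_ : IsStochasticGradient D f g B G)
          (x₀ : X) (δ : ℝ) (_ : 0 < δ) (N : ℕ)
          (_ : C * ((f x₀ - ⨅ x, f x) * G ^ 2 / (γ * ε ^ 3) + G ^ 2 / ε ^ 2
                  + δ * Module.finrank ℝ X / ε) ≤ N ∨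
               (δ * Module.finrank ℝ X ≤ G ^ 2 / ε ∧
                C * ((f x₀ - ⨅ x, f x) * G ^ 2 / (γ * ε ^ 3) + G ^ 2 / ε ^ 2) ≤ N))
          (Ω : Type*) [MeasurableSpace Ω] (P : Measure Ω) [IsProbabilityMeasure P]
          (ξ : ℕ → Ω → Ξ) (s : ℕ → Ω → ℝ) (τ : Ω → ℕ) (_ : IsO2NCSampling D P β N ξ s τ),
          IsStationaryInExpectation P H f γ ε (o2ncOutput H β η δ g x₀ ξ s τ) ∧
          P {ω | ¬ IsStationary H f γ ε (o2ncOutput H β η δ g x₀ ξ s τ ω)} ≤ ENNReal.ofReal p := by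
  -- Both expectations are driven to a fraction `a` of their targets; Markov's inequality and the
  -- union bound then lose `2 a = p`.
  set a := p / 2 with ha
  have ha0 : 0 < a := by positivity
  have ha1 : a < 1 := by rw [ha]; linarith
  have hp2 : p = 2 * a := by rw [ha]; ring
  refine ⟨9600 / a ^ 4, by positivity, fun G γ ε hG hγ hε => ?_⟩
  -- Here `u = 1 - β`. The formula makes `10 G √u = a ε / 2`, but it need not give `u < 1` when `G`
  -- is small; in that case gradients have dual norm at most `a ε` anyway and `u = 1 / 2` will do.
  obtain ⟨u, hu0, hu1, hu⟩ : ∃ u : ℝ, 0 < u ∧ u < 1 ∧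
      ((G ≤ a * ε ∧ u = 1 / 2) ∨ u = (a * ε / (20 * G)) ^ 2) := by
    by_cases h : G ≤ a * ε
    · exact ⟨1 / 2, by norm_num, by norm_num, Or.inl ⟨h, rfl⟩⟩
    · refine ⟨(a * ε / (20 * G)) ^ 2, by positivity, ?_, Or.inr rfl⟩
      refine pow_lt_one₀ (by positivity) ?_ two_ne_zero
      rw [div_lt_one (by positivity)]
      linarith
  -- This `η` makes the primal bound `6 η / u` exactly `a γ`.
  have hη : 0 < a * γ * u / 6 := by positivity
  refine ⟨1 - u, a * γ * u / 6, by linarith, by linarith, hη, ?_⟩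
  intro X _ _ _ _ _ H hH B hBH hB htr f hf hfb Ξ _ D _ g hg x₀ δ hδ N hN Ω _ P _ ξ s τ hτ
  have hβ₀ : 0 < 1 - u := by linarith
  have hβ₁ : 1 - u < 1 := by linarith
  have hΔ : 0 ≤ f x₀ - ⨅ x, f x := sub_nonneg.2 (ciInf_le hfb x₀)
  set Δ := f x₀ - ⨅ x, f x with hΔdef
  set d := δ * Module.finrank ℝ X with hd
  have hd0 : 0 ≤ d := by positivity
  have hC : 0 < 9600 / a ^ 4 := by positivity
  have t1 : 0 ≤ Δ * G ^ 2 / (γ * ε ^ 3) := by positivity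
  have t2 : 0 < G ^ 2 / ε ^ 2 := by positivity
  have t3 : 0 ≤ d / ε := by positivity
  obtain ⟨n1, n2, n3⟩ : 9600 / a ^ 4 * (Δ * G ^ 2 / (γ * ε ^ 3)) ≤ N ∧
      9600 / a ^ 4 * (G ^ 2 / ε ^ 2) ≤ N ∧ 9600 / a ^ 4 * (d / ε) ≤ N := by
    have c1 := mul_nonneg hC.le t1
    have c2 := mul_nonneg hC.le t2.le
    have c3 := mul_nonneg hC.le t3
    rcases hN with hN | ⟨hdG, hN⟩
    · rw [mul_add, mul_add] at hN
      exact ⟨by linarith, by linarith, by linarith⟩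
    · rw [mul_add] at hN
      -- In the dimension-free alternative the term with `δ` is dominated by the middle term of the
      -- iteration bound.
      have c4 : d / ε ≤ G ^ 2 / ε ^ 2 := by
        rw [sq ε, ← div_div]
        gcongr
      have c5 := mul_le_mul_of_nonneg_left c4 hC.le
      exact ⟨by linarith, by linarith, by linarith⟩
  have hNpos : (0 : ℝ) < N := (mul_pos hC t2).trans_le n2
  have hN0 : 0 < N := by exact_mod_cast hNpos
  have ha4 : a ^ 4 ≤ a ^ 2 := pow_le_pow_of_le_one ha0.le ha1.le (by norm_num)
  have ha41 : a ^ 4 ≤ a := pow_le_of_le_one ha0.le ha1.le (by norm_num)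
  have e1u : 1 - (1 - u) = u := by ring
  -- The factor 2 is needed for `u = 1 / 2`, where only `N ≥ 1` is available.
  have hprim : (1 - (1 - u))⁻¹ ≤ 2 * N := by
    rw [e1u]
    rcases hu with ⟨_, hu⟩ | hu
    · have : (1 : ℝ) ≤ N := by exact_mod_cast hN0
      rw [hu]
      linarith
    · have h1 : u⁻¹ ≤ 9600 / a ^ 4 * (G ^ 2 / ε ^ 2) := by
        have : u⁻¹ = 400 / a ^ 2 * (G ^ 2 / ε ^ 2) := by rw [hu]; field_simp; ring
        rw [this]
        gcongr
        norm_num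
      linarith
  have key := isStationary_of_lintegral_le (P := P) hH f hγ hε ha0.le ha1.le
    (averageWeight_nonneg hβ₀ hβ₁) (sum_averageWeight hβ₀ hβ₁)
    (z := fun k ω => o2ncPoint H (1 - u) (a * γ * u / 6) δ g x₀ (fun k => ξ k ω) (fun k => s k ω) k)
    (fun k => (measurable_o2ncPoint_past hH (1 - u) hη hδ hg.measurable x₀ ξ s
      (Nat.lt_succ_self k)).mono (hτ.past_le _) le_rfl) hτ.measurable_τ
    (xhat := o2ncOutput H (1 - u) (a * γ * u / 6) δ g x₀ ξ s τ)
    (fun ω => (o2ncAverage_eq_sum _ _ _ _ _ _ _ _ _).symm)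
  rw [hp2]
  refine key ?_ ((lintegral_primal_output_le hH hβ₀ hβ₁ hη hδ hg.measurable hτ x₀ hN0 hprim).trans
    (ENNReal.ofReal_le_ofReal ?_))
  · rcases hu with ⟨hGa, hu⟩ | hu
    · refine (lintegral_mono fun ω => ENNReal.ofReal_le_ofReal
        ((dualNorm_average_le hH (averageWeight_nonneg hβ₀ hβ₁ _) (sum_averageWeight hβ₀ hβ₁ _)
          fun k => hH.dualNorm_le_of_invNormSq_le hB hBH htr hG
            (hg.invNormSq_gradient_le hB _)).trans hGa)).trans ?_
      simp
    · have hu' : u⁻¹ = 400 / a ^ 2 * (G ^ 2 / ε ^ 2) := by rw [hu]; field_simp; ring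
      have hNu : (1 - (1 - u))⁻¹ ≤ N := by
        rw [e1u, hu']
        refine le_trans ?_ n2
        gcongr
        norm_num
      refine (lintegral_dual_output_le hH hB hBH htr hβ₀ hβ₁ hη hδ hG hf hfb hg hτ x₀ hN0 hNu).trans
        (ENNReal.ofReal_le_ofReal ?_)
      rw [e1u, ← hΔdef, ← hd]
      -- The dual budget `a ε` is split as `1/2` for the noise and `1/4` each for the `δ` term and
      -- the function gap.
      have b1 : 10 * G * Real.sqrt u = a * ε / 2 := by
        rw [hu, Real.sqrt_sq (by positivity)]
        field_simp
        norm_num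
      have b2 : 4 * d / N ≤ a * ε / 4 := by
        rw [div_le_iff₀ hNpos]
        have : 16 / a * (d / ε) ≤ N := by
          refine le_trans ?_ n3
          gcongr
          norm_num
        calc 4 * d = a * ε / 4 * (16 / a * (d / ε)) := by field_simp; ring
          _ ≤ a * ε / 4 * N := by gcongr
      -- This term fixes the constant: substituting `u` requires `24 · 400 = 9600` over `a ^ 4`.
      have b3 : Δ / (a * γ * u / 6 * N) ≤ a * ε / 4 := by
        rw [div_le_iff₀ (by positivity)]
        calc Δ = a * ε / 4 * (a * γ * u / 6 * (9600 / a ^ 4 * (Δ * G ^ 2 / (γ * ε ^ 3)))) := by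
              rw [hu]; field_simp; ring
          _ ≤ a * ε / 4 * (a * γ * u / 6 * N) := by gcongr
      linarith
  · rw [e1u]
    apply le_of_eq
    field_simp
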